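/- **Polygons.** A polygon is a set $\Delta\subset\mathbb R^2$ with nonempty interior that is the intersection of finitely or infinitely many closed half-planes and has only finitely many vertices in each compact set (it may be noncompact, with infinitely many vertices); it is rational if each edge is directed along a nonzero integer vector. It has everywhere finite height if $\Delta\cap\ell$ is compact or empty for each vertical line $\ell$. Write $\ell_\lambda=\{x=\lambda\}$, and $\partial^{\rm top}\Delta$ for the set of $(x_0,y_0)$ with $y_0=\sup\{y:(x_0,y)\in\Delta\}$. Let $T=\begin{pmatrix}1&1\\0&1\end{pmatrix}$. If $u,v\in\mathbb Z^2$ are the primitive inward normals of the two edges at a vertex $p$, in positive order, then $p$ is Delzant if $\det(u,v)=1$, hidden if $p\in\partial^{\rm top}\Delta$ and $\det(u,Tv)=1$, and fake if $p\in\partial^{\rm top}\Delta$ and $\det(u,Tv)=0$. A labeled weighted polygon of complexity $m\ge 0$ is $(\Delta,(\ell_{\lambda_j},\varepsilon_j,k_j)_{j=1}^m)$ with $\Delta$ a rational polygon, $\varepsilon_j=\pm1$, $k_j\in\mathbb Z$ and $\inf_\Delta x<\lambda_1<\dots<\lambda_m<\sup_\Delta x$. It is a primitive semitoric polygon if $\Delta$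 has everywhere finite height, all $\varepsilon_j=+1$, each $\ell_{\lambda_j}$ meets $\partial^{\rm top}\Delta$, every point of $\partial^{\rm top}\Delta\cap\ell_{\lambda_j}$ is a vertex that is hidden or fake, and all other vertices are Delzant; $\vec k=(k_j)$ is its twisting index. Let $t_{\ell_\lambda}^k$ be the identity for $x\le\lambda$ and $(x,y)\mapsto(x,y+k(x-\lambda))$ for $x\ge\lambda$, and let $t_{\vec\lambda}^{\vec u}=t_{\ell_{\lambda_1}}^{u_1}\circ\dots\circ t_{\ell_{\lambda_m}}^{u_m}$. The element $((\varepsilon'_j)_j,(T^t)^k)$ of $\{-1,1\}^m\times\{(T^t)^k:k\in\mathbb Z\}$ sends $(\Delta,(\ell_{\lambda_j},\varepsilon_j,k_j)_j)$ to $(t_{\vec\lambda}^{\vec u}((T^t)^k\Delta),(\ell_{\lambda_j},\varepsilon'_j\varepsilon_j,k+k_j)_j)$, where $u_j=\frac{\varepsilon_j-\varepsilon_j\varepsilon'_j}{2}$. For $\vec k\in\mathbb Z^m$, $\mathcal D\mathrm{Polyg}_{m,\vec k}$ is the set of orbits of primitive semitoric polygons with twisting index $\vec k$; the orbits of all primitive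 semitoric polygons are the semitoric polygons. **Metrics.** Let $\nu$ be an admissible measure on $\mathbb R^2$: mutually absolutely continuous with Lebesgue measure, with density $g(x)$ depending only on $x$, where $xg(x)\in L^1(\mathbb R)$ and $g$ is bounded and bounded away from zero on compact intervals. Let $(b_n)_{n\ge0}$ be positive with $\sum_n n b_n<\infty$. On $\mathcal D\mathrm{Polyg}_{m,\vec k}$ put $$d^\nu_{\mathcal P}([\Delta_w],[\Delta'_w])=\sum_{\vec u\in\{0,1\}^m}\nu\big(t^{\vec u}_{\vec\lambda}(\Delta)\,\triangle\,t^{\vec u}_{\vec\lambda'}(\Delta')\big),$$ computed on primitive representatives with twisting index $\vec k$. These are unique if $m>0$; if $m=0$ (where the sum is $\nu(\Delta\,\triangle\,\Delta')$), take the infimum over the primitive representatives $(T^t)^c\Delta$, $c\in\mathbb Z$, of each orbit. Let $\mathbb R[[X,Y]]_0$ be the set of real power series $S=\sum\sigma_{i,j}X^iY^j$ with $\sigma_{0,0}=0$ and $\sigma_{0,1}\in[0,2\pi)$, with $$d(S,S')=\sum_{(i,j)\ne(0,1)}\min\{|\sigma_{i,j}-\sigma'_{i,j}|,b_{i+j}\}+\min\{|\sigma_{0,1}-\sigma'_{0,1}|,\,2\pi-|\sigma_{0,1}-\sigma'_{0,1}|,\,b_1\}.$$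 **Ingredients.** A semitoric list of ingredients consists of $m\ge0$, a semitoric polygon $[\Delta_w]$ of complexity $m$, reals $h_1,\dots,h_m$ with $0<h_j<\mathrm{length}(\pi_2(\Delta\cap\ell_{\lambda_j}))$ for its primitive representatives (where $\pi_2(x,y)=y$), and $S_1,\dots,S_m\in\mathbb R[[X,Y]]_0$. Let $\mathcal M$ be the set of all of them, $\mathcal M_{m}$ the subset of complexity $m$, and $\mathcal M_{m,\vec k}\subset\mathcal M_m$ the subset with $[\Delta_w]\in\mathcal D\mathrm{Polyg}_{m,\vec k}$, with distance $d^\nu_{\mathcal P}([\Delta_w],[\Delta'_w])+\sum_j\big(d(S_j,S'_j)+|h_j-h'_j|\big)$. (If $\vec k-\vec k'$ is constant, then $\mathcal M_{m,\vec k}=\mathcal M_{m,\vec k'}$.) Give $\mathcal M$ the disjoint union topology of the $\mathcal M_{m,\vec k}$: a set is open iff its intersection with every $\mathcal M_{m,\vec k}$ is open there. **Statement.** For every admissible $\nu$ and every such $(b_n)$: 1. for all $m\ge0$ and $\vec k\in\mathbb Z^m$, $\mathcal D\mathrm{Polyg}_{m,\vec k}$ is path-connected in the topology induced by $d^\nu_{\mathcal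 P}$; 2. for all $m\ge0$ and $\vec k\in\mathbb Z^m$, $\mathcal M_{m,\vec k}$ is path-connected, both in the topology of its distance and as a subset of $\mathcal M$; 3. the set of connected components of $\mathcal M$ is $\{\mathcal M_{m,\vec k}: m>0,\ \vec k\in\mathbb Z^m,\ k_1=0\}\cup\{\mathcal M_0\}$. -/

import Mathlib

open scoped ENNReal

noncomputable section

namespace Semitoric

/-! ## Polygons in the plane -/

/-- The vertical line `x = c`. -/
def verticalLine (c : ℝ) : Set (ℝ × ℝ) := {p | p.1 = c}

/-- The standard pairing of a (co)vector with a point of the plane. -/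
def dot (n p : ℝ × ℝ) : ℝ := n.1 * p.1 + n.2 * p.2

/-- The set of points of `Δ` at which the linear form `dot n` is minimal on `Δ`. For a closed convex
set `Δ` with nonempty interior and `n ≠ 0` it is an edge of `Δ`, with inward normal `n`, exactly when
it has at least two points. -/
def face (Δ : Set (ℝ × ℝ)) (n : ℝ × ℝ) : Set (ℝ × ℝ) :=
  {p | p ∈ Δ ∧ ∀ q ∈ Δ, dot n p ≤ dot n q}

/-- The vertices (corner points) of a convex set. -/
def vertices (Δ : Set (ℝ × ℝ)) : Set (ℝ × ℝ) := Set.extremePoints ℝ Δ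

/-- A two-dimensional (convex, possibly noncompact) polygon: an intersection of finitely or infinitely
many closed half-planes, with nonempty interior and with finitely many vertices in each compact set. -/
structure IsPolygon (Δ : Set (ℝ × ℝ)) : Prop where
  inter_halfPlanes : ∃ H : Set ((ℝ × ℝ) × ℝ), (∀ h ∈ H, h.1 ≠ 0) ∧ Δ = {p | ∀ h ∈ H, h.2 ≤ dot h.1 p}
  interior_nonempty : (interior Δ).Nonempty
  finite_vertices : ∀ K : Set (ℝ × ℝ), IsCompact K → (vertices Δ ∩ K).Finite

/-- Every edge is directed along a nonzero integer vector. -/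
def IsRational (Δ : Set (ℝ × ℝ)) : Prop :=
  ∀ n : ℝ × ℝ, n ≠ 0 → (face Δ n).Nontrivial →
    ∃ w : ℤ × ℤ, w ≠ 0 ∧ dot n ((w.1 : ℝ), (w.2 : ℝ)) = 0

/-- The top boundary of `Δ`. -/
def topBoundary (Δ : Set (ℝ × ℝ)) : Set (ℝ × ℝ) :=
  {p | IsLUB {y : ℝ | (p.1, y) ∈ Δ} p.2}

/-- The intersection with each vertical line is compact (possibly empty). -/
def EverywhereFiniteHeight (Δ : Set (ℝ × ℝ)) : Prop :=
  ∀ c : ℝ, IsCompact (Δ ∩ verticalLine c)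

/-! ## Corner conditions -/

/-- The determinant of two integer vectors. -/
def det (u v : ℤ × ℤ) : ℤ := u.1 * v.2 - u.2 * v.1

/-- The action of the matrix `T = (1 1; 0 1)` on integer vectors. -/
def matT (v : ℤ × ℤ) : ℤ × ℤ := (v.1 + v.2, v.2)

/-- `u` is the primitive integer inward normal of an edge of `Δ` containing `p`. -/
def IsEdgeNormalAt (Δ : Set (ℝ × ℝ)) (p : ℝ × ℝ) (u : ℤ × ℤ) : Prop :=
  Int.gcd u.1 u.2 = 1 ∧ (face Δ ((u.1 : ℝ), (u.2 : ℝ))).Nontrivial ∧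
    p ∈ face Δ ((u.1 : ℝ), (u.2 : ℝ))

/-- `u`, `v` are the primitive inward normals to the two (non-collinear) edges meeting at `p`,
in the order of positive orientation. -/
def AreCornerNormals (Δ : Set (ℝ × ℝ)) (p : ℝ × ℝ) (u v : ℤ × ℤ) : Prop :=
  IsEdgeNormalAt Δ p u ∧ IsEdgeNormalAt Δ p v ∧ 0 < det u v

def IsDelzantCorner (Δ : Set (ℝ × ℝ)) (p : ℝ × ℝ) : Prop :=
  ∃ u v, AreCornerNormals Δ p u v ∧ det u v = 1

def IsHiddenCorner (Δ : Set (ℝ × ℝ)) (p : ℝ × ℝ) : Prop :=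
  p ∈ topBoundary Δ ∧ ∃ u v, AreCornerNormals Δ p u v ∧ det u (matT v) = 1

def IsFakeCorner (Δ : Set (ℝ × ℝ)) (p : ℝ × ℝ) : Prop :=
  p ∈ topBoundary Δ ∧ ∃ u v, AreCornerNormals Δ p u v ∧ det u (matT v) = 0

/-! ## Labeled weighted polygons and the group action -/

/-- The data `(Δ, (ℓ_{λ_j}, ε_j, k_j)_{j=1}^m)`, before any condition is imposed. -/
@[ext]
structure WeightedRegion (m : ℕ) where
  region : Set (ℝ × ℝ)
  line : Fin m → ℝ
  sign : Fin m → ℤˣ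
  label : Fin m → ℤ

/-- Labeled weighted polygons of complexity `m`; the last two conditions say
`inf π₁(Δ) < λ_1 < ⋯ < λ_m < sup π₁(Δ)`. -/
structure IsLabeledWeightedPolygon {m : ℕ} (w : WeightedRegion m) : Prop where
  isPolygon : IsPolygon w.region
  isRational : IsRational w.region
  strictMono : StrictMono w.line
  between : ∀ j, (∃ p ∈ w.region, p.1 < w.line j) ∧ (∃ p ∈ w.region, w.line j < p.1)

/-- Primitive semitoric polygons of complexity `m`. -/
structure IsPrimitiveSemitoric {m : ℕ} (w : WeightedRegion m) : Prop where
  isLabeledWeighted : IsLabeledWeightedPolygon w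
  finiteHeight : EverywhereFiniteHeight w.region
  sign_eq_one : ∀ j, w.sign j = 1
  line_meets_top : ∀ j, (topBoundary w.region ∩ verticalLine (w.line j)).Nonempty
  hidden_or_fake : ∀ j, ∀ p ∈ topBoundary w.region ∩ verticalLine (w.line j),
    p ∈ vertices w.region ∧ (IsHiddenCorner w.region p ∨ IsFakeCorner w.region p)
  delzant : ∀ p ∈ vertices w.region,
    (∀ j, p ∉ topBoundary w.region ∩ verticalLine (w.line j)) → IsDelzantCorner w.region p

/-- The linear map `(Tᵗ)^k` of the plane. -/
def shear (k : ℤ) (p : ℝ × ℝ) : ℝ × ℝ := (p.1, p.2 + k * p.1)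

/-- The map `t_ℓ^k`, for `ℓ` the line `x = c`: the identity to the left of `ℓ`, and `(Tᵗ)^k` with
respect to an origin on `ℓ` (the choice of which is immaterial) to the right of `ℓ`. -/
def halfShear (c : ℝ) (k : ℤ) (p : ℝ × ℝ) : ℝ × ℝ :=
  if p.1 ≤ c then p else (p.1, p.2 + k * (p.1 - c))

/-- The composition `t_{ℓ_{λ_1}}^{u_1} ∘ ⋯ ∘ t_{ℓ_{λ_m}}^{u_m}`. -/
def multiShear {m : ℕ} (l : Fin m → ℝ) (u : Fin m → ℤ) : ℝ × ℝ → ℝ × ℝ :=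
  (List.ofFn fun j => halfShear (l j) (u j)).foldr (fun f g => f ∘ g) id

theorem halfShear_apply (c : ℝ) (k : ℤ) (p : ℝ × ℝ) :
    halfShear c k p = (p.1, p.2 + k * max (p.1 - c) 0) := by
  unfold halfShear
  split_ifs with h
  · rw [max_eq_right (by linarith)]; simp
  · rw [max_eq_left (by linarith)]

theorem multiShear_apply {m : ℕ} (l : Fin m → ℝ) (u : Fin m → ℤ) (p : ℝ × ℝ) :
    multiShear l u p = (p.1, p.2 + ∑ j, (u j : ℝ) * max (p.1 - l j) 0) := by
  unfold multiShear
  induction m with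
  | zero => simp
  | succ n ih =>
    rw [List.ofFn_succ, List.foldr_cons, Function.comp_apply,
      ih (fun i => l i.succ) (fun i => u i.succ), halfShear_apply, Fin.sum_univ_succ]
    ext <;> simp
    ring

/-- The exponents `u_j = (ε_j - ε_j ε'_j) / 2 ∈ {-1, 0, 1}` (the division is exact). -/
def flipExponent {m : ℕ} (e e' : Fin m → ℤˣ) (j : Fin m) : ℤ :=
  ((e j : ℤ) - (e j : ℤ) * (e' j : ℤ)) / 2

theorem flipExponent_mul {m : ℕ} (e a b : Fin m → ℤˣ) (j : Fin m) :
    flipExponent e (a * b) j = flipExponent (b * e) a j + flipExponent e b j := by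
  unfold flipExponent
  rcases Int.units_eq_one_or (e j) with h | h <;> rcases Int.units_eq_one_or (a j) with h' | h' <;>
    rcases Int.units_eq_one_or (b j) with h'' | h'' <;> simp [h, h', h'']

/-- The action of `G_m × 𝒢` on labeled weighted data, where `G_m = {-1, 1}^m` and
`𝒢 = {(Tᵗ)^k | k ∈ ℤ}` is identified with (the multiplicative version of) `ℤ`. -/
instance {m : ℕ} : MulAction ((Fin m → ℤˣ) × Multiplicative ℤ) (WeightedRegion m) where
  smul g w :=
    { region := multiShear w.line (flipExponent w.sign g.1) ''
        (shear (Multiplicative.toAdd g.2) '' w.region)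
      line := w.line
      sign := g.1 * w.sign
      label := fun j => Multiplicative.toAdd g.2 + w.label j }
  one_smul w := by
    refine WeightedRegion.ext ?_ rfl (one_mul _) (funext fun j => zero_add _)
    change multiShear w.line (flipExponent w.sign 1) '' (shear 0 '' w.region) = w.region
    rw [Set.image_image]
    simp [multiShear_apply, shear, flipExponent]
  mul_smul g g' w := by
    refine WeightedRegion.ext ?_ rfl (mul_assoc _ _ _) (funext fun j => add_assoc _ _ _)
    change multiShear w.line (flipExponent w.sign (g.1 * g'.1)) ''
        (shear (Multiplicative.toAdd g.2 + Multiplicative.toAdd g'.2) '' w.region) =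
      multiShear w.line (flipExponent (g'.1 * w.sign) g.1) '' (shear (Multiplicative.toAdd g.2) ''
        (multiShear w.line (flipExponent w.sign g'.1) ''
          (shear (Multiplicative.toAdd g'.2) '' w.region)))
    simp only [Set.image_image]
    congr 1
    funext p
    simp only [multiShear_apply, shear, flipExponent_mul]
    push_cast
    simp only [add_mul, Finset.sum_add_distrib]
    ext <;> simp
    ring

/-- The semitoric polygons of complexity `m` with twisting index (class of) `k`: the orbits of the
primitive semitoric polygons with twisting index `k`. -/
def DPolyg (m : ℕ) (k : Fin m → ℤ) : Set (Set (WeightedRegion m)) :=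
  {O | ∃ w : WeightedRegion m, IsPrimitiveSemitoric w ∧ w.label = k ∧
    O = MulAction.orbit ((Fin m → ℤˣ) × Multiplicative ℤ) w}

/-- The collection of all semitoric polygons of complexity `m`. -/
def DPolygAll (m : ℕ) : Set (Set (WeightedRegion m)) := ⋃ k : Fin m → ℤ, DPolyg m k

/-! ## Metrics -/

/-- The topology induced by a distance function: a set is open when it contains a ball of positive
radius around each of its points. -/
abbrev topologyOfDist {X : Type*} (d : X → X → ℝ≥0∞) : TopologicalSpace X where
  IsOpen U := ∀ x ∈ U, ∃ r > 0, ∀ y, d x y < r → y ∈ U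
  isOpen_univ := fun _ _ => ⟨1, one_pos, fun _ _ => trivial⟩
  isOpen_inter := by
    rintro U V hU hV x ⟨hxU, hxV⟩
    obtain ⟨r, hr, h⟩ := hU x hxU
    obtain ⟨s, hs, h'⟩ := hV x hxV
    exact ⟨min r s, lt_min hr hs, fun y hy =>
      ⟨h y (hy.trans_le (min_le_left _ _)), h' y (hy.trans_le (min_le_right _ _))⟩⟩
  isOpen_sUnion := by
    rintro S hS x ⟨U, hU, hx⟩
    obtain ⟨r, hr, h⟩ := hS U hU x hx
    exact ⟨r, hr, fun y hy => ⟨U, hU, h y hy⟩⟩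

/-- Admissible measures on the plane. -/
def IsAdmissible (ν : MeasureTheory.Measure (ℝ × ℝ)) : Prop :=
  ν.AbsolutelyContinuous MeasureTheory.volume ∧ MeasureTheory.volume.AbsolutelyContinuous ν ∧
  ∃ g : ℝ → ℝ,
    ν = MeasureTheory.volume.withDensity (fun p : ℝ × ℝ => ENNReal.ofReal (g p.1)) ∧
    MeasureTheory.Integrable (fun x : ℝ => x * g x) ∧
    ∀ a b : ℝ, ∃ c C : ℝ, 0 < c ∧ ∀ x ∈ Set.Icc a b, c ≤ g x ∧ g x ≤ C

/-- Linearly summable sequences. -/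
def IsLinearlySummable (b : ℕ → ℝ) : Prop :=
  (∀ n, 0 < b n) ∧ Summable fun n : ℕ => (n : ℝ) * b n

/-- The sum over `u ∈ {0, 1}^m` of the `ν`-measures of the symmetric differences of
`t_λ^u(Δ)` and `t_{λ'}^u(Δ')`. -/
def regionDist (ν : MeasureTheory.Measure (ℝ × ℝ)) {m : ℕ} (w w' : WeightedRegion m) : ℝ≥0∞ :=
  ∑ u : Fin m → Fin 2,
    ν (symmDiff (multiShear w.line (fun j => ((u j : ℕ) : ℤ)) '' w.region)
      (multiShear w'.line (fun j => ((u j : ℕ) : ℤ)) '' w'.region))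

/-- The distance between two semitoric polygons in `DPolyg m k`, computed on primitive
representatives with twisting index `k`. Such a representative is unique if `0 < m`, and then the
infimum is over one pair. If `m = 0` the primitive representatives of an orbit are the polygons
`(Tᵗ)^c Δ`, `c ∈ ℤ`, and the infimum is over all choices of them. -/
def polygonDist (ν : MeasureTheory.Measure (ℝ × ℝ)) {m : ℕ} (k : Fin m → ℤ)
    (O O' : Set (WeightedRegion m)) : ℝ≥0∞ :=
  ⨅ (w : WeightedRegion m) (w' : WeightedRegion m)
    (_ : w ∈ O ∧ IsPrimitiveSemitoric w ∧ w.label = k)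
    (_ : w' ∈ O' ∧ IsPrimitiveSemitoric w' ∧ w'.label = k), regionDist ν w w'

/-- The topology on `DPolyg m k` induced by the `ν`-symmetric-difference metric. -/
abbrev polygonTopology (ν : MeasureTheory.Measure (ℝ × ℝ)) (m : ℕ) (k : Fin m → ℤ) :
    TopologicalSpace (DPolyg m k) :=
  topologyOfDist fun O O' => polygonDist ν k O.1 O'.1

/-- The coefficient `σ_{i,j}` of `X^i Y^j`. -/
def coeffXY (S : MvPowerSeries (Fin 2) ℝ) (i j : ℕ) : ℝ :=
  MvPowerSeries.coeff (Finsupp.single 0 i + Finsupp.single 1 j) S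

/-- The set `ℝ[[X, Y]]₀` of real power series with `σ_{0,0} = 0` and `σ_{0,1} ∈ [0, 2π)`. -/
def TaylorSeries : Type :=
  {S : MvPowerSeries (Fin 2) ℝ // coeffXY S 0 0 = 0 ∧ coeffXY S 0 1 ∈ Set.Ico 0 (2 * Real.pi)}

/-- The metric on `ℝ[[X, Y]]₀`. -/
def taylorDist (b : ℕ → ℝ) (S S' : TaylorSeries) : ℝ≥0∞ :=
  (∑' p : ℕ × ℕ, if p = (0, 1) then 0 else
    ENNReal.ofReal (min |coeffXY S.1 p.1 p.2 - coeffXY S'.1 p.1 p.2| (b (p.1 + p.2)))) +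
  ENNReal.ofReal (min |coeffXY S.1 0 1 - coeffXY S'.1 0 1|
    (min (2 * Real.pi - |coeffXY S.1 0 1 - coeffXY S'.1 0 1|) (b 1)))

/-! ## Semitoric lists of ingredients -/

/-- Semitoric lists of ingredients of complexity `m`. -/
structure Ingredients (m : ℕ) where
  polygon : Set (WeightedRegion m)
  polygon_mem : polygon ∈ DPolygAll m
  height : Fin m → ℝ
  height_pos : ∀ j, 0 < height j
  height_lt : ∀ w ∈ polygon, IsPrimitiveSemitoric w → ∀ j, ENNReal.ofReal (height j) <
    MeasureTheory.volume (Prod.snd '' (w.region ∩ verticalLine (w.line j)))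
  taylor : Fin m → TaylorSeries

/-- The lists of ingredients of complexity `m` whose polygon is in `DPolyg m k`. -/
def IngredientsIndex (m : ℕ) (k : Fin m → ℤ) : Set (Ingredients m) :=
  {a | a.polygon ∈ DPolyg m k}

/-- The metric on `IngredientsIndex m k`. -/
def ingredientsDist (ν : MeasureTheory.Measure (ℝ × ℝ)) (b : ℕ → ℝ) {m : ℕ} (k : Fin m → ℤ)
    (a a' : Ingredients m) : ℝ≥0∞ :=
  polygonDist ν k a.polygon a'.polygon +
    ∑ j, (taylorDist b (a.taylor j) (a'.taylor j) + ENNReal.ofReal |a.height j - a'.height j|)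

/-- The metric topology on `IngredientsIndex m k`. -/
abbrev ingredientsTopology (ν : MeasureTheory.Measure (ℝ × ℝ)) (b : ℕ → ℝ) (m : ℕ) (k : Fin m → ℤ) :
    TopologicalSpace (IngredientsIndex m k) :=
  topologyOfDist fun a a' => ingredientsDist ν b k a.1 a'.1

/-- The set `ℳ` of all semitoric lists of ingredients. -/
def Moduli : Type := Σ m : ℕ, Ingredients m

/-- The subset `ℳ_m` of `ℳ`. -/
def ModuliComplexity (m : ℕ) : Set Moduli := {x | x.1 = m}

/-- The subset `ℳ_{m,k}` of `ℳ`. -/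
def ModuliIndex (m : ℕ) (k : Fin m → ℤ) : Set Moduli :=
  (fun a : Ingredients m => (⟨m, a⟩ : Moduli)) '' IngredientsIndex m k

/-- The topology of `ℳ` as the disjoint union of the metric spaces `ℳ_{m,k}`: a set is open when
its intersection with each of them is open there. -/
abbrev moduliTopology (ν : MeasureTheory.Measure (ℝ × ℝ)) (b : ℕ → ℝ) : TopologicalSpace Moduli :=
  ⨆ (m : ℕ) (k : Fin m → ℤ),
    TopologicalSpace.coinduced (fun a : IngredientsIndex m k => (⟨m, a.1⟩ : Moduli))
      (ingredientsTopology ν b m k)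

end Semitoric

end

/-!
The difficulty is that the Delzant, hidden and fake conditions are arithmetic. Moving the edges of a
polygon does not change their normals, and there is no obvious path between primitive polygons whose
edges have different normals. The proof uses polygons with very many edges. Let
`slopes N` be the set of rationals of absolute value and denominator at most `N`. If a concave
function is the minimum of lines whose slopes run through `slopes N` and whose intercepts are a
strictly convex function of the slope, then the slopes on the two sides of any point are equal or
consecutive in `slopes N` (`exists_envelope_farey_slopes`), and consecutive slopes are Farey
neighbours, with determinant one (`slopeDet_eq_one_of_consecutive`). Subtracting
`∑ j, max (x - λ_j) 0` shifts slopes by integers, which changes the determinant at no point except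
the `λ_j`, where the corner becomes fake or hidden. Hence any choice of strictly convex intercepts,
subject to inequalities at the two ends, gives a primitive semitoric polygon
(`SupportData.IsSmooth.isPrimitiveSemitoric`).

These inequalities define a convex set of data, so that two such polygons, even for different `N`,
are joined by linear interpolation of their intercepts, after passing to the larger `N` by means of
a Legendre transform (`SupportData.IsSmooth.isPrimitiveSemitoric_segment`). The heights above the
`λ_j` are concave along the interpolation, hence the heights and the Taylor series of lists of
ingredients can be interpolated linearly too (`SupportData.IsSmooth.joined`).

Conversely, if `Δ` is any primitive semitoric polygon, the slope of its top drops by at least one at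
each `λ_j`, so that the sum of its top and `∑ j, max (x - λ_j) 0` is still concave
(`IsPrimitiveSemitoric.exists_hasProfile`). The intercepts of its supporting lines over compact
intervals exhausting the base, made strictly convex, are smooth data that approximate `Δ`
(`HasProfile.exists_isApproximation`). The segments between successive approximations converge to
`Δ` (`IsApproximation.tendsto_regionDist`) because bands that converge pointwise and stay in a cone
converge in measure (`tendsto_regionDist`). The concatenation of these infinitely many segments is a
path that ends at `Δ` (`joined_of_tendsto_paths`, `exists_joined_isSmooth`), which proves
path-connectedness.

For the components of the space of all lists of ingredients it remains to see that two of the pieces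
with fixed twisting index are equal or disjoint, hence open and closed: primitive representatives of
one orbit differ by a shear, which preserves primitive polygons and adds a constant to the twisting
index (`IsPrimitiveSemitoric.smul_one`, `DPolyg_eq_of_mem`).
-/

noncomputable section

namespace Semitoric

open Filter Topology MeasureTheory
open scoped ENNReal

/-! ### Farey neighbours -/

/-- The rational slopes of absolute value at most `N` and denominator at most `N`. -/
def slopes (N : ℕ) : Finset ℚ :=
  ((Finset.Icc (-(N * N : ℤ)) (N * N) ×ˢ Finset.Icc 1 N).image
    fun a => (a.1 : ℚ) / (a.2 : ℚ)).filter fun s => |s| ≤ N ∧ s.den ≤ N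

theorem mem_slopes {N : ℕ} {s : ℚ} : s ∈ slopes N ↔ |s| ≤ N ∧ s.den ≤ N := by
  unfold slopes
  rw [Finset.mem_filter]
  refine ⟨fun h => h.2, fun h => ⟨?_, h⟩⟩
  refine Finset.mem_image.2 ⟨(s.num, s.den), ?_, Rat.num_div_den s⟩
  have hd : (0 : ℚ) < s.den := by exact_mod_cast s.den_pos
  have hnum : (s.num : ℚ) = s * s.den := (Rat.mul_den_eq_num s).symm
  have habs : |(s.num : ℚ)| ≤ N * N := by
    rw [hnum, abs_mul, abs_of_pos hd]
    exact mul_le_mul h.1 (by exact_mod_cast h.2) hd.le (Nat.cast_nonneg _)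
  have habs' : |s.num| ≤ (N * N : ℤ) := by exact_mod_cast habs
  rw [Finset.mem_product, Finset.mem_Icc, Finset.mem_Icc]
  exact ⟨abs_le.1 habs', s.den_pos, h.2⟩

theorem intCast_mem_slopes {N : ℕ} (hN : 1 ≤ N) {a : ℤ} (ha : |a| ≤ N) : (a : ℚ) ∈ slopes N := by
  rw [mem_slopes]
  exact ⟨by exact_mod_cast ha, by simpa using hN⟩

theorem zero_mem_slopes {N : ℕ} (hN : 1 ≤ N) : (0 : ℚ) ∈ slopes N := by
  simpa using intCast_mem_slopes hN (a := 0) (by simp)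

theorem natCast_mem_slopes {N : ℕ} (hN : 1 ≤ N) : (N : ℚ) ∈ slopes N := by
  simpa using intCast_mem_slopes hN (a := N) (by simp)

theorem neg_natCast_mem_slopes {N : ℕ} (hN : 1 ≤ N) : (-N : ℚ) ∈ slopes N := by
  simpa using intCast_mem_slopes hN (a := -N) (by simp)

theorem slopes_mono {N N' : ℕ} (h : N ≤ N') : slopes N ⊆ slopes N' := by
  intro s hs
  rw [mem_slopes] at hs ⊢
  exact ⟨hs.1.trans (by exact_mod_cast h), hs.2.trans h⟩

/-- The determinant of the primitive vectors `(σ.den, σ.num)`, `(τ.den, τ.num)`, up to sign. -/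
def slopeDet (s t : ℚ) : ℤ := s.num * t.den - t.num * s.den

theorem slopeDet_pos {s t : ℚ} (h : t < s) : 0 < slopeDet s t := by
  rw [Rat.lt_iff] at h
  unfold slopeDet
  linarith

/-- Consecutive elements of `slopes N` are Farey neighbours. -/
theorem slopeDet_eq_one_of_consecutive {N : ℕ} {s t : ℚ} (hs : s ∈ slopes N) (ht : t ∈ slopes N)
    (hlt : t < s) (hcons : ∀ r ∈ slopes N, t < r → r < s → False) : slopeDet s t = 1 := by
  have hD := slopeDet_pos hlt
  rw [mem_slopes] at hs ht
  set p := s.num with hp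
  set q : ℤ := (s.den : ℤ) with hq
  set r := t.num with hr
  set e : ℤ := (t.den : ℤ) with he
  have hDdef : slopeDet s t = p * e - r * q := rfl
  set D := slopeDet s t
  have hq0 : 0 < q := by rw [hq]; exact_mod_cast s.den_pos
  have he0 : 0 < e := by rw [he]; exact_mod_cast t.den_pos
  have hqN : q ≤ N := by rw [hq]; exact_mod_cast hs.2
  have heN : e ≤ N := by rw [he]; exact_mod_cast ht.2
  have hcop : IsCoprime p q := by
    rw [Int.isCoprime_iff_gcd_eq_one]; exact s.reduced
  have hcop' : IsCoprime r e := by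
    rw [Int.isCoprime_iff_gcd_eq_one]; exact t.reduced
  -- a solution of `p y - q x = 1` with `N - q < y ≤ N`
  obtain ⟨x, y, hxy, hy1, hy2⟩ : ∃ x y : ℤ, p * y - q * x = 1 ∧ (N : ℤ) - q < y ∧ y ≤ N := by
    obtain ⟨a, b, hab⟩ := hcop
    set k := ((N : ℤ) - a) / q
    have h1 := Int.emod_add_mul_ediv ((N : ℤ) - a) q
    have h2 := Int.emod_nonneg ((N : ℤ) - a) hq0.ne'
    have h3 := Int.emod_lt_of_pos ((N : ℤ) - a) hq0
    refine ⟨-b + k * p, a + k * q, by linear_combination hab, ?_, ?_⟩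
    · change _ < a + ((N : ℤ) - a) / q * q; linarith
    · change a + ((N : ℤ) - a) / q * q ≤ _; linarith
  have hy0 : 0 < y := by linarith
  set k := r * y - e * x with hk
  have key : e = D * y + k * q := by rw [hDdef, hk]; linear_combination e * hxy.symm
  rcases lt_trichotomy k 0 with hk0 | hk0 | hk0
  · -- here `x / y` is in `slopes N` and lies strictly between `t` and `s`
    exfalso
    have hyQ : (0 : ℚ) < y := by exact_mod_cast hy0
    have hqQ : (0 : ℚ) < q := by exact_mod_cast hq0
    have heQ : (0 : ℚ) < e := by exact_mod_cast he0
    have hsq : s = (p : ℚ) / q := (Rat.num_div_den s).symm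
    have hte : t = (r : ℚ) / e := (Rat.num_div_den t).symm
    have h1 : t < (x : ℚ) / y := by
      rw [hte, div_lt_div_iff₀ heQ hyQ]
      have : r * y < x * e := by linarith
      exact_mod_cast this
    have h2 : (x : ℚ) / y < s := by
      rw [hsq, div_lt_div_iff₀ hyQ hqQ]
      have : x * q < p * y := by linarith
      exact_mod_cast this
    refine hcons _ (mem_slopes.2 ⟨?_, ?_⟩) h1 h2
    · rw [abs_le] at *
      exact ⟨ht.1.1.trans h1.le, h2.le.trans hs.1.2⟩
    · have hdvd : (((x : ℚ) / y).den : ℤ) ∣ y := by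
        have := Rat.den_dvd x y
        rwa [Rat.divInt_eq_div] at this
      exact_mod_cast (Int.le_of_dvd hy0 hdvd).trans hy2
  · -- here `e = D * y` and `e ∣ y`, so that `D = 1`
    have hdvd : e ∣ y := by
      have : e ∣ r * y := ⟨x, by linarith⟩
      exact (hcop'.symm).dvd_of_dvd_mul_left this
    have hle := Int.le_of_dvd hy0 hdvd
    nlinarith
  · -- here `e ≥ y + q > N`, which is impossible
    nlinarith

theorem exists_slope_near (N : ℕ) (hN : 1 ≤ N) (s : ℝ) (hs : |s| + 1 ≤ N) :
    ∃ r ∈ slopes N, |(r : ℝ) - s| ≤ 1 / N := by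
  have hN0 : (0 : ℝ) < N := by exact_mod_cast hN
  have h1 := Int.floor_le (s * N)
  have h2 := Int.lt_floor_add_one (s * N)
  have hnear : |((⌊s * N⌋ : ℝ) / N) - s| ≤ 1 / N := by
    rw [abs_le]
    constructor
    · have : (⌊s * N⌋ : ℝ) / N - s = (⌊s * N⌋ - s * N) / N := by field_simp
      rw [this, ← neg_div]
      exact div_le_div_of_nonneg_right (by linarith) hN0.le
    · have : (⌊s * N⌋ : ℝ) / N - s = (⌊s * N⌋ - s * N) / N := by field_simp
      rw [this]
      exact div_le_div_of_nonneg_right (by linarith) hN0.le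
  refine ⟨(⌊s * N⌋ : ℚ) / N, mem_slopes.2 ⟨?_, ?_⟩, by push_cast; exact hnear⟩
  · have h3 : |(⌊s * N⌋ : ℝ) / N| ≤ N := by
      have h4 : (1 : ℝ) / N ≤ 1 := by
        rw [div_le_one hN0]; exact_mod_cast hN
      have := abs_sub_abs_le_abs_sub ((⌊s * N⌋ : ℝ) / N) s
      linarith
    exact_mod_cast h3
  · have hdvd : (((⌊s * N⌋ : ℚ) / N).den : ℤ) ∣ (N : ℤ) := by
      have := Rat.den_dvd ⌊s * N⌋ N
      rw [Rat.divInt_eq_div] at this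
      exact_mod_cast this
    exact Nat.le_of_dvd hN (by exact_mod_cast hdvd)

/-! ### Slopes of concave piecewise linear functions -/

/-- The line of slope `s` through `(x, φ x)` lies above the graph of `φ`, and agrees with it along
the filter `l`. For `l = 𝓝[<] x` or `l = 𝓝[>] x` this says that a piecewise linear concave function
`φ` has slope `s` immediately to the left, or right, of `x`. -/
structure HasSlopeAlong (l : Filter ℝ) (φ : ℝ → ℝ) (x s : ℝ) : Prop where
  le : ∀ y, φ y ≤ φ x + s * (y - x)
  eventually_eq : ∀ᶠ y in l, φ y = φ x + s * (y - x)

/-- The sum of the convex functions `x ↦ max (x - l j) 0`, which have slope `0` to the left of `l j`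
and slope `1` to its right. -/
def kinkSum {m : ℕ} (l : Fin m → ℝ) (x : ℝ) : ℝ := ∑ j, max (x - l j) 0

/-- The minimum of the lines of slope `s ∈ slopes N` and intercept `c s`, for `1 ≤ N`. (The set
`slopes 0` is empty, and `envelope 0 c` has the junk value zero.) -/
def envelope (N : ℕ) (c : ℝ → ℝ) (x : ℝ) : ℝ := ⨅ s : slopes N, ((s : ℚ) * x + c (s : ℚ))

section Envelope

variable {N : ℕ} {c : ℝ → ℝ} {x : ℝ}

theorem envelope_le {s : ℚ} (hs : s ∈ slopes N) (c : ℝ → ℝ) (x : ℝ) :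
    envelope N c x ≤ s * x + c s :=
  ciInf_le (f := fun s : slopes N => ((s : ℚ) * x + c (s : ℚ))) (Set.finite_range _).bddBelow ⟨s, hs⟩

theorem exists_envelope_eq (hN : 1 ≤ N) (c : ℝ → ℝ) (x : ℝ) :
    ∃ s ∈ slopes N, s * x + c s = envelope N c x := by
  have : Nonempty (slopes N) := ⟨⟨0, zero_mem_slopes hN⟩⟩
  obtain ⟨s, hs⟩ := exists_eq_ciInf_of_finite (f := fun s : slopes N => ((s : ℚ) * x + c (s : ℚ)))
  exact ⟨s, s.2, hs⟩

theorem le_envelope (hN : 1 ≤ N) {a : ℝ} (h : ∀ s ∈ slopes N, a ≤ s * x + c s) :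
    a ≤ envelope N c x := by
  obtain ⟨s, hs, he⟩ := exists_envelope_eq hN c x
  exact he ▸ h s hs

/-- At each point an envelope has one-sided slopes, the extreme ones among the slopes of the lines
that attain the minimum. -/
theorem exists_envelope_slopes (hN : 1 ≤ N) (c : ℝ → ℝ) (x : ℝ) :
    ∃ s ∈ slopes N, ∃ t ∈ slopes N, t ≤ s ∧ s * x + c s = envelope N c x ∧
      t * x + c t = envelope N c x ∧ HasSlopeAlong (𝓝[<] x) (envelope N c) x s ∧
      HasSlopeAlong (𝓝[>] x) (envelope N c) x t := by
  set A := (slopes N).filter fun s : ℚ => (s : ℝ) * x + c s = envelope N c x with hA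
  have hne : A.Nonempty := by
    obtain ⟨s, hs, he⟩ := exists_envelope_eq hN c x
    exact ⟨s, Finset.mem_filter.2 ⟨hs, he⟩⟩
  have hs := Finset.mem_filter.1 (A.max'_mem hne)
  have ht := Finset.mem_filter.1 (A.min'_mem hne)
  -- lines that do not attain the minimum at `x` stay irrelevant near `x`
  have key : ∀ r ∈ slopes N, r ∈ A → ∀ l ≤ 𝓝 x,
      (∀ r' ∈ A, ∀ᶠ y in l, r * (y - x) ≤ r' * (y - x)) →
      HasSlopeAlong l (envelope N c) x r := by
    intro r hr hrA l hl hr'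
    have he := (Finset.mem_filter.1 hrA).2
    refine ⟨fun y => (envelope_le hr c y).trans (by rw [← he]; linarith), ?_⟩
    have hall : ∀ᶠ y in l, ∀ r' ∈ slopes N, (r : ℝ) * y + c r ≤ r' * y + c r' := by
      rw [Filter.eventually_all_finset]
      intro r' hr'S
      by_cases h : r' ∈ A
      · filter_upwards [hr' r' h] with y hy
        have := (Finset.mem_filter.1 h).2
        linarith
      · have hlt : (r : ℝ) * x + c r < r' * x + c r' := by
          rw [he]
          refine lt_of_le_of_ne (envelope_le hr'S c x) fun h' => h ?_
          exact Finset.mem_filter.2 ⟨hr'S, h'.symm⟩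
        refine hl ?_
        have h1 : Continuous fun y : ℝ => (r : ℝ) * y + c r := by fun_prop
        have h2 : Continuous fun y : ℝ => (r' : ℝ) * y + c r' := by fun_prop
        exact ((h1.tendsto x).eventually_lt (h2.tendsto x) hlt).mono fun y => le_of_lt
    filter_upwards [hall] with y hy
    rw [← he]
    have h1 := le_envelope hN hy
    have h2 := envelope_le hr c y
    linarith
  refine ⟨_, hs.1, _, ht.1, A.min'_le _ (A.max'_mem hne), hs.2, ht.2,
    key _ hs.1 (A.max'_mem hne) _ nhdsWithin_le_nhds fun r' hr' => ?_,
    key _ ht.1 (A.min'_mem hne) _ nhdsWithin_le_nhds fun r' hr' => ?_⟩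
  · filter_upwards [self_mem_nhdsWithin] with y (hy : y < x)
    have : (r' : ℝ) ≤ (A.max' hne : ℚ) := by exact_mod_cast A.le_max' r' hr'
    exact mul_le_mul_of_nonpos_right this (by linarith)
  · filter_upwards [self_mem_nhdsWithin] with y (hy : x < y)
    have : ((A.min' hne : ℚ) : ℝ) ≤ r' := by exact_mod_cast A.min'_le r' hr'
    exact mul_le_mul_of_nonneg_right this (by linarith)

/-- If the intercepts are strictly convex in the slope, two lines attaining the minimum at the same
point have consecutive slopes. -/
theorem slopeDet_eq_one_of_envelope (hc : StrictConvexOn ℝ Set.univ c) {s t : ℚ}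
    (hs : s ∈ slopes N) (ht : t ∈ slopes N) (hts : t < s) (hse : s * x + c s = envelope N c x)
    (hte : t * x + c t = envelope N c x) : slopeDet s t = 1 := by
  refine slopeDet_eq_one_of_consecutive hs ht hts fun r hr h1 h2 => ?_
  have h1' : (t : ℝ) < r := by exact_mod_cast h1
  have h2' : (r : ℝ) < s := by exact_mod_cast h2
  have hd : (0 : ℝ) < s - t := by linarith
  have hcomb := hc.2 (Set.mem_univ (t : ℝ)) (Set.mem_univ (s : ℝ)) (by intro h; linarith)
    (div_pos (by linarith) hd : (0 : ℝ) < (s - r) / (s - t))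
    (div_pos (by linarith) hd : (0 : ℝ) < (r - t) / (s - t)) (by field_simp; ring)
  have hr' : ((s - r) / (s - t) : ℝ) • (t : ℝ) + ((r - t) / (s - t) : ℝ) • (s : ℝ) = r := by
    simp only [smul_eq_mul]; field_simp; ring
  rw [hr'] at hcomb
  have hle := envelope_le hr c x
  simp only [smul_eq_mul] at hcomb
  have hct : c t = envelope N c x - t * x := by linarith
  have hcs : c s = envelope N c x - s * x := by linarith
  rw [hct, hcs] at hcomb
  have : ((s - r) / (s - t) : ℝ) * (envelope N c x - t * x) +
      (r - t) / (s - t) * (envelope N c x - s * x) = envelope N c x - r * x := by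
    field_simp; ring
  linarith

/-- If the intercepts are strictly convex in the slope, the one-sided slopes of the envelope are
equal or Farey neighbours. -/
theorem exists_envelope_farey_slopes (hN : 1 ≤ N) (hc : StrictConvexOn ℝ Set.univ c) (x : ℝ) :
    ∃ s ∈ slopes N, ∃ t ∈ slopes N, s * x + c s = envelope N c x ∧
      t * x + c t = envelope N c x ∧ HasSlopeAlong (𝓝[<] x) (envelope N c) x s ∧
      HasSlopeAlong (𝓝[>] x) (envelope N c) x t ∧ (s = t ∨ slopeDet s t = 1) := by
  obtain ⟨s, hs, t, ht, hts, hse, hte, h1, h2⟩ := exists_envelope_slopes hN c x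
  refine ⟨s, hs, t, ht, hse, hte, h1, h2, ?_⟩
  rcases hts.eq_or_lt with h | h
  · exact Or.inl h.symm
  · exact Or.inr (slopeDet_eq_one_of_envelope hc hs ht h hse hte)

end Envelope

section KinkSum

variable {m : ℕ} (l : Fin m → ℝ) (x : ℝ)

theorem kinkSum_nonneg : 0 ≤ kinkSum l x :=
  Finset.sum_nonneg fun _ _ => le_max_right _ _

theorem kinkSum_slopes_left :
    (∀ y, kinkSum l x + (Finset.univ.filter fun j => l j < x).card * (y - x) ≤ kinkSum l y) ∧
    ∀ᶠ y in 𝓝[<] x, kinkSum l y =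
      kinkSum l x + (Finset.univ.filter fun j => l j < x).card * (y - x) := by
  have hsum : ∀ y : ℝ, ((Finset.univ.filter fun j => l j < x).card : ℝ) * (y - x) =
      ∑ j, if l j < x then y - x else 0 := by
    intro y; rw [← Finset.sum_filter, Finset.sum_const, nsmul_eq_mul]
  constructor
  · intro y
    rw [hsum, kinkSum, kinkSum, ← Finset.sum_add_distrib]
    refine Finset.sum_le_sum fun j _ => ?_
    split_ifs with h
    · rw [max_eq_left (by linarith : (0 : ℝ) ≤ x - l j)]
      exact le_max_of_le_left (by linarith)
    · rw [max_eq_right (by linarith)]; simp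
  · have : ∀ᶠ y in 𝓝[<] x, ∀ j, l j < x → l j < y := by
      rw [Filter.eventually_all]
      intro j
      by_cases h : l j < x
      · filter_upwards [nhdsWithin_le_nhds (lt_mem_nhds h)] with y hy _ using hy
      · exact Eventually.of_forall fun y h' => absurd h' h
    filter_upwards [this, self_mem_nhdsWithin] with y hy (hyx : y < x)
    rw [hsum, kinkSum, kinkSum, ← Finset.sum_add_distrib]
    refine Finset.sum_congr rfl fun j _ => ?_
    split_ifs with h
    · rw [max_eq_left (by linarith [hy j h] : 0 ≤ y - l j), max_eq_left (by linarith)]; ring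
    · rw [max_eq_right (by linarith : y - l j ≤ 0), max_eq_right (by linarith)]; simp

theorem kinkSum_slopes_right :
    (∀ y, kinkSum l x + (Finset.univ.filter fun j => l j ≤ x).card * (y - x) ≤ kinkSum l y) ∧
    ∀ᶠ y in 𝓝[>] x, kinkSum l y =
      kinkSum l x + (Finset.univ.filter fun j => l j ≤ x).card * (y - x) := by
  have hsum : ∀ y : ℝ, ((Finset.univ.filter fun j => l j ≤ x).card : ℝ) * (y - x) =
      ∑ j, if l j ≤ x then y - x else 0 := by
    intro y; rw [← Finset.sum_filter, Finset.sum_const, nsmul_eq_mul]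
  constructor
  · intro y
    rw [hsum, kinkSum, kinkSum, ← Finset.sum_add_distrib]
    refine Finset.sum_le_sum fun j _ => ?_
    split_ifs with h
    · rw [max_eq_left (by linarith : (0 : ℝ) ≤ x - l j)]
      exact le_max_of_le_left (by linarith)
    · rw [max_eq_right (by linarith)]; simp
  · have : ∀ᶠ y in 𝓝[>] x, ∀ j, x < l j → y < l j := by
      rw [Filter.eventually_all]
      intro j
      by_cases h : x < l j
      · filter_upwards [nhdsWithin_le_nhds (gt_mem_nhds h)] with y hy _ using hy
      · exact Eventually.of_forall fun y h' => absurd h' h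
    filter_upwards [this, self_mem_nhdsWithin] with y hy (hyx : x < y)
    rw [hsum, kinkSum, kinkSum, ← Finset.sum_add_distrib]
    refine Finset.sum_congr rfl fun j _ => ?_
    split_ifs with h
    · rw [max_eq_left (by linarith : 0 ≤ y - l j), max_eq_left (by linarith)]; ring
    · rw [max_eq_right (by linarith [hy j (not_le.1 h)] : y - l j ≤ 0),
        max_eq_right (by linarith)]; simp

variable {l x}

theorem HasSlopeAlong.sub_kinkSum_left {φ : ℝ → ℝ} {s : ℝ} (h : HasSlopeAlong (𝓝[<] x) φ x s) :
    HasSlopeAlong (𝓝[<] x) (fun y => φ y - kinkSum l y) x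
      (s - (Finset.univ.filter fun j => l j < x).card) := by
  refine ⟨fun y => ?_, ?_⟩
  · linarith [h.le y, (kinkSum_slopes_left l x).1 y]
  · filter_upwards [h.eventually_eq, (kinkSum_slopes_left l x).2] with y h1 h2
    rw [h1, h2]; ring

theorem HasSlopeAlong.sub_kinkSum_right {φ : ℝ → ℝ} {s : ℝ} (h : HasSlopeAlong (𝓝[>] x) φ x s) :
    HasSlopeAlong (𝓝[>] x) (fun y => φ y - kinkSum l y) x
      (s - (Finset.univ.filter fun j => l j ≤ x).card) := by
  refine ⟨fun y => ?_, ?_⟩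
  · linarith [h.le y, (kinkSum_slopes_right l x).1 y]
  · filter_upwards [h.eventually_eq, (kinkSum_slopes_right l x).2] with y h1 h2
    rw [h1, h2]; ring

end KinkSum

/-! ### Bands over an interval as primitive semitoric polygons -/

/-- The region over `D` between the graphs of `lo` and `hi`. -/
def band (D : Set ℝ) (lo hi : ℝ → ℝ) : Set (ℝ × ℝ) :=
  {p | p.1 ∈ D ∧ lo p.1 ≤ p.2 ∧ p.2 ≤ hi p.1}

theorem mem_band {D : Set ℝ} {lo hi : ℝ → ℝ} {x y : ℝ} :
    (x, y) ∈ band D lo hi ↔ x ∈ D ∧ lo x ≤ y ∧ y ≤ hi x := Iff.rfl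

theorem mem_topBoundary_band {D : Set ℝ} {lo hi : ℝ → ℝ} {x y : ℝ} (hx : x ∈ D)
    (h : lo x ≤ hi x) : (x, y) ∈ topBoundary (band D lo hi) ↔ y = hi x := by
  have : {y : ℝ | (x, y) ∈ band D lo hi} = Set.Icc (lo x) (hi x) := by
    ext y; simp [mem_band, hx]
  change IsLUB {y : ℝ | (x, y) ∈ band D lo hi} y ↔ _
  rw [this]
  refine ⟨fun h' => h'.unique (isLUB_Icc h), ?_⟩
  rintro rfl
  exact isLUB_Icc h

theorem cast_num_eq (s : ℚ) : (s.num : ℝ) = s * s.den := by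
  exact_mod_cast (Rat.mul_den_eq_num s).symm

theorem HasSlopeAlong.exists_left {φ : ℝ → ℝ} {x s L : ℝ} (h : HasSlopeAlong (𝓝[<] x) φ x s)
    (hL : L < x) : ∃ y, L < y ∧ y < x ∧ φ y = φ x + s * (y - x) := by
  obtain ⟨y, hy, hy'⟩ := (h.eventually_eq.and (Ioo_mem_nhdsLT hL)).exists
  exact ⟨y, hy'.1, hy'.2, hy⟩

theorem HasSlopeAlong.exists_right {φ : ℝ → ℝ} {x s R : ℝ} (h : HasSlopeAlong (𝓝[>] x) φ x s)
    (hR : x < R) : ∃ y, x < y ∧ y < R ∧ φ y = φ x + s * (y - x) := by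
  obtain ⟨y, hy, hy'⟩ := (h.eventually_eq.and (Ioo_mem_nhdsGT hR)).exists
  exact ⟨y, hy'.1, hy'.2, hy⟩

/-- A function with supporting lines everywhere is affine near a point where the slopes on both sides
agree. -/
theorem exists_affine_near {φ : ℝ → ℝ} {sl : ℝ → ℚ} {x L R : ℝ}
    (hl : ∀ z, HasSlopeAlong (𝓝[<] z) φ z (sl z)) (hr : HasSlopeAlong (𝓝[>] x) φ x (sl x))
    (hx : x ∈ Set.Ioo L R) : ∃ e > 0, x - e ∈ Set.Icc L R ∧ x + e ∈ Set.Icc L R ∧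
      φ (x - e) = φ x - sl x * e ∧ φ (x + e) = φ x + sl x * e := by
  obtain ⟨y1, h1, h2, h3⟩ := (hl x).exists_left hx.1
  obtain ⟨y2, h4, h5, h6⟩ := hr.exists_right hx.2
  obtain ⟨e, he, he1, he2⟩ : ∃ e > 0, e ≤ x - y1 ∧ e ≤ y2 - x :=
    ⟨min (x - y1) (y2 - x), lt_min (by linarith) (by linarith), min_le_left _ _, min_le_right _ _⟩
  have hval : ∀ z, y1 ≤ z → z ≤ y2 → φ z = φ x + sl x * (z - x) := by
    intro z hz1 hz2
    refine le_antisymm ((hl x).le z) ?_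
    have a1 := (hl z).le y1
    have a2 := (hl z).le y2
    rw [h3] at a1
    rw [h6] at a2
    have hd : 0 < y2 - y1 := by linarith
    have : (y2 - y1) * (φ x + sl x * (z - x)) ≤ (y2 - y1) * φ z := by
      have b1 := mul_le_mul_of_nonneg_left a1 (by linarith : 0 ≤ y2 - z)
      have b2 := mul_le_mul_of_nonneg_left a2 (by linarith : 0 ≤ z - y1)
      nlinarith
    exact le_of_mul_le_mul_left this hd
  refine ⟨e, he, ⟨by linarith, by linarith⟩, ⟨by linarith, by linarith⟩, ?_, ?_⟩
  · rw [hval _ (by linarith) (by linarith)]; ring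
  · rw [hval _ (by linarith) (by linarith)]; ring

/-- A region `{L ≤ x ≤ R, -H x ≤ y ≤ f x}` with rational one-sided slopes `fl, fr` of `f` and
`Hl, Hr` of `H`. -/
structure BandData (L R : ℝ) (f H : ℝ → ℝ) (fl fr Hl Hr : ℝ → ℚ) : Prop where
  lt : L < R
  pos : ∀ x ∈ Set.Icc L R, -H x < f x
  continuous_top : Continuous f
  continuous_bot : Continuous H
  top_left : ∀ x, HasSlopeAlong (𝓝[<] x) f x (fl x)
  top_right : ∀ x, HasSlopeAlong (𝓝[>] x) f x (fr x)
  bot_left : ∀ x, HasSlopeAlong (𝓝[<] x) H x (Hl x)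
  bot_right : ∀ x, HasSlopeAlong (𝓝[>] x) H x (Hr x)

namespace BandData

variable {L R : ℝ} {f H : ℝ → ℝ} {fl fr Hl Hr : ℝ → ℚ}

local notation "Δ₀" => band (Set.Icc L R) (fun x => -H x) f

theorem top_mem (h : BandData L R f H fl fr Hl Hr) {x : ℝ} (hx : x ∈ Set.Icc L R) :
    (x, f x) ∈ Δ₀ := ⟨hx, (h.pos x hx).le, le_rfl⟩

theorem bot_mem (h : BandData L R f H fl fr Hl Hr) {x : ℝ} (hx : x ∈ Set.Icc L R) :
    (x, -H x) ∈ Δ₀ := ⟨hx, le_rfl, (h.pos x hx).le⟩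

theorem isEdgeNormalAt_top (h : BandData L R f H fl fr Hl Hr) {x y : ℝ} {s : ℚ}
    (hx : x ∈ Set.Icc L R) (hy : y ∈ Set.Icc L R) (hne : y ≠ x)
    (hle : ∀ z, f z ≤ f x + s * (z - x)) (heq : f y = f x + s * (y - x)) :
    IsEdgeNormalAt Δ₀ (x, f x) (s.num, -(s.den : ℤ)) := by
  have hd : (0 : ℝ) < s.den := by exact_mod_cast s.den_pos
  have hmem : ∀ z ∈ Set.Icc L R, f z = f x + s * (z - x) →
      (z, f z) ∈ face Δ₀ (((s.num : ℤ) : ℝ), ((-(s.den : ℤ) : ℤ) : ℝ)) := by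
    intro z hz he
    refine ⟨h.top_mem hz, ?_⟩
    rintro ⟨a, b⟩ ⟨_, _, hb⟩
    simp only [dot]
    push_cast
    rw [cast_num_eq, he]
    have : b ≤ f x + s * (a - x) := le_trans hb (hle a)
    nlinarith
  refine ⟨?_, ⟨_, hmem x hx (by ring), _, hmem y hy heq, ?_⟩, hmem x hx (by ring)⟩
  · simpa [Int.gcd] using s.reduced
  · intro h'; exact hne (Prod.ext_iff.1 h').1.symm

theorem isEdgeNormalAt_bot (h : BandData L R f H fl fr Hl Hr) {x y : ℝ} {s : ℚ}
    (hx : x ∈ Set.Icc L R) (hy : y ∈ Set.Icc L R) (hne : y ≠ x)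
    (hle : ∀ z, H z ≤ H x + s * (z - x)) (heq : H y = H x + s * (y - x)) :
    IsEdgeNormalAt Δ₀ (x, -H x) (s.num, (s.den : ℤ)) := by
  have hd : (0 : ℝ) < s.den := by exact_mod_cast s.den_pos
  have hmem : ∀ z ∈ Set.Icc L R, H z = H x + s * (z - x) →
      (z, -H z) ∈ face Δ₀ (((s.num : ℤ) : ℝ), (((s.den : ℤ) : ℤ) : ℝ)) := by
    intro z hz he
    refine ⟨h.bot_mem hz, ?_⟩
    rintro ⟨a, b⟩ ⟨_, hb, _⟩
    simp only [dot]
    push_cast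
    rw [cast_num_eq, he]
    have : -b ≤ H x + s * (a - x) := le_trans (by simp only at hb; linarith) (hle a)
    nlinarith
  refine ⟨?_, ⟨_, hmem x hx (by ring), _, hmem y hy heq, ?_⟩, hmem x hx (by ring)⟩
  · simpa [Int.gcd] using s.reduced
  · intro h'; exact hne (Prod.ext_iff.1 h').1.symm

theorem normal_top_left (h : BandData L R f H fl fr Hl Hr) {x : ℝ} (hx : x ∈ Set.Ioc L R) :
    IsEdgeNormalAt Δ₀ (x, f x) ((fl x).num, -((fl x).den : ℤ)) := by
  obtain ⟨y, h1, h2, h3⟩ := (h.top_left x).exists_left hx.1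
  exact h.isEdgeNormalAt_top ⟨hx.1.le, hx.2⟩ ⟨h1.le, h2.le.trans hx.2⟩ h2.ne (h.top_left x).le h3

theorem normal_top_right (h : BandData L R f H fl fr Hl Hr) {x : ℝ} (hx : x ∈ Set.Ico L R) :
    IsEdgeNormalAt Δ₀ (x, f x) ((fr x).num, -((fr x).den : ℤ)) := by
  obtain ⟨y, h1, h2, h3⟩ := (h.top_right x).exists_right hx.2
  exact h.isEdgeNormalAt_top ⟨hx.1, hx.2.le⟩ ⟨hx.1.trans h1.le, h2.le⟩ h1.ne' (h.top_right x).le h3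

theorem normal_bot_left (h : BandData L R f H fl fr Hl Hr) {x : ℝ} (hx : x ∈ Set.Ioc L R) :
    IsEdgeNormalAt Δ₀ (x, -H x) ((Hl x).num, ((Hl x).den : ℤ)) := by
  obtain ⟨y, h1, h2, h3⟩ := (h.bot_left x).exists_left hx.1
  exact h.isEdgeNormalAt_bot ⟨hx.1.le, hx.2⟩ ⟨h1.le, h2.le.trans hx.2⟩ h2.ne (h.bot_left x).le h3

theorem normal_bot_right (h : BandData L R f H fl fr Hl Hr) {x : ℝ} (hx : x ∈ Set.Ico L R) :
    IsEdgeNormalAt Δ₀ (x, -H x) ((Hr x).num, ((Hr x).den : ℤ)) := by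
  obtain ⟨y, h1, h2, h3⟩ := (h.bot_right x).exists_right hx.2
  exact h.isEdgeNormalAt_bot ⟨hx.1, hx.2.le⟩ ⟨hx.1.trans h1.le, h2.le⟩ h1.ne' (h.bot_right x).le h3

theorem normal_left (h : BandData L R f H fl fr Hl Hr) {y : ℝ} (hy : (L, y) ∈ Δ₀) :
    IsEdgeNormalAt Δ₀ (L, y) (1, 0) := by
  have hL : L ∈ Set.Icc L R := ⟨le_rfl, h.lt.le⟩
  have hmem : ∀ z, (L, z) ∈ Δ₀ → (L, z) ∈ face Δ₀ (((1 : ℤ) : ℝ), ((0 : ℤ) : ℝ)) := by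
    refine fun z hz => ⟨hz, ?_⟩
    rintro ⟨a, b⟩ ⟨ha, _⟩
    simpa [dot] using ha.1
  refine ⟨by simp, ⟨_, hmem _ (h.top_mem hL), _, hmem _ (h.bot_mem hL), ?_⟩, hmem _ hy⟩
  intro h'; exact (h.pos L hL).ne' (Prod.ext_iff.1 h').2

theorem normal_right (h : BandData L R f H fl fr Hl Hr) {y : ℝ} (hy : (R, y) ∈ Δ₀) :
    IsEdgeNormalAt Δ₀ (R, y) (-1, 0) := by
  have hR : R ∈ Set.Icc L R := ⟨h.lt.le, le_rfl⟩
  have hmem : ∀ z, (R, z) ∈ Δ₀ → (R, z) ∈ face Δ₀ (((-1 : ℤ) : ℝ), ((0 : ℤ) : ℝ)) := by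
    refine fun z hz => ⟨hz, ?_⟩
    rintro ⟨a, b⟩ ⟨ha, _⟩
    simpa [dot] using ha.2
  refine ⟨by simp, ⟨_, hmem _ (h.top_mem hR), _, hmem _ (h.bot_mem hR), ?_⟩, hmem _ hy⟩
  intro h'; exact (h.pos R hR).ne' (Prod.ext_iff.1 h').2

theorem midpoint_not_vertex {Δ : Set (ℝ × ℝ)} {p v : ℝ × ℝ} (hv : v ≠ 0) (h1 : p + v ∈ Δ)
    (h2 : p - v ∈ Δ) : p ∉ vertices Δ := by
  intro hp
  have := hp.2 h1 h2 ⟨1 / 2, 1 / 2, by norm_num, by norm_num, by norm_num, by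
    ext <;> simp <;> ring⟩
  exact hv (by simpa using this)

/-- The vertices of the region lie on the top or on the bottom, above an end of the interval or at a
change of slope. -/
theorem vertex_cases (h : BandData L R f H fl fr Hl Hr) {x y : ℝ} (hp : (x, y) ∈ vertices Δ₀) :
    x ∈ Set.Icc L R ∧ (y = f x ∧ (x = L ∨ x = R ∨ (x ∈ Set.Ioo L R ∧ fl x ≠ fr x)) ∨
      y = -H x ∧ (x = L ∨ x = R ∨ (x ∈ Set.Ioo L R ∧ Hl x ≠ Hr x))) := by
  obtain ⟨hx, hlo, hhi⟩ := hp.1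
  simp only at hx hlo hhi
  refine ⟨hx, ?_⟩
  -- a point strictly between bottom and top is the midpoint of a vertical segment
  have hvert : y < f x → -H x < y → False := by
    intro h1 h2
    obtain ⟨e, he, h3, h4⟩ : ∃ e > 0, e ≤ f x - y ∧ e ≤ y - -H x :=
      ⟨min (f x - y) (y - -H x), lt_min (by linarith) (by linarith), min_le_left _ _,
        min_le_right _ _⟩
    refine midpoint_not_vertex (v := (0, e)) (fun h0 => he.ne' (Prod.ext_iff.1 h0).2) ?_ ?_ hp
    · exact ⟨by simpa using hx, by simp; linarith, by simp; linarith⟩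
    · exact ⟨by simpa using hx, by simp; linarith, by simp; linarith⟩
  by_cases hin : x ∈ Set.Ioo L R
  · rcases hhi.eq_or_lt with he | hlt
    · -- where the one-sided slopes agree, a small piece of the graph is a segment through the point
      refine Or.inl ⟨he, Or.inr (Or.inr ⟨hin, fun hs => ?_⟩)⟩
      obtain ⟨e, hepos, he1, he2, hv1, hv2⟩ :=
        exists_affine_near h.top_left (hs ▸ h.top_right x) hin
      refine midpoint_not_vertex (v := (e, fl x * e)) (fun h0 => hepos.ne' (Prod.ext_iff.1 h0).1)
        ?_ ?_ hp
      · have := h.top_mem he2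
        rw [hv2] at this
        simpa [he] using this
      · have := h.top_mem he1
        rw [hv1] at this
        simpa [he] using this
    · rcases hlo.eq_or_lt with he | hlt'
      · refine Or.inr ⟨he.symm, Or.inr (Or.inr ⟨hin, fun hs => ?_⟩)⟩
        obtain ⟨e, hepos, he1, he2, hv1, hv2⟩ :=
          exists_affine_near h.bot_left (hs ▸ h.bot_right x) hin
        refine midpoint_not_vertex (v := (e, -(Hl x * e)))
          (fun h0 => hepos.ne' (Prod.ext_iff.1 h0).1) ?_ ?_ hp
        · have := h.bot_mem he2
          rw [hv2] at this
          simpa [← he, add_comm] using this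
        · have := h.bot_mem he1
          rw [hv1] at this
          simpa [← he, add_comm, sub_eq_add_neg] using this
      · exact (hvert hlt hlt').elim
  · have hends : x = L ∨ x = R := by
      rcases hx.1.eq_or_lt with h' | h'
      · exact Or.inl h'.symm
      · rcases hx.2.eq_or_lt with h'' | h''
        · exact Or.inr h''
        · exact absurd ⟨h', h''⟩ hin
    rcases hhi.eq_or_lt with he | hlt
    · exact Or.inl ⟨he, hends.imp_right Or.inl⟩
    · rcases hlo.eq_or_lt with he | hlt'
      · exact Or.inr ⟨he.symm, hends.imp_right Or.inl⟩
      · exact (hvert hlt hlt').elim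

theorem isPolygon (h : BandData L R f H fl fr Hl Hr)
    (htop : {x | x ∈ Set.Ioo L R ∧ fl x ≠ fr x}.Finite)
    (hbot : {x | x ∈ Set.Ioo L R ∧ Hl x ≠ Hr x}.Finite) : IsPolygon Δ₀ where
  inter_halfPlanes := by
    refine ⟨{((1, 0), L), ((-1, 0), -R)} ∪
      (Set.range (fun x => (((fl x : ℝ), (-1 : ℝ)), fl x * x - f x)) ∪
        Set.range (fun x => (((Hl x : ℝ), (1 : ℝ)), Hl x * x - H x))), ?_, ?_⟩
    · rintro q ((rfl | rfl) | (⟨x, rfl⟩ | ⟨x, rfl⟩)) <;> simp [Prod.ext_iff]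
    · ext ⟨x, y⟩
      constructor
      · rintro ⟨hx, hlo, hhi⟩ q ((rfl | rfl) | (⟨z, rfl⟩ | ⟨z, rfl⟩)) <;> simp only [dot] at *
        · linarith [hx.1]
        · linarith [hx.2]
        · linarith [(h.top_left z).le x]
        · linarith [(h.bot_left z).le x]
      · intro hq
        have h1 := hq ((1, 0), L) (by simp)
        have h2 := hq ((-1, 0), -R) (by simp)
        have h3 := hq _ (Or.inr (Or.inl ⟨x, rfl⟩))
        have h4 := hq _ (Or.inr (Or.inr ⟨x, rfl⟩))
        simp only [dot] at h1 h2 h3 h4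
        exact ⟨⟨by linarith, by linarith⟩, by simp only; linarith, by simp only; linarith⟩
  interior_nonempty := by
    set U : Set (ℝ × ℝ) := {p | L < p.1 ∧ p.1 < R ∧ -H p.1 < p.2 ∧ p.2 < f p.1}
    have hc1 := h.continuous_top
    have hc2 := h.continuous_bot
    have hU : IsOpen U := by
      refine IsOpen.and ?_ (IsOpen.and ?_ (IsOpen.and ?_ ?_)) <;>
        exact isOpen_lt (by fun_prop) (by fun_prop)
    have hlt := h.lt
    have hmid := h.pos ((L + R) / 2) ⟨by linarith, by linarith⟩
    refine ⟨((L + R) / 2, (-H ((L + R) / 2) + f ((L + R) / 2)) / 2), ?_⟩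
    refine interior_maximal (s := Δ₀) (t := U) ?_ hU ?_
    · exact fun p hp => ⟨⟨hp.1.le, hp.2.1.le⟩, hp.2.2.1.le, hp.2.2.2.le⟩
    · exact ⟨by simp only; linarith, by simp only; linarith, by simp only; linarith,
        by simp only; linarith⟩
  finite_vertices := by
    intro K _
    refine Set.Finite.subset (s := (fun x => (x, f x)) '' ({L, R} ∪ {x | x ∈ Set.Ioo L R ∧ fl x ≠ fr x})
      ∪ (fun x => (x, -H x)) '' ({L, R} ∪ {x | x ∈ Set.Ioo L R ∧ Hl x ≠ Hr x})) ?_ ?_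
    · exact (((Set.toFinite _).union htop).image _).union (((Set.toFinite _).union hbot).image _)
    · rintro ⟨x, y⟩ ⟨hp, _⟩
      obtain ⟨_, ⟨rfl, hx⟩ | ⟨rfl, hx⟩⟩ := h.vertex_cases hp
      · refine Or.inl ⟨x, ?_, rfl⟩
        rcases hx with rfl | rfl | hx <;> simp_all
      · refine Or.inr ⟨x, ?_, rfl⟩
        rcases hx with rfl | rfl | hx <;> simp_all

theorem isRational (h : BandData L R f H fl fr Hl Hr) : IsRational Δ₀ := by
  rintro ⟨n1, n2⟩ hn ⟨p, hp, q, hq, hpq⟩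
  wlog hle : p.1 ≤ q.1 generalizing p q
  · exact this q hq p hp hpq.symm (le_of_not_ge hle)
  obtain ⟨p1, p2⟩ := p
  obtain ⟨q1, q2⟩ := q
  have key : ∀ (φ : ℝ → ℝ) (s : ℚ) (k : ℝ), 0 < k → HasSlopeAlong (𝓝[>] p1) φ p1 s → p1 < q1 →
      (∀ z ∈ Set.Icc L R, n1 * p1 - k * φ p1 ≤ n1 * z - k * φ z) →
      n1 * q1 - k * φ q1 = n1 * p1 - k * φ p1 → n1 = k * s := by
    intro φ s k hk hs hlt hmin heq
    have hR : q1 ≤ R := hq.1.1.2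
    obtain ⟨y, hy1, hy2, hy3⟩ := hs.exists_right hlt
    have h1 := hmin y ⟨hp.1.1.1.trans hy1.le, hy2.le.trans hR⟩
    rw [hy3] at h1
    have h2 := mul_le_mul_of_nonneg_left (hs.le q1) hk.le
    have h3 : 0 ≤ (n1 - k * s) * (y - p1) := by linarith
    have h4 : (n1 - k * s) * (q1 - p1) ≤ 0 := by linarith
    have h5 := nonneg_of_mul_nonneg_left h3 (by linarith)
    have h6 := nonpos_of_mul_nonpos_left h4 (by linarith)
    linarith
  have hface : n1 * q1 + n2 * q2 = n1 * p1 + n2 * p2 :=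
    le_antisymm (hq.2 _ hp.1) (hp.2 _ hq.1)
  rcases lt_trichotomy n2 0 with h2 | h2 | h2
  · have htop : ∀ x y, (x, y) ∈ face Δ₀ (n1, n2) → y = f x := by
      rintro x y ⟨hm, hmin⟩
      refine le_antisymm hm.2.2 ?_
      have := hmin _ (h.top_mem hm.1)
      simp only [dot] at this
      nlinarith
    have ep := htop _ _ hp
    have eq := htop _ _ hq
    have hlt : p1 < q1 := by
      refine lt_of_le_of_ne hle fun h' => hpq ?_
      rw [ep, eq, h']
    have := key f (fr p1) (-n2) (by linarith) (h.top_right p1) hlt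
      (fun z hz => by
        have := hp.2 _ (h.top_mem hz)
        simp only [dot] at this
        rw [← ep]; linarith) (by rw [← ep, ← eq]; linarith)
    refine ⟨((fr p1).den, (fr p1).num), ?_, ?_⟩
    · simp [Prod.ext_iff]
    · simp only [dot, Int.cast_natCast]
      rw [cast_num_eq, this]; ring
  · refine ⟨(0, 1), by simp, by simp [dot, h2]⟩
  · have hbot : ∀ x y, (x, y) ∈ face Δ₀ (n1, n2) → y = -H x := by
      rintro x y ⟨hm, hmin⟩
      refine le_antisymm ?_ hm.2.1
      have := hmin _ (h.bot_mem hm.1)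
      simp only [dot] at this
      nlinarith
    have ep := hbot _ _ hp
    have eq := hbot _ _ hq
    have hlt : p1 < q1 := by
      refine lt_of_le_of_ne hle fun h' => hpq ?_
      rw [ep, eq, h']
    have := key H (Hr p1) n2 h2 (h.bot_right p1) hlt
      (fun z hz => by
        have := hp.2 _ (h.bot_mem hz)
        simp only [dot] at this
        rw [ep] at this; linarith) (by rw [ep, eq] at hface; linarith)
    refine ⟨((Hr p1).den, -(Hr p1).num), ?_, ?_⟩
    · simp [Prod.ext_iff]
    · simp only [dot, Int.cast_natCast, Int.cast_neg]
      rw [cast_num_eq, this]; ring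

theorem everywhereFiniteHeight : EverywhereFiniteHeight Δ₀ := by
  intro c
  by_cases hc : c ∈ Set.Icc L R
  · have : Δ₀ ∩ verticalLine c = (fun y => (c, y)) '' Set.Icc (-H c) (f c) := by
      ext ⟨x, y⟩
      simp only [Set.mem_inter_iff, mem_band, verticalLine, Set.mem_ofPred_eq, Set.mem_image,
        Prod.mk.injEq]
      constructor
      · rintro ⟨h, rfl⟩; exact ⟨y, h.2, rfl, rfl⟩
      · rintro ⟨z, hz, rfl, rfl⟩; exact ⟨⟨hc, hz⟩, rfl⟩
    rw [this]
    exact isCompact_Icc.image (by fun_prop)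
  · have : Δ₀ ∩ verticalLine c = ∅ := by
      ext ⟨x, y⟩
      simp only [Set.mem_inter_iff, mem_band, verticalLine, Set.mem_ofPred_eq,
        Set.mem_empty_iff_false, iff_false, not_and]
      rintro ⟨h, _⟩ rfl
      exact hc h
    rw [this]
    exact isCompact_empty

theorem mem_topBoundary (h : BandData L R f H fl fr Hl Hr) {x y : ℝ} (hx : x ∈ Set.Icc L R) :
    (x, y) ∈ topBoundary Δ₀ ↔ y = f x :=
  mem_topBoundary_band (lo := fun x => -H x) hx (h.pos x hx).le

theorem top_mem_vertices (h : BandData L R f H fl fr Hl Hr) {x : ℝ} (hx : x ∈ Set.Icc L R)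
    (hne : fl x ≠ fr x) : (x, f x) ∈ vertices Δ₀ := by
  refine ⟨h.top_mem hx, ?_⟩
  rintro ⟨x1, y1⟩ ⟨_, _, h1⟩ ⟨x2, y2⟩ ⟨_, _, h2⟩ ⟨a, b, ha, hb, hab, he⟩
  simp only at h1 h2
  have e1 : a * x1 + b * x2 = x := (Prod.ext_iff.1 he).1
  have e2 : a * y1 + b * y2 = f x := (Prod.ext_iff.1 he).2
  obtain rfl : b = 1 - a := by linarith
  -- both supporting lines pass through the endpoints of the segment
  have key : ∀ s : ℝ, (∀ y, f y ≤ f x + s * (y - x)) → y1 = f x + s * (x1 - x) := by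
    intro s hs
    have a1 : y1 ≤ f x + s * (x1 - x) := h1.trans (hs x1)
    have a2 := mul_le_mul_of_nonneg_left (h2.trans (hs x2)) hb.le
    refine le_antisymm a1 ?_
    refine le_of_mul_le_mul_left ?_ ha
    have : a * (s * (x1 - x)) + (1 - a) * (s * (x2 - x)) = 0 := by
      linear_combination s * e1
    linarith
  have k1 := key _ (h.top_left x).le
  have k2 := key _ (h.top_right x).le
  have hne' : (fl x : ℝ) - fr x ≠ 0 := sub_ne_zero.2 (by exact_mod_cast hne)
  have hx1 : x1 = x := by
    have : ((fl x : ℝ) - fr x) * (x1 - x) = 0 := by linarith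
    have := (mul_eq_zero.1 this).resolve_left hne'
    linarith
  ext
  · exact hx1
  · simp only; rw [k1, hx1]; ring

/-- A band whose corners satisfy the Delzant conditions, and the hidden or fake condition above
`l j`, is a primitive semitoric polygon. -/
theorem isPrimitiveSemitoric (h : BandData L R f H fl fr Hl Hr) {m : ℕ} {l : Fin m → ℝ}
    (k : Fin m → ℤ) (hl : StrictMono l) (hlm : ∀ j, l j ∈ Set.Ioo L R)
    (htopf : {x | x ∈ Set.Ioo L R ∧ fl x ≠ fr x}.Finite)
    (hbotf : {x | x ∈ Set.Ioo L R ∧ Hl x ≠ Hr x}.Finite)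
    (htop : ∀ x ∈ Set.Ioo L R, (∀ j, x ≠ l j) → fl x = fr x ∨ slopeDet (fl x) (fr x) = 1)
    (hkink : ∀ j, fl (l j) ≠ fr (l j) ∧
      (slopeDet (fl (l j)) (fr (l j)) - (fl (l j)).den * (fr (l j)).den = 1 ∨
        slopeDet (fl (l j)) (fr (l j)) - (fl (l j)).den * (fr (l j)).den = 0))
    (hbot : ∀ x ∈ Set.Ioo L R, Hl x = Hr x ∨ slopeDet (Hl x) (Hr x) = 1)
    (h1 : (fr L).den = 1) (h2 : (fl R).den = 1) (h3 : (Hr L).den = 1) (h4 : (Hl R).den = 1) :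
    IsPrimitiveSemitoric ⟨Δ₀, l, 1, k⟩ where
  isLabeledWeighted :=
    { isPolygon := h.isPolygon htopf hbotf
      isRational := h.isRational
      strictMono := hl
      between := fun j => ⟨⟨_, h.top_mem ⟨le_rfl, h.lt.le⟩, (hlm j).1⟩,
        ⟨_, h.top_mem ⟨h.lt.le, le_rfl⟩, (hlm j).2⟩⟩ }
  finiteHeight := everywhereFiniteHeight
  sign_eq_one := fun _ => rfl
  line_meets_top := fun j => ⟨(l j, f (l j)), by
    have hx := Set.Ioo_subset_Icc_self (hlm j)
    exact (h.mem_topBoundary hx).2 rfl, rfl⟩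
  hidden_or_fake := by
    rintro j ⟨x, y⟩ ⟨ht, hv⟩
    simp only [verticalLine, Set.mem_ofPred_eq] at hv
    subst hv
    have hx := Set.Ioo_subset_Icc_self (hlm j)
    have hy := (h.mem_topBoundary hx).1 ht
    subst hy
    obtain ⟨hne, hdet⟩ := hkink j
    refine ⟨h.top_mem_vertices hx hne, ?_⟩
    have hu := h.normal_top_right ⟨(hlm j).1.le, (hlm j).2⟩
    have hv := h.normal_top_left ⟨(hlm j).1, (hlm j).2.le⟩
    have hd1 : (0 : ℤ) < (fl (l j)).den := by exact_mod_cast (fl (l j)).den_pos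
    have hd2 : (0 : ℤ) < (fr (l j)).den := by exact_mod_cast (fr (l j)).den_pos
    have hpos := mul_pos hd1 hd2
    unfold slopeDet at hdet
    refine hdet.imp (fun hdet => ⟨ht, _, _, ⟨hu, hv, ?_⟩, ?_⟩)
      (fun hdet => ⟨ht, _, _, ⟨hu, hv, ?_⟩, ?_⟩)
    all_goals simp only [det, matT]
    all_goals linarith
  delzant := by
    rintro ⟨x, y⟩ hp hnot
    have hL : L ∈ Set.Icc L R := ⟨le_rfl, h.lt.le⟩
    have hR : R ∈ Set.Icc L R := ⟨h.lt.le, le_rfl⟩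
    have hdel : ∀ (p : ℝ × ℝ) (u v : ℤ × ℤ), IsEdgeNormalAt Δ₀ p u → IsEdgeNormalAt Δ₀ p v →
        det u v = 1 → IsDelzantCorner Δ₀ p := fun p u v hu hv hd =>
      ⟨u, v, ⟨hu, hv, by rw [hd]; exact one_pos⟩, hd⟩
    obtain ⟨hx, ⟨rfl, hc⟩ | ⟨rfl, hc⟩⟩ := h.vertex_cases hp
    · rcases hc with rfl | rfl | ⟨hx', hc⟩
      · exact hdel _ _ _ (h.normal_top_right ⟨le_rfl, h.lt⟩) (h.normal_left (h.top_mem hL))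
          (by simp [det, h1])
      · exact hdel _ _ _ (h.normal_right (h.top_mem hR)) (h.normal_top_left ⟨h.lt, le_rfl⟩)
          (by simp [det, h2])
      · refine hdel _ _ _ (h.normal_top_right ⟨hx'.1.le, hx'.2⟩)
          (h.normal_top_left ⟨hx'.1, hx'.2.le⟩) ?_
        have := (htop x hx' fun j hj => hnot j
          ⟨(h.mem_topBoundary hx).2 rfl, hj⟩).resolve_left hc
        unfold slopeDet at this
        simp only [det]; linarith
    · rcases hc with rfl | rfl | ⟨hx', hc⟩
      · exact hdel _ _ _ (h.normal_left (h.bot_mem hL)) (h.normal_bot_right ⟨le_rfl, h.lt⟩)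
          (by simp [det, h3])
      · exact hdel _ _ _ (h.normal_bot_left ⟨h.lt, le_rfl⟩) (h.normal_right (h.bot_mem hR))
          (by simp [det, h4])
      · refine hdel _ _ _ (h.normal_bot_left ⟨hx'.1, hx'.2.le⟩)
          (h.normal_bot_right ⟨hx'.1.le, hx'.2⟩) ?_
        have := (hbot x hx').resolve_left hc
        unfold slopeDet at this
        simp only [det]; linarith

end BandData

/-! ### Slopes shifted by integers, and continuity of envelopes -/

theorem slopeDet_sub_natCast (s t : ℚ) (a b : ℕ) :
    slopeDet (s - a) (t - b) = slopeDet s t + (b - a) * (s.den * t.den) := by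
  have hnum : ∀ (q : ℚ) (n : ℕ), (q - n).num = q.num - n * q.den := by
    intro q n
    have h1 := Rat.mul_den_eq_num (q - n)
    rw [Rat.sub_natCast_den] at h1
    have h2 := Rat.mul_den_eq_num q
    have : ((q - n).num : ℚ) = q.num - n * q.den := by rw [← h1, ← h2]; ring
    exact_mod_cast this
  unfold slopeDet
  rw [hnum, hnum, Rat.sub_natCast_den, Rat.sub_natCast_den]
  ring

theorem tendsto_envelope {ι : Type*} {F : Filter ι} {N : ℕ} (hN : 1 ≤ N) {c : ι → ℝ → ℝ}
    {x : ι → ℝ} {c₀ : ℝ → ℝ} {x₀ : ℝ} (hc : ∀ s ∈ slopes N, Tendsto (fun i => c i s) F (𝓝 (c₀ s)))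
    (hx : Tendsto x F (𝓝 x₀)) :
    Tendsto (fun i => envelope N (c i) (x i)) F (𝓝 (envelope N c₀ x₀)) := by
  have : Nonempty (slopes N) := ⟨⟨0, zero_mem_slopes hN⟩⟩
  simp only [envelope, ← Finset.inf'_univ_eq_ciInf]
  refine Filter.Tendsto.finset_inf'_nhds_apply _ fun s _ => ?_
  exact (hx.const_mul _).add (hc s s.2)

theorem continuous_envelope {N : ℕ} (hN : 1 ≤ N) (c : ℝ → ℝ) : Continuous (envelope N c) :=
  continuous_iff_continuousAt.2 fun _ =>
    tendsto_envelope hN (fun _ _ => tendsto_const_nhds) tendsto_id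

theorem tendsto_kinkSum {ι : Type*} {F : Filter ι} {m : ℕ} {l : ι → Fin m → ℝ} {x : ι → ℝ}
    {l₀ : Fin m → ℝ} {x₀ : ℝ} (hl : ∀ j, Tendsto (fun i => l i j) F (𝓝 (l₀ j)))
    (hx : Tendsto x F (𝓝 x₀)) : Tendsto (fun i => kinkSum (l i) (x i)) F (𝓝 (kinkSum l₀ x₀)) :=
  tendsto_finsetSum _ fun j _ => (hx.sub (hl j)).max tendsto_const_nhds

theorem continuous_kinkSum {m : ℕ} (l : Fin m → ℝ) : Continuous (kinkSum l) :=
  continuous_iff_continuousAt.2 fun _ => tendsto_kinkSum (fun _ => tendsto_const_nhds) tendsto_id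

theorem kinkSum_eq_zero {m : ℕ} {l : Fin m → ℝ} {x : ℝ} (h : ∀ j, x ≤ l j) : kinkSum l x = 0 :=
  Finset.sum_eq_zero fun j _ => max_eq_right (by linarith [h j])

/-! ### Polygons given by the intercepts of their supporting lines -/

/-- Data determining a compact region between `x = left` and `x = right`. Its top is the minimum of
the lines of slope `s` and intercept `top s`, lowered by slope `1` to the right of each `line j`; its
bottom is minus the minimum of the lines of slope `s` and intercept `bot s`. The slopes used are
those in `slopes N`, for a number `N` that is kept separate. -/
structure SupportData (m : ℕ) where
  left : ℝ
  right : ℝ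
  top : ℝ → ℝ
  bot : ℝ → ℝ
  line : Fin m → ℝ

namespace SupportData

variable {m : ℕ}

/-- The top function of the region. -/
def hi (θ : SupportData m) (N : ℕ) (x : ℝ) : ℝ := envelope N θ.top x - kinkSum θ.line x

/-- The polygon determined by the data, with all signs equal to one. -/
def poly (θ : SupportData m) (N : ℕ) (k : Fin m → ℤ) : WeightedRegion m :=
  ⟨band (Set.Icc θ.left θ.right) (fun x => -envelope N θ.bot x) (θ.hi N), θ.line, 1, k⟩

/-- The intercepts are convex, only the extreme slopes `N` and `-N` are needed at the ends, and the
top is above the bottom at the ends. This is the closure of the condition `IsSmooth`, except that the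
strict inequalities between left and right ends, between top and bottom, and those for the `line j`
are kept. -/
structure IsCompatible (θ : SupportData m) (N : ℕ) : Prop where
  one_le : 1 ≤ N
  top_convex : ConvexOn ℝ Set.univ θ.top
  bot_convex : ConvexOn ℝ Set.univ θ.bot
  top_left : ∀ s ∈ Set.Icc (-N : ℝ) N, θ.top N + N * θ.left ≤ θ.top s + s * θ.left
  top_right : ∀ s ∈ Set.Icc (-N : ℝ) N, θ.top (-N) - N * θ.right ≤ θ.top s + s * θ.right
  bot_left : ∀ s ∈ Set.Icc (-N : ℝ) N, θ.bot N + N * θ.left ≤ θ.bot s + s * θ.left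
  bot_right : ∀ s ∈ Set.Icc (-N : ℝ) N, θ.bot (-N) - N * θ.right ≤ θ.bot s + s * θ.right
  strictMono : StrictMono θ.line
  line_mem : ∀ j, θ.line j ∈ Set.Ioo θ.left θ.right
  left_lt_right : θ.left < θ.right
  pos_left : 0 < (θ.top N + N * θ.left) + (θ.bot N + N * θ.left)
  pos_right : 0 < (θ.top (-N) - N * θ.right) + (θ.bot (-N) - N * θ.right) - kinkSum θ.line θ.right

/-- The intercepts are strictly convex and only the extreme slopes `N` and `-N` occur at the ends, so
that both envelopes attain every slope in `slopes N`. -/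
structure IsSmooth (θ : SupportData m) (N : ℕ) : Prop extends IsCompatible θ N where
  top_strictConvex : StrictConvexOn ℝ Set.univ θ.top
  bot_strictConvex : StrictConvexOn ℝ Set.univ θ.bot
  top_left_lt : ∀ s ∈ Set.Ico (-N : ℝ) N, θ.top N + N * θ.left < θ.top s + s * θ.left
  top_right_lt : ∀ s ∈ Set.Ioc (-N : ℝ) N, θ.top (-N) - N * θ.right < θ.top s + s * θ.right
  bot_left_lt : ∀ s ∈ Set.Ico (-N : ℝ) N, θ.bot N + N * θ.left < θ.bot s + s * θ.left
  bot_right_lt : ∀ s ∈ Set.Ioc (-N : ℝ) N, θ.bot (-N) - N * θ.right < θ.bot s + s * θ.right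

theorem cast_mem_Icc {N : ℕ} {s : ℚ} (hs : s ∈ slopes N) : (s : ℝ) ∈ Set.Icc (-N : ℝ) N := by
  have := abs_le.1 (mem_slopes.1 hs).1
  exact ⟨by exact_mod_cast this.1, by exact_mod_cast this.2⟩

theorem envelope_at_left {N : ℕ} (hN : 1 ≤ N) {c : ℝ → ℝ} {x : ℝ}
    (h : ∀ s ∈ Set.Icc (-N : ℝ) N, c N + N * x ≤ c s + s * x) : envelope N c x = c N + N * x := by
  refine le_antisymm ?_ (le_envelope hN fun s hs => ?_)
  · have := envelope_le (natCast_mem_slopes hN) c x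
    simp only [Rat.cast_natCast] at this
    linarith
  · linarith [h s (cast_mem_Icc hs)]

theorem envelope_at_right {N : ℕ} (hN : 1 ≤ N) {c : ℝ → ℝ} {x : ℝ}
    (h : ∀ s ∈ Set.Icc (-N : ℝ) N, c (-N) - N * x ≤ c s + s * x) :
    envelope N c x = c (-N) - N * x := by
  refine le_antisymm ?_ (le_envelope hN fun s hs => ?_)
  · have := envelope_le (neg_natCast_mem_slopes hN) c x
    simp only [Rat.cast_neg, Rat.cast_natCast] at this
    linarith
  · linarith [h s (cast_mem_Icc hs)]

variable {θ : SupportData m} {N : ℕ}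

/-- The top is above the bottom: the height is concave and positive at both ends. -/
theorem IsCompatible.pos (h : IsCompatible θ N) {x : ℝ} (hx : x ∈ Set.Icc θ.left θ.right) :
    -envelope N θ.bot x < θ.hi N x := by
  obtain ⟨s, _, _, _, _, _, _, hs, _⟩ := exists_envelope_slopes h.one_le θ.top x
  obtain ⟨t, _, _, _, _, _, _, ht, _⟩ := exists_envelope_slopes h.one_le θ.bot x
  have hs' := hs.sub_kinkSum_left (l := θ.line)
  set a := (s : ℝ) - (Finset.univ.filter fun j => θ.line j < x).card
  have l1 := hs'.le θ.left
  have l2 := ht.le θ.left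
  have r1 := hs'.le θ.right
  have r2 := ht.le θ.right
  rw [envelope_at_left h.one_le h.top_left, kinkSum_eq_zero fun j => (h.line_mem j).1.le] at l1
  rw [envelope_at_left h.one_le h.bot_left] at l2
  rw [envelope_at_right h.one_le h.top_right] at r1
  rw [envelope_at_right h.one_le h.bot_right] at r2
  have p1 := h.pos_left
  have p2 := h.pos_right
  unfold hi
  rcases le_total 0 (a + t) with h0 | h0
  · have := mul_nonneg h0 (sub_nonneg.2 hx.1)
    linarith
  · have := mul_nonneg_of_nonpos_of_nonpos h0 (sub_nonpos.2 hx.2)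
    linarith

theorem finite_kinks (c : ℝ → ℝ) (N : ℕ) (s t : ℝ → ℚ) (hs : ∀ x, s x ∈ slopes N)
    (ht : ∀ x, t x ∈ slopes N) (hse : ∀ x : ℝ, s x * x + c (s x) = envelope N c x)
    (hte : ∀ x : ℝ, t x * x + c (t x) = envelope N c x) : {x | s x ≠ t x}.Finite := by
  refine Set.Finite.subset (((slopes N ×ˢ slopes N).finite_toSet).image
    fun p : ℚ × ℚ => -(c p.1 - c p.2) / (p.1 - p.2)) fun x hx => ?_
  refine ⟨(s x, t x), by simp [hs, ht], ?_⟩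
  have hne : (s x : ℝ) - t x ≠ 0 := sub_ne_zero.2 (by exact_mod_cast hx)
  simp only
  rw [div_eq_iff hne]
  linarith [hse x, hte x]

/-- Smooth support data define a primitive semitoric polygon. At `line j` the slope of the top drops
by one more than the slope of the envelope, so that the corner there is fake or hidden according to
whether the envelope is affine there or not. -/
theorem IsSmooth.isPrimitiveSemitoric (h : IsSmooth θ N) (k : Fin m → ℤ) :
    IsPrimitiveSemitoric (θ.poly N k) := by
  choose s hs t ht hse hte hsl htr hst using
    exists_envelope_farey_slopes h.one_le h.top_strictConvex
  choose s' hs' t' ht' hse' hte' hsl' htr' hst' using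
    exists_envelope_farey_slopes h.one_le h.bot_strictConvex
  -- the drops of the left and right slopes at `x` caused by the marked lines
  set A : ℝ → ℕ := fun x => (Finset.univ.filter fun j => θ.line j < x).card with hA
  set B : ℝ → ℕ := fun x => (Finset.univ.filter fun j => θ.line j ≤ x).card with hB
  have hdata : BandData θ.left θ.right (θ.hi N) (envelope N θ.bot) (fun x => s x - A x)
      (fun x => t x - B x) s' t' :=
    { lt := h.left_lt_right
      pos := fun x hx => h.pos hx
      continuous_top := (continuous_envelope h.one_le _).sub (continuous_kinkSum _)
      continuous_bot := continuous_envelope h.one_le _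
      top_left := fun x => by
        have := (hsl x).sub_kinkSum_left (l := θ.line)
        push_cast; exact this
      top_right := fun x => by
        have := (htr x).sub_kinkSum_right (l := θ.line)
        push_cast; exact this
      bot_left := hsl'
      bot_right := htr' }
  have hABne : ∀ x, (∀ j, x ≠ θ.line j) → A x = B x := by
    intro x hx
    refine congrArg Finset.card (Finset.filter_congr fun j _ => ?_)
    exact ⟨le_of_lt, fun h' => lt_of_le_of_ne h' (hx j).symm⟩
  have hABeq : ∀ j, B (θ.line j) = A (θ.line j) + 1 := by
    intro j
    have : (Finset.univ.filter fun i => θ.line i ≤ θ.line j) =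
        insert j (Finset.univ.filter fun i => θ.line i < θ.line j) := by
      ext i
      simp only [Finset.mem_filter, Finset.mem_univ, true_and, Finset.mem_insert, le_iff_eq_or_lt]
      rw [h.strictMono.injective.eq_iff]
    simp only [hA, hB]
    rw [this, Finset.card_insert_of_notMem (by simp)]
  -- at the ends only the slopes `N` and `-N` occur; they are integers, so the corners are Delzant
  have hL : ∀ c : ℝ → ℝ, (∀ r ∈ Set.Ico (-N : ℝ) N, c N + N * θ.left < c r + r * θ.left) →
      ∀ q ∈ slopes N, q * θ.left + c q = envelope N c θ.left → q = (N : ℤ) := by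
    intro c hc q hq hqe
    by_contra hne
    have hq' := cast_mem_Icc hq
    have hlt := hc q ⟨hq'.1, lt_of_le_of_ne hq'.2 (by exact_mod_cast hne)⟩
    have := envelope_le (natCast_mem_slopes h.one_le) c θ.left
    simp only [Rat.cast_natCast] at this
    linarith
  have hR : ∀ c : ℝ → ℝ, (∀ r ∈ Set.Ioc (-N : ℝ) N, c (-N) - N * θ.right < c r + r * θ.right) →
      ∀ q ∈ slopes N, q * θ.right + c q = envelope N c θ.right → q = (-N : ℤ) := by
    intro c hc q hq hqe
    by_contra hne
    have hq' := cast_mem_Icc hq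
    have hlt := hc q ⟨lt_of_le_of_ne hq'.1 (fun h' => hne (by exact_mod_cast h'.symm)), hq'.2⟩
    have := envelope_le (neg_natCast_mem_slopes h.one_le) c θ.right
    simp only [Rat.cast_neg, Rat.cast_natCast] at this
    linarith
  refine hdata.isPrimitiveSemitoric k h.strictMono h.line_mem ?_ ?_ ?_ ?_ ?_ ?_ ?_ ?_ ?_
  · refine Set.Finite.subset ((finite_kinks _ N s t hs ht hse hte).union
      (Set.finite_range θ.line)) ?_
    rintro x ⟨_, hx⟩
    by_contra hcon
    simp only [Set.mem_union, not_or, Set.mem_ofPred_eq, not_not, Set.mem_range, not_exists] at hcon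
    refine hx ?_
    rw [hcon.1, hABne x fun j hj => hcon.2 j hj.symm]
  · exact (finite_kinks _ N s' t' hs' ht' hse' hte').subset fun x hx => hx.2
  · intro x _ hx
    rw [hABne x hx]
    refine (hst x).imp (fun h' => by rw [h']) fun h' => ?_
    rw [slopeDet_sub_natCast, h']; simp
  · intro j
    set x := θ.line j
    have hden1 : 0 < (s x).den := (s x).den_pos
    have hden2 : 0 < (t x).den := (t x).den_pos
    have hdet : slopeDet (s x - A x) (t x - B x) = slopeDet (s x) (t x) + (s x).den * (t x).den := by
      rw [slopeDet_sub_natCast, hABeq]; push_cast; ring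
    have hdet0 : slopeDet (s x) (t x) = 1 ∨ slopeDet (s x) (t x) = 0 := by
      rcases hst x with h' | h'
      · right; rw [h']; unfold slopeDet; ring
      · exact Or.inl h'
    rw [hdet, Rat.sub_natCast_den, Rat.sub_natCast_den]
    refine ⟨fun he => ?_, by simpa using hdet0⟩
    have h0 : slopeDet (s x - A x) (t x - B x) = 0 := by
      rw [he]; unfold slopeDet; ring
    rw [hdet] at h0
    have : (0 : ℤ) < (s x).den * (t x).den := by exact_mod_cast Nat.mul_pos hden1 hden2
    rcases hdet0 with h' | h' <;> rw [h'] at h0 <;> linarith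
  · exact fun x _ => hst' x
  · rw [Rat.sub_natCast_den, hL _ h.top_left_lt _ (ht _) (hte _)]; exact Rat.den_intCast _
  · rw [Rat.sub_natCast_den, hR _ h.top_right_lt _ (hs _) (hse _)]; exact Rat.den_intCast _
  · rw [hL _ h.bot_left_lt _ (ht' _) (hte' _)]; exact Rat.den_intCast _
  · rw [hR _ h.bot_right_lt _ (hs' _) (hse' _)]; exact Rat.den_intCast _

end SupportData

/-! ### Convergence of regions in measure -/

theorem IsAdmissible.absolutelyContinuous {ν : Measure (ℝ × ℝ)} (hν : IsAdmissible ν) :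
    ν ≪ volume := hν.1

/-- An admissible measure is finite on double cones around the horizontal axis. -/
theorem IsAdmissible.measure_cone_ne_top {ν : Measure (ℝ × ℝ)} (hν : IsAdmissible ν) (C : ℝ) :
    ν {p | |p.2| ≤ C * (1 + |p.1|)} ≠ ∞ := by
  obtain ⟨_, _, g, rfl, hint, hbd⟩ := hν
  obtain ⟨a, K, _, hK⟩ := hbd (-1) 1
  set B : Set (ℝ × ℝ) := {p | |p.2| ≤ C * (1 + |p.1|)} with hB
  have hBm : MeasurableSet B := measurableSet_le (by fun_prop) (by fun_prop)
  rw [withDensity_apply _ hBm, ← lintegral_indicator hBm]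
  refine ne_top_of_le_ne_top ?_ (lintegral_prod_le _)
  set F : ℝ → ℝ≥0∞ := fun x => (Set.Icc (-1 : ℝ) 1).indicator
    (fun _ => ENNReal.ofReal K * ENNReal.ofReal (4 * C)) x +
      ENNReal.ofReal (4 * C) * ENNReal.ofReal |x * g x| with hF
  have hpt : ∀ x, ∫⁻ y, B.indicator (fun p => ENNReal.ofReal (g p.1)) (x, y) ≤ F x := by
    intro x
    have h1 : ∀ y, B.indicator (fun p => ENNReal.ofReal (g p.1)) (x, y) =
        (Set.Icc (-(C * (1 + |x|))) (C * (1 + |x|))).indicator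
          (fun _ => ENNReal.ofReal (g x)) y := by
      intro y
      simp only [Set.indicator, hB, Set.mem_ofPred_eq, abs_le, Set.mem_Icc]
    simp_rw [h1]
    rw [lintegral_indicator measurableSet_Icc, setLIntegral_const, Real.volume_Icc]
    simp only [hF]
    by_cases hx : x ∈ Set.Icc (-1 : ℝ) 1
    · rw [Set.indicator_of_mem hx]
      refine le_add_right (mul_le_mul' (ENNReal.ofReal_le_ofReal (hK x hx).2) ?_)
      have := abs_le.2 hx
      rcases le_total 0 C with hC | hC
      · exact ENNReal.ofReal_le_ofReal (by nlinarith)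
      · rw [ENNReal.ofReal_of_nonpos (by nlinarith [abs_nonneg x])]; exact zero_le
    · refine le_add_left ?_
      have h2 : 1 ≤ |x| := by
        by_contra hcon
        exact hx (abs_le.1 (not_le.1 hcon).le)
      rcases le_total 0 C with hC | hC
      · rw [mul_comm, ← ENNReal.ofReal_mul' (abs_nonneg _),
          ← ENNReal.ofReal_mul (by nlinarith)]
        refine ENNReal.ofReal_le_ofReal ?_
        rw [abs_mul]
        have h3 := le_abs_self (g x)
        have h4 := abs_nonneg (g x)
        calc (C * (1 + |x|) - -(C * (1 + |x|))) * g x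
            ≤ (C * (1 + |x|) - -(C * (1 + |x|))) * |g x| :=
              mul_le_mul_of_nonneg_left h3 (by nlinarith)
          _ ≤ (4 * C * |x|) * |g x| := mul_le_mul_of_nonneg_right (by nlinarith) h4
          _ = _ := by ring
      · rw [ENNReal.ofReal_of_nonpos (p := C * (1 + |x|) - _) (by nlinarith)]; simp
  refine ne_top_of_le_ne_top ?_ (lintegral_mono hpt)
  rw [hF, lintegral_add_left (measurable_const.indicator measurableSet_Icc),
    lintegral_indicator measurableSet_Icc, setLIntegral_const,
    lintegral_const_mul' _ _ ENNReal.ofReal_ne_top, Real.volume_Icc]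
  have hfin : ∫⁻ x, ENNReal.ofReal |x * g x| ≠ ∞ := by
    have := hint.norm.lintegral_lt_top
    simpa only [Real.norm_eq_abs] using this.ne
  exact ENNReal.add_ne_top.2 ⟨by finiteness, ENNReal.mul_ne_top ENNReal.ofReal_ne_top hfin⟩

theorem mem_multiShear_image {m : ℕ} {l : Fin m → ℝ} {u : Fin m → ℤ} {Δ : Set (ℝ × ℝ)} {x y : ℝ} :
    (x, y) ∈ multiShear l u '' Δ ↔ (x, y - ∑ j, (u j : ℝ) * max (x - l j) 0) ∈ Δ := by
  constructor
  · rintro ⟨⟨a, b⟩, hp, he⟩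
    rw [multiShear_apply, Prod.mk.injEq] at he
    obtain ⟨rfl, rfl⟩ := he
    simpa using hp
  · intro h
    exact ⟨_, h, by rw [multiShear_apply]; simp⟩

theorem isClosed_multiShear_image {m : ℕ} (l : Fin m → ℝ) (u : Fin m → ℤ) {Δ : Set (ℝ × ℝ)}
    (h : IsClosed Δ) : IsClosed (multiShear l u '' Δ) := by
  have : multiShear l u '' Δ =
      (fun p : ℝ × ℝ => (p.1, p.2 - ∑ j, (u j : ℝ) * max (p.1 - l j) 0)) ⁻¹' Δ := by
    ext ⟨x, y⟩; exact mem_multiShear_image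
  rw [this]
  exact h.preimage (by fun_prop)

/-- The vertical displacement `(x, y) ↦ (x, y - φ x)` preserves null sets. -/
theorem ae_displaced {φ : ℝ → ℝ} (hφ : Continuous φ) {s : Set (ℝ × ℝ)} (hs : volume s = 0) :
    ∀ᵐ p : ℝ × ℝ, (p.1, p.2 - φ p.1) ∉ s := by
  have hmp : MeasurePreserving (fun p : ℝ × ℝ => (p.1, p.2 - φ p.1)) volume volume := by
    refine (MeasurePreserving.id (volume : Measure ℝ)).skew_product
      (g := fun x y => y - φ x) (by fun_prop) (ae_of_all _ fun x => ?_)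
    exact (measurePreserving_sub_right volume (φ x)).map_eq
  exact hmp.quasiMeasurePreserving.ae (p := fun p => p ∉ s) (measure_eq_zero_iff_ae_notMem.1 hs)

/-- Bands that converge pointwise and are bounded by a cone converge in the distance on regions. -/
theorem tendsto_regionDist {ν : Measure (ℝ × ℝ)} (hν : IsAdmissible ν) {m : ℕ} {ι : Type*}
    {F : Filter ι} [F.IsCountablyGenerated] {w : ι → WeightedRegion m} {w₀ : WeightedRegion m}
    {D : ι → Set ℝ} {lo hi : ι → ℝ → ℝ} {D₀ : Set ℝ} {lo₀ hi₀ : ℝ → ℝ} {X : Set ℝ} {C : ℝ}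
    (hw : ∀ i, (w i).region = band (D i) (lo i) (hi i)) (hw₀ : w₀.region = band D₀ lo₀ hi₀)
    (hclosed : ∀ i, IsClosed (w i).region) (hclosed₀ : IsClosed w₀.region)
    (hconv₀ : Convex ℝ w₀.region) (hX : volume X = 0)
    (hD : ∀ x ∉ X, ∀ᶠ i in F, x ∈ D i ↔ x ∈ D₀)
    (hlo : ∀ x ∉ X, x ∈ D₀ → Tendsto (fun i => lo i x) F (𝓝 (lo₀ x)))
    (hhi : ∀ x ∉ X, x ∈ D₀ → Tendsto (fun i => hi i x) F (𝓝 (hi₀ x)))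
    (hline : ∀ j, Tendsto (fun i => (w i).line j) F (𝓝 (w₀.line j)))
    (hbound : ∀ᶠ i in F, ∀ x ∈ D i, -(C * (1 + |x|)) ≤ lo i x ∧ hi i x ≤ C * (1 + |x|))
    (hbound₀ : ∀ x ∈ D₀, -(C * (1 + |x|)) ≤ lo₀ x ∧ hi₀ x ≤ C * (1 + |x|)) :
    Tendsto (fun i => regionDist ν w₀ (w i)) F (𝓝 0) := by
  unfold regionDist
  have h0 : (0 : ℝ≥0∞) = ∑ _u : Fin m → Fin 2, 0 := by simp
  rw [h0]
  refine tendsto_finsetSum _ fun u _ => ?_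
  set U : Fin m → ℤ := fun j => ((u j : ℕ) : ℤ)
  have hU : ∀ j, (0 : ℝ) ≤ (U j : ℝ) ∧ (U j : ℝ) ≤ 1 := fun j => by
    have : (u j : ℕ) ≤ 1 := Nat.lt_succ_iff.1 (u j).2
    simp only [U]; push_cast
    exact ⟨by positivity, by exact_mod_cast this⟩
  set φ₀ : ℝ → ℝ := fun x => ∑ j, (U j : ℝ) * max (x - w₀.line j) 0
  set φ : ι → ℝ → ℝ := fun i x => ∑ j, (U j : ℝ) * max (x - (w i).line j) 0
  have hφ : ∀ x, Tendsto (fun i => φ i x) F (𝓝 (φ₀ x)) := fun x =>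
    tendsto_finsetSum _ fun j _ =>
      ((tendsto_const_nhds.sub (hline j)).max tendsto_const_nhds).const_mul _
  -- the displaced regions stay in a cone of finite measure, with a slope that includes this bound on
  -- the displacements
  set Q : ℝ := ∑ j, (1 + (|w₀.line j| + 1)) with hQ
  have hQ0 : ∀ (x : ℝ) (l : Fin m → ℝ), (∀ j, |l j| ≤ |w₀.line j| + 1) →
      |∑ j, (U j : ℝ) * max (x - l j) 0| ≤ Q * (1 + |x|) := by
    intro x l hl
    rw [hQ, Finset.sum_mul]
    refine (Finset.abs_sum_le_sum_abs _ _).trans (Finset.sum_le_sum fun j _ => ?_)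
    have h1 : max (x - l j) 0 ≤ |x| + |l j| :=
      max_le (by linarith [le_abs_self x, neg_abs_le (l j)])
        (by positivity)
    rw [abs_of_nonneg (mul_nonneg (hU j).1 (le_max_right _ _))]
    have h2 := mul_le_mul (hU j).2 h1 (le_max_right _ _) zero_le_one
    have h3 := hl j
    nlinarith [abs_nonneg x, abs_nonneg (l j), abs_nonneg (w₀.line j)]
  have hcone : ∀ (l : Fin m → ℝ) (Δ : Set (ℝ × ℝ)) (D' : Set ℝ) (lo' hi' : ℝ → ℝ),
      Δ = band D' lo' hi' → (∀ j, |l j| ≤ |w₀.line j| + 1) →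
      (∀ x ∈ D', -(C * (1 + |x|)) ≤ lo' x ∧ hi' x ≤ C * (1 + |x|)) →
      multiShear l U '' Δ ⊆ {p | |p.2| ≤ (C + Q) * (1 + |p.1|)} := by
    rintro l _ D' lo' hi' rfl hl hb ⟨x, y⟩ hp
    rw [mem_multiShear_image] at hp
    obtain ⟨hx, h1, h2⟩ := hp
    simp only at hx h1 h2
    have h3 := hb x hx
    have h4 := abs_le.1 (hQ0 x l hl)
    simp only [Set.mem_ofPred_eq, abs_le]
    constructor <;> linarith
  rw [← measure_empty (μ := ν)]
  refine tendsto_measure_of_ae_tendsto_indicator F MeasurableSet.empty (fun i => ?_)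
    (B := {p | |p.2| ≤ (C + Q) * (1 + |p.1|)}) (measurableSet_le (by fun_prop) (by fun_prop))
    (hν.measure_cone_ne_top _) ?_ ?_
  · exact (isClosed_multiShear_image _ _ hclosed₀).measurableSet.symmDiff
      (isClosed_multiShear_image _ _ (hclosed i)).measurableSet
  · have hev : ∀ᶠ i in F, ∀ j, |(w i).line j| ≤ |w₀.line j| + 1 :=
      Filter.eventually_all.2 fun j =>
        ((hline j).abs.eventually (gt_mem_nhds (lt_add_one _))).mono fun _ => le_of_lt
    filter_upwards [hev, hbound] with i h1 h2
    refine Set.symmDiff_subset_union.trans (Set.union_subset ?_ ?_)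
    · exact hcone _ _ _ _ _ hw₀ (fun j => by linarith) hbound₀
    · exact hcone _ _ _ _ _ (hw i) h1 h2
  · -- off the displaced frontier of `w₀.region` membership is decided by strict inequalities
    refine hν.absolutelyContinuous.ae_le ?_
    have hcont : Continuous φ₀ := by fun_prop
    have hXae : ∀ᵐ p : ℝ × ℝ, p.1 ∉ X :=
      Measure.quasiMeasurePreserving_fst.ae (p := fun x => x ∉ X)
        (measure_eq_zero_iff_ae_notMem.1 hX)
    filter_upwards [ae_displaced hcont (hconv₀.addHaar_frontier volume), hXae] with ⟨x, y⟩ hp hxX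
    simp only at hp hxX
    simp only [Set.mem_empty_iff_false, iff_false, Set.mem_symmDiff, not_or, not_and, not_not]
    suffices h : ∀ᶠ i in F, (x, y) ∈ multiShear (w i).line U '' (w i).region ↔
        (x, y) ∈ multiShear w₀.line U '' w₀.region by
      filter_upwards [h] with i hi
      exact ⟨hi.2, hi.1⟩
    have hy : Tendsto (fun i => y - φ i x) F (𝓝 (y - φ₀ x)) := tendsto_const_nhds.sub (hφ x)
    simp only [mem_multiShear_image]
    by_cases hmem : (x, y - φ₀ x) ∈ w₀.region
    · have hint : (x, y - φ₀ x) ∈ interior w₀.region := by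
        by_contra hcon
        exact hp ⟨subset_closure hmem, hcon⟩
      have hxD : x ∈ D₀ := by rw [hw₀] at hmem; exact hmem.1
      -- an interior point is strictly between bottom and top
      obtain ⟨e, he, h1, h2⟩ : ∃ e > 0, (x, y - φ₀ x - e) ∈ w₀.region ∧
          (x, y - φ₀ x + e) ∈ w₀.region := by
        have hev : ∀ᶠ e in 𝓝 (0 : ℝ), (x, y - φ₀ x + e) ∈ w₀.region := by
          have hc : Continuous fun e : ℝ => (x, y - φ₀ x + e) := by fun_prop
          have : Tendsto (fun e : ℝ => (x, y - φ₀ x + e)) (𝓝 0) (𝓝 (x, y - φ₀ x)) := by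
            simpa using hc.tendsto 0
          exact this.eventually (mem_interior_iff_mem_nhds.1 hint)
        obtain ⟨r, hr, hball⟩ := Metric.eventually_nhds_iff.1 hev
        refine ⟨r / 2, by linarith, ?_, ?_⟩
        · have := hball (y := -(r / 2)) (by simp [abs_of_pos hr]; linarith)
          rwa [← sub_eq_add_neg] at this
        · exact hball (y := r / 2) (by simp [abs_of_pos hr]; linarith)
      rw [hw₀] at h1 h2
      have hlt1 : lo₀ x < y - φ₀ x := by have := h1.2.1; simp only at this; linarith
      have hlt2 : y - φ₀ x < hi₀ x := by have := h2.2.2; simp only at this; linarith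
      filter_upwards [hD x hxX, (hlo x hxX hxD).eventually_lt hy hlt1,
        hy.eventually_lt (hhi x hxX hxD) hlt2] with i h3 h4 h5
      refine ⟨fun _ => hmem, fun _ => ?_⟩
      rw [hw i]
      exact ⟨h3.2 hxD, h4.le, h5.le⟩
    · by_cases hxD : x ∈ D₀
      · have hor : y - φ₀ x < lo₀ x ∨ hi₀ x < y - φ₀ x := by
          by_contra hcon
          simp only [not_or, not_lt] at hcon
          exact hmem (by rw [hw₀]; exact ⟨hxD, hcon⟩)
        rcases hor with h | h
        · filter_upwards [hy.eventually_lt (hlo x hxX hxD) h] with i hi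
          refine ⟨fun h' => ?_, fun h' => absurd h' hmem⟩
          rw [hw i] at h'
          exact absurd h'.2.1 (not_le.2 hi)
        · filter_upwards [(hhi x hxX hxD).eventually_lt hy h] with i hi
          refine ⟨fun h' => ?_, fun h' => absurd h' hmem⟩
          rw [hw i] at h'
          exact absurd h'.2.2 (not_le.2 hi)
      · filter_upwards [hD x hxX] with i hi
        refine ⟨fun h' => ?_, fun h' => absurd h' hmem⟩
        rw [hw i] at h'
        exact absurd (hi.1 h'.1) hxD

/-! ### The profile of a primitive semitoric polygon -/

/-- The region of `w` as a band over the interval `I`. The function `hi + kinkSum w.line`, in which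
the drop of slope at the marked lines is undone, has supporting lines at all interior points, as has
`-lo`. -/
structure HasProfile {m : ℕ} (w : WeightedRegion m) (I : Set ℝ) (lo hi : ℝ → ℝ) : Prop where
  region_eq : w.region = band I lo hi
  convex : Convex ℝ w.region
  closed : IsClosed w.region
  convex_base : Convex ℝ I
  interior_nonempty : (interior I).Nonempty
  lt : ∀ x ∈ interior I, lo x < hi x
  strictMono : StrictMono w.line
  line_mem : ∀ j, w.line j ∈ interior I
  support_top : ∀ x ∈ interior I, ∃ s : ℝ, ∀ y ∈ I,
    hi y + kinkSum w.line y ≤ hi x + kinkSum w.line x + s * (y - x)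
  support_bot : ∀ x ∈ interior I, ∃ s : ℝ, ∀ y ∈ I, -lo y ≤ -lo x + s * (y - x)

theorem exists_support_of_concaveOn {I : Set ℝ} {φ : ℝ → ℝ} (h : ConcaveOn ℝ I φ) {x : ℝ}
    (hx : x ∈ interior I) : ∃ s : ℝ, ∀ y ∈ I, φ y ≤ φ x + s * (y - x) := by
  have hc := h.neg
  refine ⟨-derivWithin (-φ) (Set.Ioi x) x, fun y hy => ?_⟩
  rcases lt_trichotomy x y with hlt | rfl | hlt
  · have := hc.rightDeriv_le_slope_of_mem_interior hx hy hlt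
    rw [slope_def_field, le_div_iff₀ (by linarith)] at this
    simp only [Pi.neg_apply] at this
    linarith
  · simp
  · have h1 := hc.slope_le_leftDeriv_of_mem_interior hy hx hlt
    have h2 := h1.trans (hc.leftDeriv_le_rightDeriv_of_mem_interior hx)
    rw [slope_def_field, div_le_iff₀ (by linarith)] at h2
    simp only [Pi.neg_apply] at h2
    linarith

/-- If a function has two supporting lines at `l` whose slopes differ by at least one, then adding
`max (· - l) 0` does not destroy supporting lines at other points: their slopes increase by one to
the right of `l`. -/
theorem support_add_kink {I : Set ℝ} {φ : ℝ → ℝ} {l p q : ℝ} (hpq : p + 1 ≤ q) (hl : l ∈ I)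
    (hp : ∀ y ∈ I, φ y ≤ φ l + p * (y - l)) (hq : ∀ y ∈ I, φ y ≤ φ l + q * (y - l)) {x s : ℝ}
    (hx : x ∈ I) (hs : ∀ y ∈ I, φ y ≤ φ x + s * (y - x)) :
    (x < l → ∀ y ∈ I, φ y + max (y - l) 0 ≤ φ x + max (x - l) 0 + s * (y - x)) ∧
    (l < x → ∀ y ∈ I, φ y + max (y - l) 0 ≤ φ x + max (x - l) 0 + (s + 1) * (y - x)) := by
  have hsl := hs l hl
  constructor
  · intro hxl y hy
    have hqx := hq x hx
    have hsq : q ≤ s := by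
      have : 0 ≤ (s - q) * (l - x) := by linarith
      linarith [nonneg_of_mul_nonneg_left this (by linarith)]
    rw [max_eq_right (by linarith : x - l ≤ 0)]
    rcases le_total y l with h | h
    · rw [max_eq_right (by linarith)]; linarith [hs y hy]
    · rw [max_eq_left (by linarith)]
      have h1 := hp y hy
      have h2 := mul_le_mul_of_nonneg_right (by linarith : p + 1 ≤ s) (by linarith : 0 ≤ y - l)
      linarith
  · intro hlx y hy
    have hpx := hp x hx
    have hsp : s ≤ p := by
      have : 0 ≤ (p - s) * (x - l) := by linarith
      linarith [nonneg_of_mul_nonneg_left this (by linarith)]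
    rw [max_eq_left (by linarith : 0 ≤ x - l)]
    rcases le_total l y with h | h
    · rw [max_eq_left (by linarith)]; linarith [hs y hy]
    · rw [max_eq_right (by linarith)]
      have h1 := hq y hy
      have h2 := mul_le_mul_of_nonpos_right (by linarith : s + 1 ≤ q) (by linarith : y - l ≤ 0)
      linarith

theorem support_add_kink_self {I : Set ℝ} {φ : ℝ → ℝ} {l p q : ℝ} (hpq : p + 1 ≤ q)
    (hp : ∀ y ∈ I, φ y ≤ φ l + p * (y - l)) (hq : ∀ y ∈ I, φ y ≤ φ l + q * (y - l)) :
    ∀ y ∈ I, φ y + max (y - l) 0 ≤ φ l + max (l - l) 0 + q * (y - l) := by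
  intro y hy
  rw [sub_self, max_self]
  rcases le_total y l with h | h
  · rw [max_eq_right (by linarith)]; linarith [hq y hy]
  · rw [max_eq_left (by linarith)]
    have := mul_le_mul_of_nonneg_right hpq (by linarith : 0 ≤ y - l)
    linarith [hp y hy]

theorem support_add_kinkSum {m : ℕ} {I : Set ℝ} {φ : ℝ → ℝ} {l : Fin m → ℝ}
    (hl : Function.Injective l) (hlI : ∀ j, l j ∈ interior I)
    (hd : ∀ j, ∃ p q : ℝ, p + 1 ≤ q ∧ (∀ y ∈ I, φ y ≤ φ (l j) + p * (y - l j)) ∧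
      ∀ y ∈ I, φ y ≤ φ (l j) + q * (y - l j))
    (hs : ∀ x ∈ interior I, ∃ s : ℝ, ∀ y ∈ I, φ y ≤ φ x + s * (y - x)) :
    ∀ x ∈ interior I, ∃ s : ℝ, ∀ y ∈ I,
      φ y + kinkSum l y ≤ φ x + kinkSum l x + s * (y - x) := by
  -- the kinks are added one by one
  suffices H : ∀ J : Finset (Fin m),
      (∀ x ∈ interior I, ∃ s : ℝ, ∀ y ∈ I, φ y + ∑ j ∈ J, max (y - l j) 0 ≤
        φ x + ∑ j ∈ J, max (x - l j) 0 + s * (y - x)) ∧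
      ∀ i ∉ J, ∃ p q : ℝ, p + 1 ≤ q ∧
        (∀ y ∈ I, φ y + ∑ j ∈ J, max (y - l j) 0 ≤
          φ (l i) + ∑ j ∈ J, max (l i - l j) 0 + p * (y - l i)) ∧
        ∀ y ∈ I, φ y + ∑ j ∈ J, max (y - l j) 0 ≤
          φ (l i) + ∑ j ∈ J, max (l i - l j) 0 + q * (y - l i) from (H Finset.univ).1
  intro J
  induction J using Finset.induction_on with
  | empty => simpa using ⟨hs, hd⟩
  | insert i J hi ih =>
    obtain ⟨ih1, ih2⟩ := ih
    obtain ⟨p, q, hpq, hp, hq⟩ := ih2 i hi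
    set ψ : ℝ → ℝ := fun y => φ y + ∑ j ∈ J, max (y - l j) 0 with hψ
    have hsum : ∀ y, φ y + ∑ j ∈ insert i J, max (y - l j) 0 = ψ y + max (y - l i) 0 := by
      intro y; rw [Finset.sum_insert hi, hψ]; ring
    simp_rw [hsum]
    have hli := interior_subset (hlI i)
    constructor
    · intro x hx
      obtain ⟨s, hs'⟩ := ih1 x hx
      have hk := support_add_kink (φ := ψ) hpq hli hp hq (interior_subset hx) hs'
      rcases lt_trichotomy x (l i) with h | rfl | h
      · exact ⟨s, hk.1 h⟩
      · exact ⟨q, support_add_kink_self (φ := ψ) hpq hp hq⟩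
      · exact ⟨s + 1, hk.2 h⟩
    · intro i' hi'
      rw [Finset.mem_insert, not_or] at hi'
      obtain ⟨p', q', hpq', hp', hq'⟩ := ih2 i' hi'.2
      have hli' := interior_subset (hlI i')
      have k1 := support_add_kink (φ := ψ) hpq hli hp hq hli' hp'
      have k2 := support_add_kink (φ := ψ) hpq hli hp hq hli' hq'
      rcases lt_trichotomy (l i') (l i) with h | h | h
      · exact ⟨p', q', hpq', k1.1 h, k2.1 h⟩
      · exact absurd (hl h) hi'.1
      · exact ⟨p' + 1, q' + 1, by linarith, k1.2 h, k2.2 h⟩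

theorem IsPolygon.convex_isClosed {Δ : Set (ℝ × ℝ)} (h : IsPolygon Δ) : Convex ℝ Δ ∧ IsClosed Δ := by
  obtain ⟨S, _, rfl⟩ := h.inter_halfPlanes
  constructor
  · intro p hp q hq a b ha hb hab s hs
    have h1 := mul_le_mul_of_nonneg_left (hp s hs) ha
    have h2 := mul_le_mul_of_nonneg_left (hq s hs) hb
    have h3 : s.2 = a * s.2 + b * s.2 := by rw [← add_mul, hab, one_mul]
    simp only [dot, Prod.fst_add, Prod.snd_add, Prod.smul_fst, Prod.smul_snd, smul_eq_mul] at *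
    linarith
  · have : {p | ∀ s ∈ S, s.2 ≤ dot s.1 p} = ⋂ s ∈ S, {p | s.2 ≤ dot s.1 p} := by
      ext; simp
    rw [this]
    refine isClosed_biInter fun s _ => isClosed_le continuous_const ?_
    unfold dot; fun_prop

/-- At a hidden or fake corner the slope of the top drops by at least one. -/
theorem exists_double_support {Δ : Set (ℝ × ℝ)} {I : Set ℝ} {lo hi : ℝ → ℝ}
    (hΔ : Δ = band I lo hi) (hle : ∀ x ∈ I, lo x ≤ hi x) {x : ℝ} (hx : x ∈ interior I)
    (hlt : lo x < hi x) (h : IsHiddenCorner Δ (x, hi x) ∨ IsFakeCorner Δ (x, hi x)) :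
    ∃ p q : ℝ, p + 1 ≤ q ∧ (∀ y ∈ I, hi y ≤ hi x + p * (y - x)) ∧
      ∀ y ∈ I, hi y ≤ hi x + q * (y - x) := by
  obtain ⟨u, v, ⟨⟨_, _, hu⟩, ⟨_, _, hv⟩, hdet⟩, hT⟩ : ∃ u v, AreCornerNormals Δ (x, hi x) u v ∧
      (det u (matT v) = 1 ∨ det u (matT v) = 0) := by
    rcases h with ⟨_, u, v, h1, h2⟩ | ⟨_, u, v, h1, h2⟩
    · exact ⟨u, v, h1, Or.inl h2⟩
    · exact ⟨u, v, h1, Or.inr h2⟩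
  subst hΔ
  have hxI := interior_subset hx
  -- the normals of edges through an inner point of the top point downwards
  have hneg : ∀ n : ℤ × ℤ, n ≠ 0 → (x, hi x) ∈ face (band I lo hi) ((n.1 : ℝ), (n.2 : ℝ)) →
      (n.2 : ℝ) < 0 := by
    intro n hn hf
    have h1 := hf.2 (x, lo x) ⟨hxI, le_rfl, hlt.le⟩
    simp only [dot] at h1
    have h2 : (n.2 : ℝ) ≤ 0 := by
      by_contra hcon
      nlinarith
    refine lt_of_le_of_ne h2 fun h0 => ?_
    obtain ⟨e, he, hball⟩ := Metric.isOpen_iff.1 isOpen_interior x hx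
    have hm : ∀ t : ℝ, |t| < e → 0 ≤ (n.1 : ℝ) * t := by
      intro t ht
      have hmem : x + t ∈ I := interior_subset (hball (by simpa [Real.dist_eq] using ht))
      have := hf.2 (x + t, hi (x + t)) ⟨hmem, hle _ hmem, le_rfl⟩
      simp only [dot, h0] at this
      linarith
    have a1 := hm (e / 2) (by rw [abs_of_pos] <;> linarith)
    have a2 := hm (-(e / 2)) (by rw [abs_neg, abs_of_pos] <;> linarith)
    have hn1 : (n.1 : ℝ) = 0 := by nlinarith
    exact hn (Prod.ext (by exact_mod_cast hn1) (by exact_mod_cast h0))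
  have hu2 := hneg u (by rintro rfl; simp [det] at hdet) hu
  have hv2 := hneg v (by rintro rfl; simp [det] at hdet) hv
  have hsupp : ∀ n : ℤ × ℤ, (n.2 : ℝ) < 0 →
      (x, hi x) ∈ face (band I lo hi) ((n.1 : ℝ), (n.2 : ℝ)) →
      ∀ y ∈ I, hi y ≤ hi x + (n.1 / -n.2 : ℝ) * (y - x) := by
    intro n hn hf y hy
    have := hf.2 (y, hi y) ⟨hy, hle y hy, le_rfl⟩
    simp only [dot] at this
    have h1 : (hi y - hi x) * (-n.2) ≤ n.1 * (y - x) := by linarith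
    have h2 := (le_div_iff₀ (by linarith : (0 : ℝ) < -n.2)).2 h1
    have h3 : (n.1 / -n.2 : ℝ) * (y - x) = n.1 * (y - x) / -n.2 := by ring
    rw [h3]; linarith
  refine ⟨_, _, ?_, hsupp u hu2 hu, hsupp v hv2 hv⟩
  have hdet' : (u.1 : ℝ) * v.2 - u.2 * v.1 - u.2 * v.2 ≥ 0 := by
    have : u.1 * v.2 - u.2 * v.1 - u.2 * v.2 ≥ 0 := by
      simp only [det, matT] at hT
      rcases hT with h | h <;> linarith
    exact_mod_cast this
  rw [div_add_one (by linarith), div_le_div_iff₀ (by linarith) (by linarith)]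
  nlinarith

/-- The top of a primitive semitoric polygon is concave, and at each marked line its slope drops by at
least one because the corner is hidden or fake. Hence it remains concave when the functions
`max (· - w.line j) 0` are added. -/
theorem IsPrimitiveSemitoric.exists_hasProfile {m : ℕ} {w : WeightedRegion m}
    (hw : IsPrimitiveSemitoric w) : ∃ I lo hi, HasProfile w I lo hi := by
  obtain ⟨hconv, hclosed⟩ := hw.isLabeledWeighted.isPolygon.convex_isClosed
  set Δ := w.region with hΔ
  set I : Set ℝ := Prod.fst '' Δ with hI
  set S : ℝ → Set ℝ := fun x => {y | (x, y) ∈ Δ} with hS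
  have hScomp : ∀ x, IsCompact (S x) := by
    intro x
    have : S x = Prod.snd '' (Δ ∩ verticalLine x) := by
      ext y
      constructor
      · exact fun h => ⟨(x, y), ⟨h, rfl⟩, rfl⟩
      · rintro ⟨⟨a, b⟩, ⟨h, h'⟩, rfl⟩
        have : a = x := h'
        rw [← this]; exact h
    rw [this]
    exact (hw.finiteHeight x).image continuous_snd
  have hSne : ∀ x ∈ I, (S x).Nonempty := by
    rintro _ ⟨⟨a, b⟩, h, rfl⟩; exact ⟨b, h⟩
  set lo : ℝ → ℝ := fun x => sInf (S x) with hlo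
  set hi : ℝ → ℝ := fun x => sSup (S x) with hhi
  have hmem_hi : ∀ x ∈ I, (x, hi x) ∈ Δ := fun x hx => (hScomp x).sSup_mem (hSne x hx)
  have hmem_lo : ∀ x ∈ I, (x, lo x) ∈ Δ := fun x hx => (hScomp x).sInf_mem (hSne x hx)
  have hbounds : ∀ x y, (x, y) ∈ Δ → x ∈ I ∧ lo x ≤ y ∧ y ≤ hi x := fun x y h =>
    ⟨⟨_, h, rfl⟩, csInf_le (hScomp x).bddBelow h, le_csSup (hScomp x).bddAbove h⟩
  have hle : ∀ x ∈ I, lo x ≤ hi x := fun x hx => (hbounds _ _ (hmem_hi x hx)).2.1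
  have hcomb : ∀ x y, (x, y) ∈ Δ → ∀ x' y', (x', y') ∈ Δ → ∀ a b : ℝ, 0 ≤ a → 0 ≤ b → a + b = 1 →
      (a * x + b * x', a * y + b * y') ∈ Δ := fun x y h x' y' h' a b ha hb hab => by
    simpa using hconv h h' ha hb hab
  have hregion : Δ = band I lo hi := by
    ext ⟨x, y⟩
    refine ⟨fun h => hbounds x y h, ?_⟩
    rintro ⟨hx, h1, h2⟩
    simp only at hx h1 h2
    have hslice : Convex ℝ (S x) := by
      intro y1 h1 y2 h2 a b ha hb hab
      have := hcomb _ _ h1 _ _ h2 a b ha hb hab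
      rwa [← add_mul, hab, one_mul] at this
    exact hslice.ordConnected.out (hmem_lo x hx) (hmem_hi x hx) ⟨h1, h2⟩
  have hIconv : Convex ℝ I := hconv.linear_image (LinearMap.fst ℝ ℝ ℝ)
  have hconc : ConcaveOn ℝ I hi := by
    refine ⟨hIconv, fun x hx y hy a b ha hb hab => ?_⟩
    exact (hbounds _ _ (hcomb _ _ (hmem_hi x hx) _ _ (hmem_hi y hy) a b ha hb hab)).2.2
  have hconc' : ConcaveOn ℝ I (fun x => -lo x) := by
    refine ⟨hIconv, fun x hx y hy a b ha hb hab => ?_⟩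
    have := (hbounds _ _ (hcomb _ _ (hmem_lo x hx) _ _ (hmem_lo y hy) a b ha hb hab)).2.1
    simp only [smul_eq_mul]
    linarith
  have hsup_hi : ∀ x ∈ interior I, ∃ s : ℝ, ∀ y ∈ I, hi y ≤ hi x + s * (y - x) :=
    fun x hx => exists_support_of_concaveOn hconc hx
  have hsup_lo : ∀ x ∈ interior I, ∃ s : ℝ, ∀ y ∈ I, -lo y ≤ -lo x + s * (y - x) :=
    fun x hx => exists_support_of_concaveOn hconc' hx
  obtain ⟨⟨x1, y1⟩, hp⟩ := hw.isLabeledWeighted.isPolygon.interior_nonempty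
  have hx1 : x1 ∈ interior I := by
    refine interior_maximal (t := Prod.fst '' interior Δ) (Set.image_mono interior_subset)
      (isOpenMap_fst _ isOpen_interior) ⟨_, hp, rfl⟩
  have hx1lt : lo x1 < hi x1 := by
    have hc : Continuous fun e : ℝ => (x1, y1 + e) := by fun_prop
    have ht : Tendsto (fun e : ℝ => (x1, y1 + e)) (𝓝 0) (𝓝 (x1, y1)) := by
      simpa using hc.tendsto 0
    obtain ⟨r, hr, hball⟩ :=
      Metric.eventually_nhds_iff.1 (ht.eventually (mem_interior_iff_mem_nhds.1 hp))
    have h1 := hball (y := r / 2) (by simp [abs_of_pos hr]; linarith)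
    have h2 := (hbounds _ _ (interior_subset hp)).2.1
    have h3 := (hbounds _ _ h1).2.2
    linarith
  -- the height is concave and positive at `x1`
  have hlt : ∀ x ∈ interior I, lo x < hi x := by
    intro x hx
    by_contra hcon
    have heq : lo x = hi x := le_antisymm (hle x (interior_subset hx)) (not_lt.1 hcon)
    obtain ⟨s, hs⟩ := hsup_hi x hx
    obtain ⟨s', hs'⟩ := hsup_lo x hx
    have hne : x ≠ x1 := by rintro rfl; exact hcon hx1lt
    -- a point of `I` on the other side of `x`
    have ht : Tendsto (fun e : ℝ => x + e * (x - x1)) (𝓝[>] 0) (𝓝 x) := by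
      have hc : Continuous fun e : ℝ => x + e * (x - x1) := by fun_prop
      have := hc.tendsto 0
      simp only [zero_mul, add_zero] at this
      exact this.mono_left nhdsWithin_le_nhds
    obtain ⟨e, he, hepos⟩ := ((ht.eventually (isOpen_interior.mem_nhds hx)).and
      self_mem_nhdsWithin).exists
    have he' : (0 : ℝ) < e := hepos
    have hmem := interior_subset he
    have a1 := hs x1 (interior_subset hx1)
    have a2 := hs' x1 (interior_subset hx1)
    have b1 := hs _ hmem
    have b2 := hs' _ hmem
    have b3 := hle _ hmem
    have c1 : 0 < (s + s') * (x1 - x) := by linarith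
    have c2 : 0 ≤ e * ((s + s') * (x - x1)) := by linarith
    have c3 := mul_pos he' c1
    linarith
  have hline : ∀ j, w.line j ∈ interior I := by
    intro j
    obtain ⟨⟨p, hp, hpj⟩, ⟨q, hq, hqj⟩⟩ := hw.isLabeledWeighted.between j
    refine interior_maximal (t := Set.Ioo p.1 q.1) ?_ isOpen_Ioo ⟨hpj, hqj⟩
    exact Set.Ioo_subset_Icc_self.trans (hIconv.ordConnected.out ⟨p, hp, rfl⟩ ⟨q, hq, rfl⟩)
  refine ⟨I, lo, hi, hregion, hconv, hclosed, hIconv, ⟨x1, hx1⟩, hlt,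
    hw.isLabeledWeighted.strictMono, hline, ?_, hsup_lo⟩
  refine support_add_kinkSum hw.isLabeledWeighted.strictMono.injective hline (fun j => ?_) hsup_hi
  have hj := interior_subset (hline j)
  have htop : (w.line j, hi (w.line j)) ∈ topBoundary w.region :=
    ⟨fun y hy => (hbounds _ _ hy).2.2, fun b hb => hb (hmem_hi _ hj)⟩
  exact exists_double_support hregion hle (hline j) (hlt _ (hline j))
    (hw.hidden_or_fake j _ ⟨htop, rfl⟩).2

/-! ### Legendre transforms and interpolation of support data -/

/-- The intercept of the lowest line of slope `s` above the graph of `F` over `[L, R]`. It has a junk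
value if `L > R` or if `F` is not bounded above. -/
def legendre (F : ℝ → ℝ) (L R s : ℝ) : ℝ := sSup ((fun y => F y - s * y) '' Set.Icc L R)

section Legendre

variable {F : ℝ → ℝ} {L R : ℝ}

theorem bddAbove_legendre (hF : BddAbove (F '' Set.Icc L R)) (s : ℝ) :
    BddAbove ((fun y => F y - s * y) '' Set.Icc L R) := by
  obtain ⟨C, hC⟩ := hF
  refine ⟨C + |s| * max |L| |R|, ?_⟩
  rintro _ ⟨y, hy, rfl⟩
  have h1 := hC ⟨y, hy, rfl⟩
  have h2 : |y| ≤ max |L| |R| := abs_le_max_abs_abs hy.1 hy.2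
  have h3 : -(s * y) ≤ |s| * |y| := by rw [← abs_mul]; exact neg_le_abs _
  have h4 := mul_le_mul_of_nonneg_left h2 (abs_nonneg s)
  simp only
  linarith

theorem le_legendre (hF : BddAbove (F '' Set.Icc L R)) {y : ℝ} (hy : y ∈ Set.Icc L R) (s : ℝ) :
    F y ≤ s * y + legendre F L R s := by
  have := le_csSup (bddAbove_legendre hF s) ⟨y, hy, rfl⟩
  simp only at this
  unfold legendre
  linarith

theorem legendre_le (hLR : L ≤ R) {s a : ℝ} (h : ∀ y ∈ Set.Icc L R, F y ≤ s * y + a) :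
    legendre F L R s ≤ a := by
  refine csSup_le ((Set.nonempty_Icc.2 hLR).image _) ?_
  rintro _ ⟨y, hy, rfl⟩
  have := h y hy
  simp only
  linarith

theorem convexOn_legendre (hLR : L ≤ R) (hF : BddAbove (F '' Set.Icc L R)) :
    ConvexOn ℝ Set.univ (legendre F L R) := by
  refine ⟨convex_univ, fun s _ t _ a b ha hb hab => legendre_le hLR fun y hy => ?_⟩
  have h1 := mul_le_mul_of_nonneg_left (le_legendre hF hy s) ha
  have h2 := mul_le_mul_of_nonneg_left (le_legendre hF hy t) hb
  have h3 : F y = a * F y + b * F y := by rw [← add_mul, hab, one_mul]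
  simp only [smul_eq_mul]
  linarith

theorem legendre_add_left_le (hLR : L ≤ R) (hF : BddAbove (F '' Set.Icc L R)) {s t : ℝ}
    (hst : s ≤ t) : legendre F L R t + t * L ≤ legendre F L R s + s * L := by
  have : legendre F L R t ≤ legendre F L R s + s * L - t * L :=
    legendre_le hLR fun y hy => by
      have h1 := le_legendre hF hy s
      have h2 := mul_nonneg (sub_nonneg.2 hst) (sub_nonneg.2 hy.1)
      linarith
  linarith

theorem legendre_add_right_le (hLR : L ≤ R) (hF : BddAbove (F '' Set.Icc L R)) {s t : ℝ}
    (hst : s ≤ t) : legendre F L R s + s * R ≤ legendre F L R t + t * R := by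
  have : legendre F L R s ≤ legendre F L R t + t * R - s * R :=
    legendre_le hLR fun y hy => by
      have h1 := le_legendre hF hy t
      have h2 := mul_nonneg (sub_nonneg.2 hst) (sub_nonneg.2 hy.2)
      linarith
  linarith

theorem bddAbove_envelope {N : ℕ} (hN : 1 ≤ N) (c : ℝ → ℝ) (L R : ℝ) :
    BddAbove (envelope N c '' Set.Icc L R) :=
  (isCompact_Icc.image (continuous_envelope hN c)).bddAbove

/-- The Legendre transform of an envelope defines the same envelope, also when more slopes are
allowed. -/
theorem envelope_legendre {N N' : ℕ} (hN : 1 ≤ N) (hNN : N ≤ N') (hLR : L ≤ R) (c : ℝ → ℝ) {x : ℝ}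
    (hx : x ∈ Set.Icc L R) :
    envelope N' (legendre (envelope N c) L R) x = envelope N c x := by
  refine le_antisymm ?_ (le_envelope (hN.trans hNN) fun s _ =>
    le_legendre (bddAbove_envelope hN c L R) hx _)
  obtain ⟨s, hs, he⟩ := exists_envelope_eq hN c x
  have h1 := envelope_le (slopes_mono hNN hs) (legendre (envelope N c) L R) x
  have h2 : legendre (envelope N c) L R s ≤ c s := legendre_le hLR fun y _ => envelope_le hs c y
  linarith

end Legendre

/-- The sum of the kinks is jointly convex in the marked lines and the point. -/
theorem kinkSum_lerp_le {m : ℕ} (l l' : Fin m → ℝ) (x x' : ℝ) {t : ℝ} (ht : t ∈ Set.Icc (0 : ℝ) 1) :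
    kinkSum (fun j => (1 - t) * l j + t * l' j) ((1 - t) * x + t * x') ≤
      (1 - t) * kinkSum l x + t * kinkSum l' x' := by
  unfold kinkSum
  rw [Finset.mul_sum, Finset.mul_sum, ← Finset.sum_add_distrib]
  have h0 : 0 ≤ 1 - t := by linarith [ht.2]
  refine Finset.sum_le_sum fun j _ => max_le ?_ ?_
  · have h1 := mul_le_mul_of_nonneg_left (le_max_left (x - l j) 0) h0
    have h2 := mul_le_mul_of_nonneg_left (le_max_left (x' - l' j) 0) ht.1
    linarith
  · exact add_nonneg (mul_nonneg h0 (le_max_right _ _)) (mul_nonneg ht.1 (le_max_right _ _))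

/-- Envelopes are jointly concave in the intercepts and the point. -/
theorem le_envelope_lerp {N : ℕ} (hN : 1 ≤ N) (c c' : ℝ → ℝ) (x x' : ℝ) {t : ℝ}
    (ht : t ∈ Set.Icc (0 : ℝ) 1) :
    (1 - t) * envelope N c x + t * envelope N c' x' ≤
      envelope N (fun s => (1 - t) * c s + t * c' s) ((1 - t) * x + t * x') := by
  have h0 : 0 ≤ 1 - t := by linarith [ht.2]
  refine le_envelope hN fun s hs => ?_
  have h1 := mul_le_mul_of_nonneg_left (envelope_le hs c x) h0
  have h2 := mul_le_mul_of_nonneg_left (envelope_le hs c' x') ht.1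
  linarith

theorem lerp_lt_lerp {a b a' b' t : ℝ} (ht : t ∈ Set.Icc (0 : ℝ) 1) (h : a < b) (h' : a' < b') :
    (1 - t) * a + t * a' < (1 - t) * b + t * b' := by
  rcases ht.1.eq_or_lt with rfl | h0
  · simpa using h
  · have h1 := mul_le_mul_of_nonneg_left h.le (by linarith [ht.2] : 0 ≤ 1 - t)
    have h2 := mul_lt_mul_of_pos_left h' h0
    linarith

theorem lerp_le_lerp {a b a' b' t : ℝ} (ht : t ∈ Set.Icc (0 : ℝ) 1) (h : a ≤ b) (h' : a' ≤ b') :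
    (1 - t) * a + t * a' ≤ (1 - t) * b + t * b' :=
  add_le_add (mul_le_mul_of_nonneg_left h (by linarith [ht.2])) (mul_le_mul_of_nonneg_left h' ht.1)

namespace SupportData

variable {m : ℕ} {θ θ' : SupportData m} {N N' : ℕ}

/-- The same region, with the intercepts replaced by the lowest possible ones for all slopes. -/
def closure (θ : SupportData m) (N : ℕ) : SupportData m where
  left := θ.left
  right := θ.right
  top := legendre (envelope N θ.top) θ.left θ.right
  bot := legendre (envelope N θ.bot) θ.left θ.right
  line := θ.line

/-- Linear interpolation of support data. On regions it interpolates Minkowski sums. -/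
def lerp (θ θ' : SupportData m) (t : ℝ) : SupportData m where
  left := (1 - t) * θ.left + t * θ'.left
  right := (1 - t) * θ.right + t * θ'.right
  top := fun s => (1 - t) * θ.top s + t * θ'.top s
  bot := fun s => (1 - t) * θ.bot s + t * θ'.bot s
  line := fun j => (1 - t) * θ.line j + t * θ'.line j

theorem lerp_zero (θ θ' : SupportData m) : θ.lerp θ' 0 = θ := by simp [lerp]

theorem lerp_one (θ θ' : SupportData m) : θ.lerp θ' 1 = θ' := by simp [lerp]

theorem IsCompatible.closure (h : IsCompatible θ N) (hNN : N ≤ N') :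
    IsCompatible (θ.closure N) N' := by
  have hN' := h.one_le.trans hNN
  have hLR := h.left_lt_right.le
  have hb := fun c => bddAbove_envelope h.one_le c θ.left θ.right
  have hleft : ∀ c : ℝ → ℝ, ∀ s ∈ Set.Icc (-N' : ℝ) N',
      legendre (envelope N c) θ.left θ.right N' + N' * θ.left ≤
        legendre (envelope N c) θ.left θ.right s + s * θ.left :=
    fun c s hs => legendre_add_left_le hLR (hb c) hs.2
  have hright : ∀ c : ℝ → ℝ, ∀ s ∈ Set.Icc (-N' : ℝ) N',
      legendre (envelope N c) θ.left θ.right (-N') - N' * θ.right ≤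
        legendre (envelope N c) θ.left θ.right s + s * θ.right :=
    fun c s hs => by linarith [legendre_add_right_le hLR (hb c) hs.1]
  have hL : θ.left ∈ Set.Icc θ.left θ.right := ⟨le_rfl, hLR⟩
  have hR : θ.right ∈ Set.Icc θ.left θ.right := ⟨hLR, le_rfl⟩
  refine ⟨hN', convexOn_legendre hLR (hb _), convexOn_legendre hLR (hb _), hleft _, hright _,
    hleft _, hright _, h.strictMono, h.line_mem, h.left_lt_right, ?_, ?_⟩
  · change 0 < (legendre (envelope N θ.top) θ.left θ.right N' + N' * θ.left) +
      (legendre (envelope N θ.bot) θ.left θ.right N' + N' * θ.left)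
    rw [← envelope_at_left hN' (hleft _), ← envelope_at_left hN' (hleft _),
      envelope_legendre h.one_le hNN hLR _ hL, envelope_legendre h.one_le hNN hLR _ hL,
      envelope_at_left h.one_le h.top_left, envelope_at_left h.one_le h.bot_left]
    exact h.pos_left
  · change 0 < (legendre (envelope N θ.top) θ.left θ.right (-N') - N' * θ.right) +
      (legendre (envelope N θ.bot) θ.left θ.right (-N') - N' * θ.right) - kinkSum θ.line θ.right
    rw [← envelope_at_right hN' (hright _), ← envelope_at_right hN' (hright _),
      envelope_legendre h.one_le hNN hLR _ hR, envelope_legendre h.one_le hNN hLR _ hR,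
      envelope_at_right h.one_le h.top_right, envelope_at_right h.one_le h.bot_right]
    exact h.pos_right

theorem IsCompatible.poly_closure (h : IsCompatible θ N) (hNN : N ≤ N') (k : Fin m → ℤ) :
    (θ.closure N).poly N' k = θ.poly N k := by
  have hLR := h.left_lt_right.le
  refine WeightedRegion.ext ?_ rfl rfl rfl
  ext ⟨x, y⟩
  simp only [poly, mem_band, hi]
  refine and_congr_right fun hx => ?_
  change -envelope N' (legendre (envelope N θ.bot) θ.left θ.right) x ≤ y ∧
    y ≤ envelope N' (legendre (envelope N θ.top) θ.left θ.right) x - kinkSum θ.line x ↔ _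
  rw [envelope_legendre h.one_le hNN hLR _ hx, envelope_legendre h.one_le hNN hLR _ hx]

theorem IsCompatible.lerp (h : IsCompatible θ N) (h' : IsCompatible θ' N) {t : ℝ}
    (ht : t ∈ Set.Icc (0 : ℝ) 1) : IsCompatible (θ.lerp θ' t) N := by
  have h0 : 0 ≤ 1 - t := by linarith [ht.2]
  refine ⟨h.one_le, (h.top_convex.smul h0).add (h'.top_convex.smul ht.1),
    (h.bot_convex.smul h0).add (h'.bot_convex.smul ht.1), fun s hs => ?_, fun s hs => ?_,
    fun s hs => ?_, fun s hs => ?_, fun i j hij => ?_, fun j => ⟨?_, ?_⟩, ?_, ?_, ?_⟩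
  all_goals simp only [SupportData.lerp]
  · linarith [lerp_le_lerp ht (h.top_left s hs) (h'.top_left s hs)]
  · linarith [lerp_le_lerp ht (h.top_right s hs) (h'.top_right s hs)]
  · linarith [lerp_le_lerp ht (h.bot_left s hs) (h'.bot_left s hs)]
  · linarith [lerp_le_lerp ht (h.bot_right s hs) (h'.bot_right s hs)]
  · exact lerp_lt_lerp ht (h.strictMono hij) (h'.strictMono hij)
  · exact lerp_lt_lerp ht (h.line_mem j).1 (h'.line_mem j).1
  · exact lerp_lt_lerp ht (h.line_mem j).2 (h'.line_mem j).2
  · exact lerp_lt_lerp ht h.left_lt_right h'.left_lt_right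
  · linarith [lerp_lt_lerp ht h.pos_left h'.pos_left]
  · linarith [lerp_lt_lerp ht h.pos_right h'.pos_right,
      kinkSum_lerp_le θ.line θ'.line θ.right θ'.right ht]

theorem lerp_lt_lerp_of_pos {a b a' b' t : ℝ} (ht : t ∈ Set.Ioc (0 : ℝ) 1) (h : a ≤ b)
    (h' : a' < b') : (1 - t) * a + t * a' < (1 - t) * b + t * b' :=
  add_lt_add_of_le_of_lt (mul_le_mul_of_nonneg_left h (by linarith [ht.2]))
    (mul_lt_mul_of_pos_left h' ht.1)

theorem strictConvexOn_lerp {c c' : ℝ → ℝ} (hc : ConvexOn ℝ Set.univ c)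
    (hc' : StrictConvexOn ℝ Set.univ c') {t : ℝ} (ht : t ∈ Set.Ioc (0 : ℝ) 1) :
    StrictConvexOn ℝ Set.univ (fun s => (1 - t) * c s + t * c' s) := by
  refine ⟨convex_univ, fun x hx y hy hxy a b ha hb hab => ?_⟩
  have h1 := hc.2 hx hy ha.le hb.le hab
  have h2 := hc'.2 hx hy hxy ha hb hab
  have := lerp_lt_lerp_of_pos ht h1 h2
  simp only [smul_eq_mul] at *
  linarith

/-- The segment from compatible to smooth support data consists of smooth support data. -/
theorem IsCompatible.isSmooth_lerp (h : IsCompatible θ N) (h' : IsSmooth θ' N) {t : ℝ}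
    (ht : t ∈ Set.Ioc (0 : ℝ) 1) : IsSmooth (θ.lerp θ' t) N := by
  refine ⟨h.lerp h'.toIsCompatible ⟨ht.1.le, ht.2⟩,
    strictConvexOn_lerp h.top_convex h'.top_strictConvex ht,
    strictConvexOn_lerp h.bot_convex h'.bot_strictConvex ht, fun s hs => ?_, fun s hs => ?_,
    fun s hs => ?_, fun s hs => ?_⟩
  all_goals simp only [SupportData.lerp]
  · linarith [lerp_lt_lerp_of_pos ht (h.top_left s ⟨hs.1, hs.2.le⟩) (h'.top_left_lt s hs)]
  · linarith [lerp_lt_lerp_of_pos ht (h.top_right s ⟨hs.1.le, hs.2⟩) (h'.top_right_lt s hs)]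
  · linarith [lerp_lt_lerp_of_pos ht (h.bot_left s ⟨hs.1, hs.2.le⟩) (h'.bot_left_lt s hs)]
  · linarith [lerp_lt_lerp_of_pos ht (h.bot_right s ⟨hs.1.le, hs.2⟩) (h'.bot_right_lt s hs)]

/-- The segment joining two smooth polygons, the first with at most as many slopes as the second. -/
def segment (θ θ' : SupportData m) (N : ℕ) (t : ℝ) : SupportData m := (θ.closure N).lerp θ' t

/-- At `t = 0` the polygon is the first one, because the closure of its data defines the same region
for the larger set of slopes; afterwards the data are smooth. -/
theorem IsSmooth.isPrimitiveSemitoric_segment (h : IsSmooth θ N) (h' : IsSmooth θ' N')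
    (hNN : N ≤ N') (k : Fin m → ℤ) {t : ℝ} (ht : t ∈ Set.Icc (0 : ℝ) 1) :
    IsPrimitiveSemitoric ((segment θ θ' N t).poly N' k) := by
  rcases ht.1.eq_or_lt with rfl | h0
  · rw [segment, lerp_zero, h.poly_closure hNN]
    exact h.isPrimitiveSemitoric k
  · exact ((h.closure hNN).isSmooth_lerp h' ⟨h0, ht.2⟩).isPrimitiveSemitoric k

/-- The height of the region above `line j`. -/
def height (θ : SupportData m) (N : ℕ) (j : Fin m) : ℝ :=
  θ.hi N (θ.line j) + envelope N θ.bot (θ.line j)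

theorem le_height_lerp (hN : 1 ≤ N) (θ θ' : SupportData m) (j : Fin m) {t : ℝ}
    (ht : t ∈ Set.Icc (0 : ℝ) 1) :
    (1 - t) * θ.height N j + t * θ'.height N j ≤ (θ.lerp θ' t).height N j := by
  have h1 := le_envelope_lerp hN θ.top θ'.top (θ.line j) (θ'.line j) ht
  have h2 := le_envelope_lerp hN θ.bot θ'.bot (θ.line j) (θ'.line j) ht
  have h3 := kinkSum_lerp_le θ.line θ'.line (θ.line j) (θ'.line j) ht
  simp only [height, hi, SupportData.lerp]
  linarith

theorem IsCompatible.height_closure (h : IsCompatible θ N) (hNN : N ≤ N') (j : Fin m) :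
    (θ.closure N).height N' j = θ.height N j := by
  have hLR := h.left_lt_right.le
  have hx := Set.Ioo_subset_Icc_self (h.line_mem j)
  simp only [height, hi, SupportData.closure]
  rw [envelope_legendre h.one_le hNN hLR _ hx, envelope_legendre h.one_le hNN hLR _ hx]

end SupportData

/-! ### Smooth approximation of a primitive semitoric polygon -/

/-- Strictly convex intercepts close to the Legendre transform of `F` over `[L, R]`. -/
def capIntercept (F : ℝ → ℝ) (L R δ s : ℝ) : ℝ := legendre F L R s + δ * s ^ 2

section Cap

variable {F : ℝ → ℝ} {L R δ : ℝ}

theorem strictConvexOn_capIntercept (hLR : L ≤ R) (hF : BddAbove (F '' Set.Icc L R)) (hδ : 0 < δ) :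
    StrictConvexOn ℝ Set.univ (capIntercept F L R δ) := by
  have h2 : StrictConvexOn ℝ Set.univ fun s : ℝ => δ * s ^ 2 := by
    refine ⟨convex_univ, fun x _ y _ hxy a b ha hb hab => ?_⟩
    obtain rfl : b = 1 - a := by linarith
    simp only [smul_eq_mul]
    have : 0 < δ * (a * (1 - a) * (x - y) ^ 2) :=
      mul_pos hδ (mul_pos (mul_pos ha hb) (by have := sub_ne_zero.2 hxy; positivity))
    nlinarith
  exact (convexOn_legendre hLR hF).add_strictConvexOn h2

theorem le_capIntercept (hF : BddAbove (F '' Set.Icc L R)) (hδ : 0 < δ) {x : ℝ}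
    (hx : x ∈ Set.Icc L R) (s : ℝ) : F x ≤ s * x + capIntercept F L R δ s := by
  have := le_legendre hF hx s
  unfold capIntercept
  linarith [mul_nonneg hδ.le (sq_nonneg s)]

theorem capIntercept_le (hLR : L ≤ R) {M s b : ℝ} (hM : ∀ y ∈ Set.Icc L R, |y| ≤ M)
    (hs : ∀ y ∈ Set.Icc L R, F y ≤ s * y + b) (r : ℝ) :
    capIntercept F L R δ r ≤ b + M * |r - s| + δ * r ^ 2 := by
  unfold capIntercept
  refine add_le_add_left (legendre_le hLR fun y hy => ?_) _
  have h1 : -((r - s) * y) ≤ |r - s| * |y| := by rw [← abs_mul]; exact neg_le_abs _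
  have h2 := mul_le_mul_of_nonneg_left (hM y hy) (abs_nonneg (r - s))
  linarith [hs y hy]

theorem capIntercept_left_lt (hLR : L ≤ R) (hF : BddAbove (F '' Set.Icc L R)) {N η : ℝ}
    (hη : 2 * N * δ < η) (hδ : 0 < δ) {s : ℝ} (hs : s ∈ Set.Ico (-N) N) :
    capIntercept F L R δ N + N * (L - η) < capIntercept F L R δ s + s * (L - η) := by
  have h1 := legendre_add_left_le hLR hF hs.2.le
  have h2 : δ * (N + s) < η := by nlinarith [hs.2]
  have h3 := mul_lt_mul_of_pos_right h2 (sub_pos.2 hs.2)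
  unfold capIntercept
  nlinarith

theorem capIntercept_right_lt (hLR : L ≤ R) (hF : BddAbove (F '' Set.Icc L R)) {N η : ℝ}
    (hη : 2 * N * δ < η) (hδ : 0 < δ) {s : ℝ} (hs : s ∈ Set.Ioc (-N) N) :
    capIntercept F L R δ (-N) - N * (R + η) < capIntercept F L R δ s + s * (R + η) := by
  have h1 := legendre_add_right_le hLR hF hs.1.le
  have h2 : δ * (N - s) < η := by nlinarith [hs.1]
  have h3 := mul_lt_mul_of_pos_right h2 (by linarith [hs.1] : 0 < s + N)
  unfold capIntercept
  nlinarith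

theorem bddAbove_of_support (hs : ∃ s b : ℝ, ∀ y ∈ Set.Icc L R, F y ≤ s * y + b) :
    BddAbove (F '' Set.Icc L R) := by
  obtain ⟨s, b, h⟩ := hs
  refine ⟨|s| * max |L| |R| + b, ?_⟩
  rintro _ ⟨y, hy, rfl⟩
  have h2 : |y| ≤ max |L| |R| := abs_le_max_abs_abs hy.1 hy.2
  have h3 : s * y ≤ |s| * |y| := by rw [← abs_mul]; exact le_abs_self _
  have h4 := mul_le_mul_of_nonneg_left h2 (abs_nonneg s)
  linarith [h y hy]

end Cap

/-- An open interval is exhausted by an increasing sequence of compact intervals. -/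
theorem exists_exhaustion {J : Set ℝ} (hJ : IsOpen J) (hne : J.Nonempty) {m : ℕ} {l : Fin m → ℝ}
    (hl : ∀ j, l j ∈ J) : ∃ L R : ℕ → ℝ, Antitone L ∧ Monotone R ∧
      (∀ n, L n < R n ∧ L n ∈ J ∧ R n ∈ J ∧ ∀ j, l j ∈ Set.Icc (L n) (R n)) ∧
      ∀ x ∈ J, ∀ᶠ n in atTop, x ∈ Set.Icc (L n) (R n) := by
  have : Nonempty J := hne.to_subtype
  set q : ℕ → ℝ := fun k => (TopologicalSpace.denseSeq J k : ℝ) with hq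
  have hqJ : ∀ k, q k ∈ J := fun k => (TopologicalSpace.denseSeq J k).2
  have hdense : ∀ U : Set ℝ, IsOpen U → (U ∩ J).Nonempty → ∃ k, q k ∈ U := by
    rintro U hU ⟨x, hxU, hxJ⟩
    have := (TopologicalSpace.denseRange_denseSeq J).exists_mem_open
      (hU.preimage continuous_subtype_val) ⟨⟨x, hxJ⟩, hxU⟩
    exact this
  have hr : ∀ n : ℕ, (Finset.range (n + 1)).Nonempty := fun n => ⟨0, by simp⟩
  set L : ℕ → ℝ := fun n => (Finset.range (n + 1)).inf' (hr n) q with hLdef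
  set R : ℕ → ℝ := fun n => (Finset.range (n + 1)).sup' (hr n) q with hRdef
  have hsub : ∀ {a b : ℕ}, a ≤ b → Finset.range (a + 1) ⊆ Finset.range (b + 1) := fun h =>
    Finset.range_mono (by omega)
  have hLanti : Antitone L := fun a b h => Finset.inf'_mono _ (hsub h) (hr a)
  have hRmono : Monotone R := fun a b h => Finset.sup'_mono _ (hsub h) (hr a)
  have hLJ : ∀ n, L n ∈ J := fun n => by
    obtain ⟨k, _, hk⟩ := Finset.exists_mem_eq_inf' (hr n) q
    change (Finset.range (n + 1)).inf' (hr n) q ∈ J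
    exact hk.symm ▸ hqJ k
  have hRJ : ∀ n, R n ∈ J := fun n => by
    obtain ⟨k, _, hk⟩ := Finset.exists_mem_eq_sup' (hr n) q
    change (Finset.range (n + 1)).sup' (hr n) q ∈ J
    exact hk.symm ▸ hqJ k
  have hexL : ∀ x ∈ J, ∃ n, L n < x := by
    intro x hx
    have hxnear : (Set.Iio x ∩ J).Nonempty :=
      Filter.nonempty_of_mem (f := 𝓝[<] x) (Filter.inter_mem self_mem_nhdsWithin
        (nhdsWithin_le_nhds (hJ.mem_nhds hx)))
    obtain ⟨k, hk⟩ := hdense _ isOpen_Iio hxnear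
    exact ⟨k, (Finset.inf'_le q (by simp : k ∈ Finset.range (k + 1))).trans_lt hk⟩
  have hexR : ∀ x ∈ J, ∃ n, x < R n := by
    intro x hx
    have hxnear : (Set.Ioi x ∩ J).Nonempty :=
      Filter.nonempty_of_mem (f := 𝓝[>] x) (Filter.inter_mem self_mem_nhdsWithin
        (nhdsWithin_le_nhds (hJ.mem_nhds hx)))
    obtain ⟨k, hk⟩ := hdense _ isOpen_Ioi hxnear
    exact ⟨k, lt_of_lt_of_le hk (Finset.le_sup' q (by simp : k ∈ Finset.range (k + 1)))⟩
  have hev : ∀ x ∈ J, ∀ᶠ n in atTop, L n < x ∧ x < R n := by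
    intro x hx
    obtain ⟨a, ha⟩ := hexL x hx
    obtain ⟨b, hb⟩ := hexR x hx
    filter_upwards [eventually_ge_atTop a, eventually_ge_atTop b] with n h1 h2
    exact ⟨(hLanti h1).trans_lt ha, hb.trans_le (hRmono h2)⟩
  obtain ⟨x₀, hx₀⟩ := hne
  obtain ⟨n₀, h1, h2⟩ := ((hev x₀ hx₀).and (eventually_all.2 fun j => hev _ (hl j))).exists
  refine ⟨fun n => L (n + n₀), fun n => R (n + n₀), fun a b h => hLanti (by omega),
    fun a b h => hRmono (by omega), fun n => ⟨?_, hLJ _, hRJ _, fun j => ?_⟩, fun x hx => ?_⟩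
  · exact ((hLanti (by omega : n₀ ≤ n + n₀)).trans_lt h1.1).trans
      (h1.2.trans_le (hRmono (by omega)))
  · exact ⟨(hLanti (by omega : n₀ ≤ n + n₀)).trans (h2 j).1.le,
      (h2 j).2.le.trans (hRmono (by omega))⟩
  · have := (tendsto_add_atTop_nat n₀).eventually (hev x hx)
    exact this.mono fun n h => ⟨h.1.le, h.2.le⟩

/-- A sequence of smooth support data `θ n` with slopes in `slopes (N n)`, exhausting the base and
approximating the top and the bottom of a profile from above and below. The profile is bounded by
the approximation over the core `[L n, R n]`. -/
structure IsApproximation {m : ℕ} (w : WeightedRegion m) (I : Set ℝ) (lo hi : ℝ → ℝ)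
    (θ : ℕ → SupportData m) (N : ℕ → ℕ) (L R M : ℕ → ℝ) : Prop where
  smooth : ∀ n, (θ n).IsSmooth (N n)
  line_eq : ∀ n, (θ n).line = w.line
  N_mono : Monotone N
  L_anti : Antitone L
  R_mono : Monotone R
  left_le : ∀ n, (θ n).left ≤ L n
  le_right : ∀ n, R n ≤ (θ n).right
  sub : ∀ n, Set.Icc (θ n).left (θ n).right ⊆ interior I
  exhaust : ∀ x ∈ interior I, ∀ᶠ n in atTop, x ∈ Set.Icc (L n) (R n)
  line_mem : ∀ n j, w.line j ∈ Set.Icc (L n) (R n)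
  le_M : ∀ n, ∀ y ∈ Set.Icc (θ n).left (θ n).right, |y| ≤ M n
  one_le_M : ∀ n, 1 ≤ M n
  M_le : ∀ n, (n + 1) * M n ≤ N n
  top_lower : ∀ n, ∀ x ∈ Set.Icc (L n) (R n), ∀ s, hi x + kinkSum w.line x ≤ s * x + (θ n).top s
  bot_lower : ∀ n, ∀ x ∈ Set.Icc (L n) (R n), ∀ s, -lo x ≤ s * x + (θ n).bot s
  top_upper : ∀ n s b, (∀ y ∈ I, hi y + kinkSum w.line y ≤ s * y + b) →
    ∀ r, (θ n).top r ≤ b + M n * |r - s| + 1 / (n + 1) * r ^ 2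
  bot_upper : ∀ n s b, (∀ y ∈ I, -lo y ≤ s * y + b) →
    ∀ r, (θ n).bot r ≤ b + M n * |r - s| + 1 / (n + 1) * r ^ 2

theorem kinkSum_add_le {m : ℕ} (l : Fin m → ℝ) (x : ℝ) {e : ℝ} (he : 0 ≤ e) :
    kinkSum l (x + e) ≤ kinkSum l x + m * e := by
  have : kinkSum l x + m * e = ∑ j, (max (x - l j) 0 + e) := by
    rw [Finset.sum_add_distrib]; simp [kinkSum]
  rw [this]
  refine Finset.sum_le_sum fun j _ => max_le ?_ ?_
  · linarith [le_max_left (x - l j) 0]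
  · linarith [le_max_right (x - l j) 0]

/-- Every profile has an approximation. The intercepts at step `n` are those of the concave functions
over the core, made strictly convex by a small quadratic term, and the ends are moved slightly
outwards from the core, where the lines of slope `N n` and `-N n` are the lowest. -/
theorem HasProfile.exists_isApproximation {m : ℕ} {w : WeightedRegion m} {I : Set ℝ}
    {lo hi : ℝ → ℝ} (h : HasProfile w I lo hi) :
    ∃ θ N L R M, IsApproximation w I lo hi θ N L R M := by
  obtain ⟨L, R, hLanti, hRmono, hLR, hex⟩ :=
    exists_exhaustion isOpen_interior h.interior_nonempty h.line_mem
  set M : ℕ → ℝ := fun n => max |L n| |R n| + 1 with hM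
  have hM1 : ∀ n, 1 ≤ M n := fun n => by
    have := (abs_nonneg (L n)).trans (le_max_left _ |R n|)
    simp only [hM]; linarith
  -- a sum, so that `N` is monotone
  set N : ℕ → ℕ := fun n => ∑ i ∈ Finset.range (n + 1), (i + 1) * ⌈M i⌉₊ with hN
  have hNmono : Monotone N := fun a b hab =>
    Finset.sum_le_sum_of_subset (Finset.range_mono (by omega))
  have hNM : ∀ n, (n + 1) * M n ≤ N n := by
    intro n
    have h1 : (n + 1) * ⌈M n⌉₊ ≤ N n :=
      Finset.single_le_sum (f := fun i => (i + 1) * ⌈M i⌉₊) (fun _ _ => Nat.zero_le _)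
        (by simp : n ∈ Finset.range (n + 1))
    have h2 : ((n : ℝ) + 1) * ⌈M n⌉₊ ≤ N n := by exact_mod_cast h1
    exact (mul_le_mul_of_nonneg_left (Nat.le_ceil _) (by positivity)).trans h2
  have hN1 : ∀ n, 1 ≤ N n := fun n => by
    have h1 := hNM n
    have h2 : (1 : ℝ) * 1 ≤ (n + 1) * M n :=
      mul_le_mul (by linarith [(Nat.cast_nonneg n : (0 : ℝ) ≤ n)]) (hM1 n) zero_le_one (by positivity)
    have : (1 : ℝ) ≤ N n := by linarith
    exact_mod_cast this
  -- the margins by which the ends are moved outwards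
  have hη : ∀ n, ∃ η : ℝ, 0 < η ∧ L n - η ∈ interior I ∧ R n + η ∈ interior I ∧ η < 1 / (n + 1) ∧
      2 * N n * η < hi (L n) - lo (L n) ∧ (2 * N n + m) * η < hi (R n) - lo (R n) := by
    intro n
    obtain ⟨_, hLn, hRn, _⟩ := hLR n
    have e1 : ∀ᶠ η : ℝ in 𝓝 0, L n - η ∈ interior I := by
      have hc : Continuous fun η : ℝ => L n - η := by fun_prop
      exact (hc.tendsto 0).eventually (isOpen_interior.mem_nhds (by simpa using hLn))
    have e2 : ∀ᶠ η : ℝ in 𝓝 0, R n + η ∈ interior I := by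
      have hc : Continuous fun η : ℝ => R n + η := by fun_prop
      exact (hc.tendsto 0).eventually (isOpen_interior.mem_nhds (by simpa using hRn))
    have e3 : ∀ᶠ η : ℝ in 𝓝 0, η < 1 / (n + 1) := gt_mem_nhds (by positivity)
    have e4 : ∀ (a b : ℝ), 0 < b → ∀ᶠ η : ℝ in 𝓝 0, a * η < b := by
      intro a b hb
      have hc : Continuous fun η : ℝ => a * η := by fun_prop
      exact (hc.tendsto 0).eventually (gt_mem_nhds (by simpa using hb))
    have e := e1.and (e2.and (e3.and ((e4 (2 * N n) _ (sub_pos.2 (h.lt _ hLn))).and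
      (e4 (2 * N n + m) _ (sub_pos.2 (h.lt _ hRn))))))
    obtain ⟨η, h1, h2⟩ := Filter.nonempty_of_mem (f := 𝓝[>] (0 : ℝ))
      (Filter.inter_mem (nhdsWithin_le_nhds e) self_mem_nhdsWithin)
    exact ⟨η, h2, h1⟩
  choose η hηpos hηL hηR hηn hηposL hηposR using hη
  -- small enough for `2 * N n * δ n < η n`, which makes the extreme slopes the lowest at the ends
  set δ : ℕ → ℝ := fun n => η n / (3 * N n) with hδ
  have hNpos : ∀ n, (0 : ℝ) < N n := fun n => by exact_mod_cast hN1 n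
  have hδpos : ∀ n, 0 < δ n := fun n => div_pos (hηpos n) (by linarith [hNpos n])
  have hδη : ∀ n, 2 * N n * δ n < η n := fun n => by
    have h1 := hNpos n
    have : 3 * N n * δ n = η n := by simp only [hδ]; field_simp
    nlinarith [hηpos n]
  have hδn : ∀ n, δ n ≤ 1 / (n + 1) := fun n => by
    refine le_trans ?_ (hηn n).le
    refine div_le_self (hηpos n).le ?_
    have : (1 : ℝ) ≤ N n := by exact_mod_cast hN1 n
    linarith
  set F : ℝ → ℝ := fun x => hi x + kinkSum w.line x with hF
  set H : ℝ → ℝ := fun x => -lo x with hH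
  have hintI : Set.OrdConnected (interior I) := h.convex_base.interior.ordConnected
  have hcoreI : ∀ n, Set.Icc (L n) (R n) ⊆ I := fun n =>
    (hintI.out (hLR n).2.1 (hLR n).2.2.1).trans interior_subset
  have hbd : ∀ (φ : ℝ → ℝ), (∀ x ∈ interior I, ∃ s : ℝ, ∀ y ∈ I, φ y ≤ φ x + s * (y - x)) →
      ∀ n, BddAbove (φ '' Set.Icc (L n) (R n)) := by
    intro φ hφ n
    obtain ⟨s, hs⟩ := hφ _ (hLR n).2.1
    refine bddAbove_of_support ⟨s, φ (L n) - s * L n, fun y hy => ?_⟩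
    linarith [hs y (hcoreI n hy)]
  have hFbd := hbd F h.support_top
  have hHbd := hbd H h.support_bot
  have hLRle : ∀ n, L n ≤ R n := fun n => (hLR n).1.le
  have hcoreM : ∀ n, ∀ y ∈ Set.Icc (L n) (R n), |y| ≤ M n := fun n y hy =>
    (abs_le_max_abs_abs hy.1 hy.2).trans (by simp only [hM]; linarith)
  set θ : ℕ → SupportData m := fun n =>
    { left := L n - η n
      right := R n + η n
      top := capIntercept F (L n) (R n) (δ n)
      bot := capIntercept H (L n) (R n) (δ n)
      line := w.line } with hθ
  have hval : ∀ (φ : ℝ → ℝ) n, BddAbove (φ '' Set.Icc (L n) (R n)) →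
      φ (L n) - N n * η n ≤ capIntercept φ (L n) (R n) (δ n) (N n) + N n * (L n - η n) ∧
      φ (R n) - N n * η n ≤ capIntercept φ (L n) (R n) (δ n) (-N n) - N n * (R n + η n) := by
    intro φ n hφ
    have h1 := le_capIntercept hφ (hδpos n) (Set.left_mem_Icc.2 (hLRle n)) (N n)
    have h2 := le_capIntercept hφ (hδpos n) (Set.right_mem_Icc.2 (hLRle n)) (-N n)
    constructor <;> linarith
  have hleft : ∀ (φ : ℝ → ℝ) n, BddAbove (φ '' Set.Icc (L n) (R n)) →
      ∀ s ∈ Set.Ico (-N n : ℝ) (N n), capIntercept φ (L n) (R n) (δ n) (N n) +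
        N n * (L n - η n) < capIntercept φ (L n) (R n) (δ n) s + s * (L n - η n) :=
    fun φ n hφ s hs => capIntercept_left_lt (hLRle n) hφ (hδη n) (hδpos n) hs
  have hright : ∀ (φ : ℝ → ℝ) n, BddAbove (φ '' Set.Icc (L n) (R n)) →
      ∀ s ∈ Set.Ioc (-N n : ℝ) (N n), capIntercept φ (L n) (R n) (δ n) (-N n) -
        N n * (R n + η n) < capIntercept φ (L n) (R n) (δ n) s + s * (R n + η n) :=
    fun φ n hφ s hs => capIntercept_right_lt (hLRle n) hφ (hδη n) (hδpos n) hs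
  have hleft' : ∀ (φ : ℝ → ℝ) n, BddAbove (φ '' Set.Icc (L n) (R n)) →
      ∀ s ∈ Set.Icc (-N n : ℝ) (N n), capIntercept φ (L n) (R n) (δ n) (N n) +
        N n * (L n - η n) ≤ capIntercept φ (L n) (R n) (δ n) s + s * (L n - η n) := by
    intro φ n hφ s hs
    rcases hs.2.eq_or_lt with rfl | h'
    · exact le_rfl
    · exact (hleft φ n hφ s ⟨hs.1, h'⟩).le
  have hright' : ∀ (φ : ℝ → ℝ) n, BddAbove (φ '' Set.Icc (L n) (R n)) →
      ∀ s ∈ Set.Icc (-N n : ℝ) (N n), capIntercept φ (L n) (R n) (δ n) (-N n) -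
        N n * (R n + η n) ≤ capIntercept φ (L n) (R n) (δ n) s + s * (R n + η n) := by
    intro φ n hφ s hs
    rcases hs.1.eq_or_lt with rfl | h'
    · linarith
    · exact (hright φ n hφ s ⟨h', hs.2⟩).le
  refine ⟨θ, N, L, R, M, ?_⟩
  refine
    { smooth := fun n => ?_
      line_eq := fun n => rfl
      N_mono := hNmono
      L_anti := hLanti
      R_mono := hRmono
      left_le := fun n => by simp only [hθ]; linarith [hηpos n]
      le_right := fun n => by simp only [hθ]; linarith [hηpos n]
      sub := fun n => hintI.out (hηL n) (hηR n)
      exhaust := hex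
      line_mem := fun n => (hLR n).2.2.2
      le_M := fun n y hy => ?_
      one_le_M := hM1
      M_le := hNM
      top_lower := fun n x hx s => le_capIntercept (hFbd n) (hδpos n) hx s
      bot_lower := fun n x hx s => le_capIntercept (hHbd n) (hδpos n) hx s
      top_upper := fun n s b hs r =>
        (capIntercept_le (hLRle n) (hcoreM n) (fun y hy => hs y (hcoreI n hy)) r).trans
          (by linarith [mul_le_mul_of_nonneg_right (hδn n) (sq_nonneg r)])
      bot_upper := fun n s b hs r =>
        (capIntercept_le (hLRle n) (hcoreM n) (fun y hy => hs y (hcoreI n hy)) r).trans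
          (by linarith [mul_le_mul_of_nonneg_right (hδn n) (sq_nonneg r)]) }
  · refine
      { one_le := hN1 n
        top_convex := (strictConvexOn_capIntercept (hLRle n) (hFbd n) (hδpos n)).convexOn
        bot_convex := (strictConvexOn_capIntercept (hLRle n) (hHbd n) (hδpos n)).convexOn
        top_left := hleft' F n (hFbd n)
        top_right := hright' F n (hFbd n)
        bot_left := hleft' H n (hHbd n)
        bot_right := hright' H n (hHbd n)
        strictMono := h.strictMono
        line_mem := fun j => ?_
        left_lt_right := ?_
        pos_left := ?_
        pos_right := ?_
        top_strictConvex := strictConvexOn_capIntercept (hLRle n) (hFbd n) (hδpos n)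
        bot_strictConvex := strictConvexOn_capIntercept (hLRle n) (hHbd n) (hδpos n)
        top_left_lt := hleft F n (hFbd n)
        top_right_lt := hright F n (hFbd n)
        bot_left_lt := hleft H n (hHbd n)
        bot_right_lt := hright H n (hHbd n) }
    · have := (hLR n).2.2.2 j
      exact ⟨by simp only [hθ]; linarith [this.1, hηpos n],
        by simp only [hθ]; linarith [this.2, hηpos n]⟩
    · simp only [hθ]; linarith [hLRle n, hηpos n]
    · simp only [hθ]
      have h1 := (hval F n (hFbd n)).1
      have h2 := (hval H n (hHbd n)).1
      have h3 := kinkSum_nonneg w.line (L n)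
      have h4 := hηposL n
      simp only [hF] at h1 ⊢
      simp only [hH] at h2 ⊢
      linarith
    · simp only [hθ]
      have h1 := (hval F n (hFbd n)).2
      have h2 := (hval H n (hHbd n)).2
      have h3 := kinkSum_add_le w.line (R n) (hηpos n).le
      have h4 := hηposR n
      simp only [hF] at h1 ⊢
      simp only [hH] at h2 ⊢
      linarith
  · have h1 : η n < 1 := (hηn n).trans_le (by
      rw [div_le_one (by positivity)]; linarith [(Nat.cast_nonneg n : (0 : ℝ) ≤ n)])
    have h2 := neg_abs_le (L n)
    have h3 := le_abs_self (R n)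
    have h4 := le_max_left |L n| |R n|
    have h5 := le_max_right |L n| |R n|
    simp only [hθ] at hy
    rw [abs_le]
    simp only [hM]
    exact ⟨by linarith [hy.1], by linarith [hy.2]⟩

/-! ### Continuity along segments and convergence of the approximation -/

/-- If the line of slope `s` and intercept `b` dominates the function that is approximated, then up to
an error `O(1 / n)` it dominates the envelopes along the segment from step `n` to step `n + 1` of an
approximation. The line need not have rational slope; it is compared with nearby lines whose slopes
are in the finite sets of the two steps. -/
theorem envelope_segment_le {N N' n : ℕ} {c c' : ℝ → ℝ} {A B M M' s b t : ℝ} (hAB : A ≤ B)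
    (hNN : N ≤ N') (hM : ∀ y ∈ Set.Icc A B, |y| ≤ M) (hM1 : 1 ≤ M) (hM1' : 1 ≤ M')
    (hMN : (n + 1) * M ≤ N) (hMN' : (n + 1) * M' ≤ N') (hs : |s| + 1 ≤ N)
    (hc : ∀ r, c r ≤ b + M * |r - s| + 1 / (n + 1) * r ^ 2)
    (hc' : ∀ r, c' r ≤ b + M' * |r - s| + 1 / (n + 1) * r ^ 2) (ht : t ∈ Set.Icc (0 : ℝ) 1) (x : ℝ) :
    envelope N' (fun r => (1 - t) * legendre (envelope N c) A B r + t * c' r) x ≤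
      s * x + b + (|x| + 3 + (|s| + 1) ^ 2) * (1 / (n + 1)) := by
  have hn : (0 : ℝ) < n + 1 := by positivity
  have hNN' : (N : ℝ) ≤ N' := by exact_mod_cast hNN
  have hNge : (n + 1 : ℝ) ≤ N := le_trans (by nlinarith) hMN
  have hN0 : (0 : ℝ) < N := by linarith
  have hN1 : 1 ≤ N := by exact_mod_cast hN0
  set e : ℝ := 1 / (n + 1) with he
  have he0 : 0 < e := by positivity
  have hne : (n + 1) * e = 1 := by rw [he]; field_simp
  have hinv : ∀ K P : ℝ, 0 ≤ K → 0 < P → (n + 1) * K ≤ P → K * (1 / P) ≤ e := by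
    intro K P hK hP h
    rw [mul_one_div, div_le_iff₀ hP]
    calc K = e * ((n + 1) * K) := by linear_combination -K * hne
      _ ≤ e * P := mul_le_mul_of_nonneg_left h he0.le
  obtain ⟨ρ, hρ, hρs⟩ := exists_slope_near N hN1 s hs
  obtain ⟨σ, hσ, hσs⟩ := exists_slope_near N' (hN1.trans hNN) s (hs.trans hNN')
  have hN'0 : (0 : ℝ) < N' := by linarith
  have hσs' : |(σ : ℝ) - s| ≤ 1 / N := hσs.trans (one_div_le_one_div_of_le hN0 hNN')
  have hsq : ∀ r : ℝ, |r - s| ≤ 1 / N → r ^ 2 ≤ (|s| + 1) ^ 2 := by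
    intro r hr
    have h1 : (1 : ℝ) / N ≤ 1 := by rw [div_le_one hN0]; linarith [abs_nonneg s]
    have h2 := abs_sub_abs_le_abs_sub r s
    rw [← sq_abs r]
    exact pow_le_pow_left₀ (abs_nonneg r) (by linarith) 2
  have hc1 : c ρ ≤ b + e + e * (|s| + 1) ^ 2 := by
    have h1 := mul_le_mul_of_nonneg_left hρs (by linarith : 0 ≤ M)
    have h2 := hinv M N (by linarith) hN0 hMN
    have h3 := mul_le_mul_of_nonneg_left (hsq ρ hρs) he0.le
    linarith [hc ρ]
  have hc1' : c' σ ≤ b + e + e * (|s| + 1) ^ 2 := by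
    have h1 := mul_le_mul_of_nonneg_left hσs (by linarith : 0 ≤ M')
    have h2 := hinv M' N' (by linarith) hN'0 hMN'
    have h3 := mul_le_mul_of_nonneg_left (hsq σ hσs') he0.le
    linarith [hc' σ]
  have hleg : legendre (envelope N c) A B σ ≤ b + 3 * e + e * (|s| + 1) ^ 2 := by
    refine legendre_le hAB fun y hy => ?_
    have h1 := envelope_le hρ c y
    have h2 : (ρ - σ : ℝ) * y ≤ |(ρ - σ : ℝ)| * |y| := by rw [← abs_mul]; exact le_abs_self _
    have h3 : |(ρ - σ : ℝ)| ≤ 2 * (1 / N) := by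
      have : (ρ - σ : ℝ) = (ρ - s) - (σ - s) := by ring
      rw [this]
      linarith [abs_sub (ρ - s : ℝ) (σ - s)]
    have h4 := mul_le_mul h3 (hM y hy) (abs_nonneg y) (by positivity)
    have h5 := hinv M N (by linarith) hN0 hMN
    linarith
  have hx : (σ : ℝ) * x ≤ s * x + |x| * e := by
    have h1 : (σ - s : ℝ) * x ≤ |(σ - s : ℝ)| * |x| := by rw [← abs_mul]; exact le_abs_self _
    have h2 : (1 : ℝ) / N ≤ e := one_div_le_one_div_of_le hn hNge
    have h3 := mul_le_mul_of_nonneg_right (hσs'.trans h2) (abs_nonneg x)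
    linarith
  have hcomb := lerp_le_lerp ht hleg (hc1'.trans (by linarith :
    b + e + e * (|s| + 1) ^ 2 ≤ b + 3 * e + e * (|s| + 1) ^ 2))
  have henv := envelope_le hσ (fun r => (1 - t) * legendre (envelope N c) A B r + t * c' r) x
  linarith

namespace SupportData

variable {m : ℕ} {θ θ' : SupportData m} {N N' : ℕ}

theorem isClosed_poly (hN : 1 ≤ N) (θ : SupportData m) (k : Fin m → ℤ) :
    IsClosed (θ.poly N k).region := by
  have h1 := continuous_envelope hN θ.top
  have h2 := continuous_envelope hN θ.bot
  have h3 := continuous_kinkSum θ.line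
  have h4 : Continuous (θ.hi N) := h1.sub h3
  refine IsClosed.and (isClosed_Icc.preimage continuous_fst) (IsClosed.and ?_ ?_)
  · exact isClosed_le (by fun_prop) (by fun_prop)
  · exact isClosed_le (by fun_prop) (by fun_prop)

theorem hi_le (hN : 1 ≤ N) (θ : SupportData m) (x : ℝ) : θ.hi N x ≤ θ.top 0 := by
  have := envelope_le (zero_mem_slopes hN) θ.top x
  simp only [Rat.cast_zero, zero_mul, zero_add] at this
  unfold hi
  linarith [kinkSum_nonneg θ.line x]

theorem envelope_le_zero (hN : 1 ≤ N) (c : ℝ → ℝ) (x : ℝ) : envelope N c x ≤ c 0 := by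
  have := envelope_le (zero_mem_slopes hN) c x
  simpa using this

/-- The polygons along a segment of support data vary continuously. -/
theorem tendsto_regionDist_lerp {ν : Measure (ℝ × ℝ)} (hν : Semitoric.IsAdmissible ν) (hN : 1 ≤ N)
    (θ θ' : SupportData m) (k : Fin m → ℤ) {t₀ : ℝ} (ht₀ : t₀ ∈ Set.Icc (0 : ℝ) 1)
    (hconv : Convex ℝ ((θ.lerp θ' t₀).poly N k).region) :
    Tendsto (fun t => regionDist ν ((θ.lerp θ' t₀).poly N k) ((θ.lerp θ' t).poly N k))
      (𝓝[Set.Icc 0 1] t₀) (𝓝 0) := by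
  have hlerp : ∀ a b : ℝ, Tendsto (fun t : ℝ => (1 - t) * a + t * b) (𝓝[Set.Icc 0 1] t₀)
      (𝓝 ((1 - t₀) * a + t₀ * b)) := fun a b => by
    have hc : Continuous fun t : ℝ => (1 - t) * a + t * b := by fun_prop
    exact (hc.tendsto t₀).mono_left nhdsWithin_le_nhds
  set C : ℝ := |θ.top 0| + |θ'.top 0| + (|θ.bot 0| + |θ'.bot 0|) with hC
  have habs : ∀ t ∈ Set.Icc (0 : ℝ) 1, ∀ a b : ℝ, (1 - t) * a + t * b ≤ |a| + |b| := by
    intro t ht a b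
    have h1 := mul_le_mul_of_nonneg_left (le_abs_self a) (by linarith [ht.2] : 0 ≤ 1 - t)
    have h2 := mul_le_mul_of_nonneg_left (le_abs_self b) ht.1
    nlinarith [ht.1, ht.2, abs_nonneg a, abs_nonneg b]
  have hbound : ∀ t ∈ Set.Icc (0 : ℝ) 1, ∀ x, -(C * (1 + |x|)) ≤ -envelope N (θ.lerp θ' t).bot x ∧
      (θ.lerp θ' t).hi N x ≤ C * (1 + |x|) := by
    intro t ht x
    have h1 := (hi_le hN (θ.lerp θ' t) x).trans (habs t ht (θ.top 0) (θ'.top 0))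
    have h2 := (envelope_le_zero hN (θ.lerp θ' t).bot x).trans (habs t ht (θ.bot 0) (θ'.bot 0))
    have hC0 : 0 ≤ C := by positivity
    have h3 := mul_nonneg hC0 (abs_nonneg x)
    have h4 := abs_nonneg (θ.top 0)
    have h5 := abs_nonneg (θ'.top 0)
    have h6 := abs_nonneg (θ.bot 0)
    have h7 := abs_nonneg (θ'.bot 0)
    constructor <;> linarith
  refine tendsto_regionDist hν (X := {(θ.lerp θ' t₀).left, (θ.lerp θ' t₀).right}) (C := C)
    (D := fun t => Set.Icc (θ.lerp θ' t).left (θ.lerp θ' t).right)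
    (lo := fun t x => -envelope N (θ.lerp θ' t).bot x) (hi := fun t => (θ.lerp θ' t).hi N)
    (fun t => rfl) rfl (fun t => isClosed_poly hN _ k) (isClosed_poly hN _ k) hconv
    (Set.Finite.measure_zero (Set.toFinite _) _) (fun x hx => ?_) (fun x _ _ => ?_)
    (fun x _ _ => ?_) (fun j => hlerp _ _) ?_ (fun x _ => hbound t₀ ht₀ x)
  · simp only [Set.mem_insert_iff, Set.mem_singleton_iff, not_or] at hx
    have hl := hlerp θ.left θ'.left
    have hr := hlerp θ.right θ'.right
    rcases lt_or_gt_of_ne hx.1 with h | h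
    · filter_upwards [hl.eventually (lt_mem_nhds h)] with t ht
      exact iff_of_false (fun h' => absurd h'.1 (not_le.2 ht)) (fun h' => absurd h'.1 (not_le.2 h))
    · rcases lt_or_gt_of_ne hx.2 with h2 | h2
      · filter_upwards [hl.eventually (gt_mem_nhds h), hr.eventually (lt_mem_nhds h2)] with t h3 h4
        exact iff_of_true ⟨h3.le, h4.le⟩ ⟨h.le, h2.le⟩
      · filter_upwards [hr.eventually (gt_mem_nhds h2)] with t ht
        exact iff_of_false (fun h' => absurd h'.2 (not_le.2 ht))
          (fun h' => absurd h'.2 (not_le.2 h2))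
  · exact (tendsto_envelope hN (fun s _ => hlerp _ _) tendsto_const_nhds).neg
  · exact (tendsto_envelope hN (fun s _ => hlerp _ _) tendsto_const_nhds).sub
      (tendsto_kinkSum (fun j => hlerp _ _) tendsto_const_nhds)
  · filter_upwards [self_mem_nhdsWithin] with t ht x _ using hbound t ht x

end SupportData

namespace IsApproximation

variable {m : ℕ} {w : WeightedRegion m} {I : Set ℝ} {lo hi : ℝ → ℝ} {θ : ℕ → SupportData m}
  {N : ℕ → ℕ} {L R M : ℕ → ℝ}

theorem M_le_succ (h : IsApproximation w I lo hi θ N L R M) (n : ℕ) :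
    ((n : ℝ) + 1) * M (n + 1) ≤ N (n + 1) := by
  have h1 := h.M_le (n + 1)
  have h2 := h.one_le_M (n + 1)
  push_cast at h1
  nlinarith

theorem segment_top_le (h : IsApproximation w I lo hi θ N L R M) {s b : ℝ}
    (hs : ∀ y ∈ I, hi y + kinkSum w.line y ≤ s * y + b) {n : ℕ} (hn : |s| + 1 ≤ N n) {t : ℝ}
    (ht : t ∈ Set.Icc (0 : ℝ) 1) (x : ℝ) :
    envelope (N (n + 1)) (SupportData.segment (θ n) (θ (n + 1)) (N n) t).top x ≤
      s * x + b + (|x| + 3 + (|s| + 1) ^ 2) * (1 / (n + 1)) :=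
  envelope_segment_le (h.smooth n).left_lt_right.le (h.N_mono n.le_succ) (h.le_M n) (h.one_le_M n)
    (h.one_le_M (n + 1)) (h.M_le n) (h.M_le_succ n) hn (h.top_upper n s b hs)
    (fun r => (h.top_upper (n + 1) s b hs r).trans (by
      refine add_le_add_right (mul_le_mul_of_nonneg_right ?_ (sq_nonneg r)) _
      refine one_div_le_one_div_of_le (by positivity) ?_
      push_cast; linarith)) ht x

theorem segment_bot_le (h : IsApproximation w I lo hi θ N L R M) {s b : ℝ}
    (hs : ∀ y ∈ I, -lo y ≤ s * y + b) {n : ℕ} (hn : |s| + 1 ≤ N n) {t : ℝ}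
    (ht : t ∈ Set.Icc (0 : ℝ) 1) (x : ℝ) :
    envelope (N (n + 1)) (SupportData.segment (θ n) (θ (n + 1)) (N n) t).bot x ≤
      s * x + b + (|x| + 3 + (|s| + 1) ^ 2) * (1 / (n + 1)) :=
  envelope_segment_le (h.smooth n).left_lt_right.le (h.N_mono n.le_succ) (h.le_M n) (h.one_le_M n)
    (h.one_le_M (n + 1)) (h.M_le n) (h.M_le_succ n) hn (h.bot_upper n s b hs)
    (fun r => (h.bot_upper (n + 1) s b hs r).trans (by
      refine add_le_add_right (mul_le_mul_of_nonneg_right ?_ (sq_nonneg r)) _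
      refine one_div_le_one_div_of_le (by positivity) ?_
      push_cast; linarith)) ht x

theorem core_sub (h : IsApproximation w I lo hi θ N L R M) (n : ℕ) :
    Set.Icc (L n) (R n) ⊆ Set.Icc (θ n).left (θ n).right :=
  Set.Icc_subset_Icc (h.left_le n) (h.le_right n)

/-- Over the core, the envelopes along the segments stay above the functions they approximate. -/
theorem le_segment (h : IsApproximation w I lo hi θ N L R M) {n : ℕ} {x : ℝ}
    (hx : x ∈ Set.Icc (L n) (R n)) {t : ℝ} (ht : t ∈ Set.Icc (0 : ℝ) 1) :
    hi x + kinkSum w.line x ≤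
        envelope (N (n + 1)) (SupportData.segment (θ n) (θ (n + 1)) (N n) t).top x ∧
      -lo x ≤ envelope (N (n + 1)) (SupportData.segment (θ n) (θ (n + 1)) (N n) t).bot x := by
  have hx' := h.core_sub n hx
  have hx1 : x ∈ Set.Icc (L (n + 1)) (R (n + 1)) :=
    ⟨(h.L_anti n.le_succ).trans hx.1, hx.2.trans (h.R_mono n.le_succ)⟩
  have key : ∀ (a : ℝ) (c c' : ℝ → ℝ), (∀ s, a ≤ s * x + c s) → (∀ s, a ≤ s * x + c' s) →
      a ≤ envelope (N (n + 1)) (fun s => (1 - t) *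
        legendre (envelope (N n) c) (θ n).left (θ n).right s + t * c' s) x := by
    intro a c c' hc hc'
    refine le_envelope (h.smooth (n + 1)).one_le fun s _ => ?_
    have h1 : a ≤ s * x + legendre (envelope (N n) c) (θ n).left (θ n).right s :=
      (le_envelope (h.smooth n).one_le fun r _ => hc r).trans
        (le_legendre (bddAbove_envelope (h.smooth n).one_le _ _ _) hx' _)
    have := lerp_le_lerp ht h1 (hc' s)
    linarith
  exact ⟨key _ _ _ (h.top_lower n x hx) (h.top_lower (n + 1) x hx1),
    key _ _ _ (h.bot_lower n x hx) (h.bot_lower (n + 1) x hx1)⟩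

theorem segment_line (h : IsApproximation w I lo hi θ N L R M) (n : ℕ) (t : ℝ) :
    (SupportData.segment (θ n) (θ (n + 1)) (N n) t).line = w.line := by
  funext j
  simp only [SupportData.segment, SupportData.lerp, SupportData.closure, h.line_eq]
  ring

theorem segment_base_sub (h : IsApproximation w I lo hi θ N L R M) (hp : HasProfile w I lo hi)
    (n : ℕ) {t : ℝ} (ht : t ∈ Set.Icc (0 : ℝ) 1) :
    Set.Icc (SupportData.segment (θ n) (θ (n + 1)) (N n) t).left
      (SupportData.segment (θ n) (θ (n + 1)) (N n) t).right ⊆ interior I := by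
  have hc := hp.convex_base.interior
  have h1 := (h.smooth n).left_lt_right.le
  have h2 := (h.smooth (n + 1)).left_lt_right.le
  have ht' : 0 ≤ 1 - t := by linarith [ht.2]
  refine hc.ordConnected.out ?_ ?_
  · exact hc (h.sub n (Set.left_mem_Icc.2 h1)) (h.sub (n + 1) (Set.left_mem_Icc.2 h2)) ht' ht.1
      (by ring)
  · exact hc (h.sub n (Set.right_mem_Icc.2 h1)) (h.sub (n + 1) (Set.right_mem_Icc.2 h2)) ht' ht.1
      (by ring)

theorem core_sub_segment (h : IsApproximation w I lo hi θ N L R M) (n : ℕ) {t : ℝ}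
    (ht : t ∈ Set.Icc (0 : ℝ) 1) :
    Set.Icc (L n) (R n) ⊆ Set.Icc (SupportData.segment (θ n) (θ (n + 1)) (N n) t).left
      (SupportData.segment (θ n) (θ (n + 1)) (N n) t).right := by
  refine Set.Icc_subset_Icc ?_ ?_
  · have := lerp_le_lerp ht (h.left_le n) ((h.left_le (n + 1)).trans (h.L_anti n.le_succ))
    calc _ ≤ (1 - t) * L n + t * L n := this
      _ = L n := by ring
  · have := lerp_le_lerp ht (h.le_right n) ((h.R_mono n.le_succ).trans (h.le_right (n + 1)))
    calc R n = (1 - t) * R n + t * R n := by ring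
      _ ≤ _ := this

/-- The polygons along the segments of an approximation converge to the approximated polygon. -/
theorem tendsto_regionDist (h : IsApproximation w I lo hi θ N L R M) (hp : HasProfile w I lo hi)
    {ν : Measure (ℝ × ℝ)} (hν : IsAdmissible ν) (k : Fin m → ℤ) :
    Tendsto (fun p : ℕ × ℝ => regionDist ν w
        ((SupportData.segment (θ p.1) (θ (p.1 + 1)) (N p.1) p.2).poly (N (p.1 + 1)) k))
      (atTop ×ˢ 𝓟 (Set.Icc 0 1)) (𝓝 0) := by
  set F : Filter (ℕ × ℝ) := atTop ×ˢ 𝓟 (Set.Icc 0 1)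
  have hfst : Tendsto Prod.fst F atTop := tendsto_fst
  have hsnd : ∀ᶠ p : ℕ × ℝ in F, p.2 ∈ Set.Icc (0 : ℝ) 1 :=
    tendsto_snd.eventually (mem_principal_self (Set.Icc (0 : ℝ) 1))
  have hN : ∀ C : ℝ, ∀ᶠ p in F, C ≤ N p.1 := by
    intro C
    refine hfst.eventually (p := fun n => C ≤ N n) ?_
    obtain ⟨n₀, hn₀⟩ := exists_nat_ge C
    filter_upwards [eventually_ge_atTop n₀] with n hn
    have h1 := h.M_le n
    have h2 := h.one_le_M n
    have h3 : (n₀ : ℝ) ≤ n := by exact_mod_cast hn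
    have h4 : (0 : ℝ) ≤ n := Nat.cast_nonneg n
    nlinarith
  have herr : ∀ K a : ℝ, Tendsto (fun p : ℕ × ℝ => a + K * (1 / ((p.1 : ℝ) + 1))) F (𝓝 a) := by
    intro K a
    have h1 : Tendsto (fun n : ℕ => a + K * (1 / ((n : ℝ) + 1))) atTop (𝓝 (a + K * 0)) :=
      (tendsto_one_div_add_atTop_nhds_zero_nat.const_mul K).const_add a
    rw [mul_zero, add_zero] at h1
    exact h1.comp hfst
  obtain ⟨x₀, hx₀⟩ := hp.interior_nonempty
  obtain ⟨s₁, hs₁⟩ := hp.support_top x₀ hx₀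
  obtain ⟨s₂, hs₂⟩ := hp.support_bot x₀ hx₀
  set b₁ := hi x₀ + kinkSum w.line x₀ - s₁ * x₀ with hb₁
  set b₂ := -lo x₀ - s₂ * x₀ with hb₂
  have hs₁' : ∀ y ∈ I, hi y + kinkSum w.line y ≤ s₁ * y + b₁ := fun y hy => by linarith [hs₁ y hy]
  have hs₂' : ∀ y ∈ I, -lo y ≤ s₂ * y + b₂ := fun y hy => by linarith [hs₂ y hy]
  set C : ℝ := (|s₁| + |b₁| + 4 + (|s₁| + 1) ^ 2) + (|s₂| + |b₂| + 4 + (|s₂| + 1) ^ 2) with hC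
  have hCle : ∀ s b x e : ℝ, e ≤ 1 → 0 ≤ e → s * x + b + (|x| + 3 + (|s| + 1) ^ 2) * e ≤
      (|s| + |b| + 4 + (|s| + 1) ^ 2) * (1 + |x|) := by
    intro s b x e he he0
    have h1 : s * x ≤ |s| * |x| := by rw [← abs_mul]; exact le_abs_self _
    have h2 := le_abs_self b
    have h3 := mul_le_mul_of_nonneg_left he
      (by positivity : 0 ≤ |x| + 3 + (|s| + 1) ^ 2)
    have h4 := abs_nonneg x
    have h5 := abs_nonneg s
    have h6 := abs_nonneg b
    have h7 := mul_nonneg h6 h4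
    have h8 := mul_nonneg (sq_nonneg (|s| + 1)) h4
    nlinarith
  have hCpos : ∀ s b x : ℝ, 0 ≤ (|s| + |b| + 4 + (|s| + 1) ^ 2) * (1 + |x|) := fun s b x => by
    positivity
  have hcase : ∀ x ∉ frontier I, x ∈ I → x ∈ interior I := fun x hx hxI => by
    by_contra hcon
    exact hx ⟨subset_closure hxI, hcon⟩
  have hcore : ∀ x ∈ interior I, ∀ᶠ p in F, x ∈ Set.Icc (L p.1) (R p.1) := fun x hx =>
    hfst.eventually (h.exhaust x hx)
  refine Semitoric.tendsto_regionDist hν (X := frontier I) (C := C)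
    (D := fun p => Set.Icc (SupportData.segment (θ p.1) (θ (p.1 + 1)) (N p.1) p.2).left
      (SupportData.segment (θ p.1) (θ (p.1 + 1)) (N p.1) p.2).right)
    (lo := fun p x => -envelope (N (p.1 + 1))
      (SupportData.segment (θ p.1) (θ (p.1 + 1)) (N p.1) p.2).bot x)
    (hi := fun p => (SupportData.segment (θ p.1) (θ (p.1 + 1)) (N p.1) p.2).hi (N (p.1 + 1)))
    (fun p => rfl) hp.region_eq
    (fun p => SupportData.isClosed_poly (h.smooth (p.1 + 1)).one_le _ k) hp.closed hp.convex
    (hp.convex_base.addHaar_frontier volume) (fun x hx => ?_) (fun x hx hxI => ?_)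
    (fun x hx hxI => ?_) (fun j => ?_) ?_ (fun x hx => ?_)
  · by_cases hxI : x ∈ I
    · filter_upwards [hcore x (hcase x hx hxI), hsnd] with p h1 h2
      exact iff_of_true (h.core_sub_segment p.1 h2 h1) hxI
    · filter_upwards [hsnd] with p h2
      exact iff_of_false (fun h' => hxI (interior_subset (h.segment_base_sub hp p.1 h2 h'))) hxI
  · have hxint := hcase x hx hxI
    obtain ⟨s, hs⟩ := hp.support_bot x hxint
    refine tendsto_of_tendsto_of_tendsto_of_le_of_le' (h := fun _ => lo x)
      (g := fun p => -(-lo x + (|x| + 3 + (|s| + 1) ^ 2) * (1 / ((p.1 : ℝ) + 1))))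
      (by simpa using (herr (|x| + 3 + (|s| + 1) ^ 2) (-lo x)).neg) tendsto_const_nhds ?_ ?_
    · filter_upwards [hN (|s| + 1), hsnd] with p h1 h2
      have := h.segment_bot_le (b := -lo x - s * x) (fun y hy => by linarith [hs y hy]) h1 h2 x
      linarith
    · filter_upwards [hcore x hxint, hsnd] with p h1 h2
      linarith [(h.le_segment h1 h2).2]
  · have hxint := hcase x hx hxI
    obtain ⟨s, hs⟩ := hp.support_top x hxint
    refine tendsto_of_tendsto_of_tendsto_of_le_of_le' (g := fun _ => hi x)
      (h := fun p => hi x + (|x| + 3 + (|s| + 1) ^ 2) * (1 / ((p.1 : ℝ) + 1)))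
      tendsto_const_nhds (herr _ _) ?_ ?_
    · filter_upwards [hcore x hxint, hsnd] with p h1 h2
      unfold SupportData.hi
      rw [h.segment_line]
      linarith [(h.le_segment h1 h2).1]
    · filter_upwards [hN (|s| + 1), hsnd] with p h1 h2
      unfold SupportData.hi
      rw [h.segment_line]
      have := h.segment_top_le (b := hi x + kinkSum w.line x - s * x)
        (fun y hy => by linarith [hs y hy]) h1 h2 x
      linarith
  · refine tendsto_const_nhds.congr fun p => ?_
    exact (congrFun (h.segment_line p.1 p.2) j).symm
  · filter_upwards [hN (|s₁| + 1), hN (|s₂| + 1), hsnd] with p h1 h2 h3 x _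
    have he : 1 / ((p.1 : ℝ) + 1) ≤ 1 := by
      rw [div_le_one (by positivity)]; linarith [(Nat.cast_nonneg p.1 : (0 : ℝ) ≤ p.1)]
    have he0 : 0 ≤ 1 / ((p.1 : ℝ) + 1) := by positivity
    have a1 := h.segment_top_le hs₁' h1 h3 x
    have a2 := h.segment_bot_le hs₂' h2 h3 x
    have b1 := hCle s₁ b₁ x _ he he0
    have b2 := hCle s₂ b₂ x _ he he0
    have c1 := hCpos s₁ b₁ x
    have c2 := hCpos s₂ b₂ x
    have d := kinkSum_nonneg (SupportData.segment (θ p.1) (θ (p.1 + 1)) (N p.1) p.2).line x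
    unfold SupportData.hi
    constructor <;> rw [hC, add_mul] <;> linarith
  · have b1 := hCle s₁ b₁ x 0 zero_le_one le_rfl
    have b2 := hCle s₂ b₂ x 0 zero_le_one le_rfl
    have c1 := hCpos s₁ b₁ x
    have c2 := hCpos s₂ b₂ x
    have d := kinkSum_nonneg w.line x
    have e1 := hs₁' x hx
    have e2 := hs₂' x hx
    constructor <;> rw [hC, add_mul] <;> linarith

end IsApproximation

/-! ### Paths in the topology of a distance function -/

theorem continuous_topologyOfDist {X Y : Type*} [TopologicalSpace Y] {d : X → X → ℝ≥0∞}
    {f : Y → X} (h : ∀ y, Tendsto (fun z => d (f y) (f z)) (𝓝 y) (𝓝 0)) :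
    @Continuous Y X _ (topologyOfDist d) f := by
  let := topologyOfDist d
  refine ⟨fun U hU => isOpen_iff_mem_nhds.2 fun y hy => ?_⟩
  obtain ⟨r, hr, hball⟩ := hU (f y) hy
  filter_upwards [(h y).eventually (gt_mem_nhds hr)] with z hz using hball _ hz

theorem tendsto_nhds_topologyOfDist {X ι : Type*} {F : Filter ι} {d : X → X → ℝ≥0∞} {f : ι → X}
    {x : X} (h : Tendsto (fun i => d x (f i)) F (𝓝 0)) :
    Tendsto f F (@nhds X (topologyOfDist d) x) := by
  let := topologyOfDist d
  refine tendsto_nhds.2 fun U hU hx => ?_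
  obtain ⟨r, hr, hball⟩ := hU x hx
  filter_upwards [h.eventually (gt_mem_nhds hr)] with i hi using hball _ hi

/-- The concatenation of a sequence of paths, defined on the whole real line, with the path `γ n` over
`[n, n + 1]`, is continuous. -/
theorem continuous_concat {X : Type*} [TopologicalSpace X] {x : ℕ → X}
    (γ : ∀ n, Path (x n) (x (n + 1))) :
    Continuous fun s : ℝ => (γ ⌊s⌋₊).extend (s - ⌊s⌋₊) := by
  set G : ℝ → X := fun s => (γ ⌊s⌋₊).extend (s - ⌊s⌋₊) with hG
  have hcont : ∀ n : ℕ, ContinuousOn G (Set.Iic (n : ℝ)) := by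
    intro n
    induction n with
    | zero =>
      refine (continuousOn_const (c := x 0)).congr fun s hs => ?_
      have hs' : s ≤ 0 := by simpa using hs
      simp only [hG]
      rw [Nat.floor_of_nonpos hs']
      exact Path.extend_of_le_zero _ (by simpa using hs')
    | succ n ih =>
      have hu : Set.Iic ((n + 1 : ℕ) : ℝ) = Set.Iic (n : ℝ) ∪ Set.Icc (n : ℝ) (n + 1) := by
        rw [Set.Iic_union_Icc_eq_Iic (by linarith)]; push_cast; rfl
      rw [hu]
      refine ih.union_of_isClosed ?_ isClosed_Iic isClosed_Icc
      have hc : Continuous fun s : ℝ => (γ n).extend (s - n) :=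
        (γ n).continuous_extend.comp (continuous_id.sub continuous_const)
      refine hc.continuousOn.congr fun s hs => ?_
      rcases hs.2.eq_or_lt with rfl | hlt
      · have : ⌊(n : ℝ) + 1⌋₊ = n + 1 := by exact_mod_cast Nat.floor_natCast (R := ℝ) (n + 1)
        simp only [hG]
        rw [this]
        simp
      · have : ⌊s⌋₊ = n := (Nat.floor_eq_iff ((Nat.cast_nonneg n).trans hs.1)).2 ⟨hs.1, hlt⟩
        simp only [hG]
        rw [this]
  refine continuous_iff_continuousAt.2 fun s => ?_
  obtain ⟨n, hn⟩ := exists_nat_gt s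
  exact (hcont n).continuousAt (Iic_mem_nhds hn)

/-- Infinitely many consecutive paths that converge to a point join this point to their start. -/
theorem joined_of_tendsto_paths {X : Type*} [TopologicalSpace X] {x : ℕ → X} {a : X}
    (γ : ∀ n, Path (x n) (x (n + 1)))
    (h : Tendsto (fun p : ℕ × unitInterval => γ p.1 p.2) (atTop ×ˢ ⊤) (𝓝 a)) : Joined a (x 0) := by
  set G : ℝ → X := fun s => (γ ⌊s⌋₊).extend (s - ⌊s⌋₊) with hG
  have hGc : Continuous G := continuous_concat γ
  have hGlim : Tendsto G atTop (𝓝 a) := by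
    have h1 : Tendsto (fun s : ℝ => (⌊s⌋₊, Set.projIcc (0 : ℝ) 1 zero_le_one (s - ⌊s⌋₊))) atTop
        (atTop ×ˢ (⊤ : Filter unitInterval)) := tendsto_nat_floor_atTop.prodMk tendsto_top
    exact h.comp h1
  -- the concatenation is run backwards, with `s = 1 / t - 1`
  set Γ : unitInterval → X := fun t => if t = 0 then a else G ((t : ℝ)⁻¹ - 1) with hΓ
  have hΓc : Continuous Γ := by
    refine continuous_iff_continuousAt.2 fun t => ?_
    by_cases ht : t = 0
    · subst ht
      rw [continuousAt_iff_punctured_nhds]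
      have h0 : Γ 0 = a := if_pos rfl
      rw [h0]
      have hcoe : Tendsto (fun t : unitInterval => (t : ℝ)) (𝓝[≠] 0) (𝓝[>] 0) := by
        refine tendsto_nhdsWithin_iff.2 ⟨?_, ?_⟩
        · exact (continuous_subtype_val.tendsto (0 : unitInterval)).mono_left nhdsWithin_le_nhds
        · filter_upwards [self_mem_nhdsWithin] with t ht
          exact lt_of_le_of_ne t.2.1 fun h' => ht (Subtype.ext h'.symm)
      have h1 : Tendsto (fun t : unitInterval => (t : ℝ)⁻¹ - 1) (𝓝[≠] 0) atTop :=
        tendsto_atTop_add_const_right _ _ (tendsto_inv_nhdsGT_zero.comp hcoe)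
      refine (hGlim.comp h1).congr' ?_
      filter_upwards [self_mem_nhdsWithin] with t ht
      exact (if_neg ht).symm
    · have hne : (t : ℝ) ≠ 0 := fun h' => ht (Subtype.ext h')
      have h1 : ContinuousAt (fun t : unitInterval => G ((t : ℝ)⁻¹ - 1)) t :=
        hGc.continuousAt.comp ((continuous_subtype_val.continuousAt.inv₀ hne).sub continuousAt_const)
      refine h1.congr ?_
      filter_upwards [isOpen_ne.mem_nhds ht] with t' ht'
      exact (if_neg ht').symm
  refine ⟨⟨⟨Γ, hΓc⟩, if_pos rfl, ?_⟩⟩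
  change Γ 1 = x 0
  have : Γ 1 = G (((1 : unitInterval) : ℝ)⁻¹ - 1) := if_neg one_ne_zero
  rw [this]
  simp [hG]

/-! ### Continuity of the distance on Taylor series -/

theorem IsLinearlySummable.tsum_add_ne_top {b : ℕ → ℝ} (hb : IsLinearlySummable b) :
    ∑' p : ℕ × ℕ, ENNReal.ofReal (b (p.1 + p.2)) ≠ ∞ := by
  have hs : Summable b := by
    rw [← summable_nat_add_iff 1]
    refine Summable.of_nonneg_of_le (fun n => (hb.1 _).le) (fun n => ?_)
      ((summable_nat_add_iff 1).2 hb.2)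
    have := (hb.1 (n + 1)).le
    push_cast
    nlinarith [(Nat.cast_nonneg n : (0 : ℝ) ≤ n)]
  have hs' : Summable fun n : ℕ => ((n : ℝ) + 1) * b n :=
    (hb.2.add hs).congr fun n => by ring
  have : ∑' p : ℕ × ℕ, ENNReal.ofReal (b (p.1 + p.2)) =
      ∑' n : ℕ, ENNReal.ofReal (((n : ℝ) + 1) * b n) := by
    rw [← (Finset.HasAntidiagonal.sigmaAntidiagonalEquivProd (A := ℕ)).tsum_eq, ENNReal.tsum_sigma']
    refine tsum_congr fun n => ?_
    rw [tsum_fintype]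
    have : ∀ p : Finset.HasAntidiagonal.antidiagonal n,
        ENNReal.ofReal (b (p.1.1 + p.1.2)) = ENNReal.ofReal (b n) := fun p => by
      rw [Finset.HasAntidiagonal.mem_antidiagonal.1 p.2]
    simp only [Finset.HasAntidiagonal.sigmaAntidiagonalEquivProd_apply]
    rw [Finset.sum_congr rfl fun p _ => this p, Finset.sum_const, nsmul_eq_mul,
      ENNReal.ofReal_mul (by positivity)]
    congr 1
    rw [Finset.card_univ, Fintype.card_coe, Finset.Nat.card_antidiagonal]
    push_cast
    rw [ENNReal.ofReal_add (by positivity) zero_le_one]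
    simp
  rw [this]
  exact hs'.tsum_ofReal_ne_top

/-- Convergence of each coefficient suffices for convergence of Taylor series, because the distances
of the coefficients are cut off at the terms of a summable family. -/
theorem tendsto_taylorDist {b : ℕ → ℝ} (hb : IsLinearlySummable b) {ι : Type*} {F : Filter ι}
    [F.IsCountablyGenerated] {S : ι → TaylorSeries} {S₀ : TaylorSeries}
    (h : ∀ i j, Tendsto (fun a => coeffXY (S a).1 i j) F (𝓝 (coeffXY S₀.1 i j))) :
    Tendsto (fun a => taylorDist b S₀ (S a)) F (𝓝 0) := by
  have hdiff : ∀ i j, Tendsto (fun a => |coeffXY S₀.1 i j - coeffXY (S a).1 i j|) F (𝓝 0) :=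
    fun i j => by
      simpa using ((tendsto_const_nhds (x := coeffXY S₀.1 i j)).sub (h i j)).abs
  have hmin : ∀ i j (c : ℝ), 0 ≤ c →
      Tendsto (fun a => ENNReal.ofReal (min |coeffXY S₀.1 i j - coeffXY (S a).1 i j| c)) F (𝓝 0) := by
    intro i j c hc
    have := ENNReal.tendsto_ofReal ((hdiff i j).min (tendsto_const_nhds (x := c)))
    rwa [min_eq_left hc, ENNReal.ofReal_zero] at this
  have h1 : Tendsto (fun a => ∑' p : ℕ × ℕ, if p = (0, 1) then 0 else
      ENNReal.ofReal (min |coeffXY S₀.1 p.1 p.2 - coeffXY (S a).1 p.1 p.2| (b (p.1 + p.2)))) F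
      (𝓝 0) := by
    have h2 : ∫⁻ _p : ℕ × ℕ, (0 : ℝ≥0∞) ∂Measure.count = 0 := by simp
    rw [← congrArg 𝓝 h2]
    simp only [← lintegral_count]
    refine tendsto_lintegral_filter_of_dominated_convergence
      (fun p : ℕ × ℕ => ENNReal.ofReal (b (p.1 + p.2))) ?_ ?_ ?_ ?_
    · exact Eventually.of_forall fun a => Measurable.of_discrete
    · refine Eventually.of_forall fun a => Eventually.of_forall fun p => ?_
      split_ifs
      · exact zero_le
      · exact ENNReal.ofReal_le_ofReal (min_le_right _ _)
    · rw [lintegral_count]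
      exact hb.tsum_add_ne_top
    · refine Eventually.of_forall fun p => ?_
      by_cases hp : p = (0, 1)
      · simp only [hp, if_true]
        exact tendsto_const_nhds
      · simp only [hp, if_false]
        exact hmin _ _ _ (hb.1 _).le
  have h3 : Tendsto (fun a => ENNReal.ofReal (min |coeffXY S₀.1 0 1 - coeffXY (S a).1 0 1|
      (min (2 * Real.pi - |coeffXY S₀.1 0 1 - coeffXY (S a).1 0 1|) (b 1)))) F (𝓝 0) := by
    refine tendsto_of_tendsto_of_tendsto_of_le_of_le tendsto_const_nhds
      (hmin 0 1 (b 1) (hb.1 1).le) (fun a => zero_le) fun a => ENNReal.ofReal_le_ofReal ?_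
    exact min_le_min_left _ (min_le_right _ _)
  have h4 := h1.add h3
  rwa [add_zero] at h4

theorem coeffXY_lerp (S S' : MvPowerSeries (Fin 2) ℝ) (t : ℝ) (i j : ℕ) :
    coeffXY ((1 - t) • S + t • S') i j = (1 - t) * coeffXY S i j + t * coeffXY S' i j := by
  simp [coeffXY]

/-- Linear interpolation of Taylor series. -/
def TaylorSeries.lerp (S S' : TaylorSeries) (t : unitInterval) : TaylorSeries :=
  ⟨(1 - t : ℝ) • S.1 + (t : ℝ) • S'.1, by rw [coeffXY_lerp, S.2.1, S'.2.1]; simp, by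
    rw [coeffXY_lerp]
    exact convex_Ico 0 (2 * Real.pi) S.2.2 S'.2.2 (by linarith [t.2.2]) t.2.1 (by ring)⟩

theorem TaylorSeries.lerp_zero (S S' : TaylorSeries) : S.lerp S' 0 = S :=
  Subtype.ext (by simp [TaylorSeries.lerp])

theorem TaylorSeries.lerp_one (S S' : TaylorSeries) : S.lerp S' 1 = S' :=
  Subtype.ext (by simp [TaylorSeries.lerp])

theorem TaylorSeries.lerp_self (S : TaylorSeries) (t : unitInterval) : S.lerp S t = S :=
  Subtype.ext (by simp [TaylorSeries.lerp, ← add_smul])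

theorem TaylorSeries.tendsto_lerp {b : ℕ → ℝ} (hb : IsLinearlySummable b) (S S' : TaylorSeries)
    (t₀ : unitInterval) :
    Tendsto (fun t => taylorDist b (S.lerp S' t₀) (S.lerp S' t)) (𝓝 t₀) (𝓝 0) := by
  refine tendsto_taylorDist hb fun i j => ?_
  simp only [TaylorSeries.lerp, coeffXY_lerp]
  have : Continuous fun t : unitInterval =>
      (1 - (t : ℝ)) * coeffXY S.1 i j + t * coeffXY S'.1 i j := by fun_prop
  exact this.tendsto t₀

/-! ### Orbits, shears and heights -/

theorem smul_one_eq {m : ℕ} (c : ℤ) (w : WeightedRegion m) :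
    ((1 : Fin m → ℤˣ), Multiplicative.ofAdd c) • w =
      ⟨shear c '' w.region, w.line, w.sign, fun j => c + w.label j⟩ := by
  refine WeightedRegion.ext ?_ rfl (one_mul _) rfl
  change multiShear w.line (flipExponent w.sign 1) '' (shear c '' w.region) = shear c '' w.region
  have : multiShear w.line (flipExponent w.sign 1) = id := by
    funext p
    simp [multiShear_apply, flipExponent]
  rw [this, Set.image_id]

/-- Regions in the same orbit, with all signs equal to one, differ by a shear of the plane. -/
theorem eq_smul_of_mem_orbit {m : ℕ} {w w' : WeightedRegion m} (hw : ∀ j, w.sign j = 1)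
    (hw' : ∀ j, w'.sign j = 1)
    (h : w' ∈ MulAction.orbit ((Fin m → ℤˣ) × Multiplicative ℤ) w) :
    ∃ c : ℤ, w' = ((1 : Fin m → ℤˣ), Multiplicative.ofAdd c) • w := by
  obtain ⟨⟨e, c⟩, rfl⟩ := h
  refine ⟨Multiplicative.toAdd c, ?_⟩
  have he : e = 1 := by
    funext j
    have h1 : e j * w.sign j = 1 := hw' j
    rwa [hw j, mul_one] at h1
  rw [he]
  rfl

theorem volume_snd_shear (c : ℤ) (Δ : Set (ℝ × ℝ)) (x : ℝ) :
    volume (Prod.snd '' (shear c '' Δ ∩ verticalLine x)) =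
      volume (Prod.snd '' (Δ ∩ verticalLine x)) := by
  have : Prod.snd '' (shear c '' Δ ∩ verticalLine x) =
      (fun y => y + c * x) '' (Prod.snd '' (Δ ∩ verticalLine x)) := by
    ext y
    constructor
    · rintro ⟨_, ⟨⟨p, hp, rfl⟩, hx⟩, rfl⟩
      have hx' : p.1 = x := hx
      exact ⟨p.2, ⟨p, ⟨hp, hx⟩, rfl⟩, by simp [shear, hx']⟩
    · rintro ⟨_, ⟨p, ⟨hp, hx⟩, rfl⟩, rfl⟩
      have hx' : p.1 = x := hx
      exact ⟨shear c p, ⟨⟨p, hp, rfl⟩, hx⟩, by simp [shear, hx']⟩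
  rw [this, Set.image_add_right, measure_preimage_add_right]

theorem volume_snd_band {D : Set ℝ} {lo hi : ℝ → ℝ} {x : ℝ} (hx : x ∈ D) :
    volume (Prod.snd '' (band D lo hi ∩ verticalLine x)) = ENNReal.ofReal (hi x - lo x) := by
  have : Prod.snd '' (band D lo hi ∩ verticalLine x) = Set.Icc (lo x) (hi x) := by
    ext y
    constructor
    · rintro ⟨p, ⟨hp, hpx⟩, rfl⟩
      have hx' : p.1 = x := hpx
      rw [← hx']
      exact hp.2
    · exact fun hy => ⟨(x, y), ⟨⟨hx, hy⟩, rfl⟩, rfl⟩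
  rw [this, Real.volume_Icc]

theorem SupportData.IsCompatible.volume_snd {m : ℕ} {θ : SupportData m} {N : ℕ}
    (h : θ.IsCompatible N) (k : Fin m → ℤ) (j : Fin m) :
    volume (Prod.snd '' ((θ.poly N k).region ∩ verticalLine (θ.line j))) =
      ENNReal.ofReal (θ.height N j) := by
  refine (volume_snd_band (lo := fun x => -envelope N θ.bot x) (hi := θ.hi N)
    (Set.Ioo_subset_Icc_self (h.line_mem j))).trans ?_
  rw [sub_neg_eq_add]
  rfl

/-- The list of ingredients with a given primitive representative. -/
def ofPrimitive {m : ℕ} {k : Fin m → ℤ} (w : WeightedRegion m) (hw : IsPrimitiveSemitoric w)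
    (hk : w.label = k) (y : Fin m → ℝ) (hy : ∀ j, 0 < y j)
    (hlt : ∀ j, ENNReal.ofReal (y j) <
      volume (Prod.snd '' (w.region ∩ verticalLine (w.line j))))
    (S : Fin m → TaylorSeries) : IngredientsIndex m k :=
  ⟨{ polygon := MulAction.orbit ((Fin m → ℤˣ) × Multiplicative ℤ) w
     polygon_mem := Set.mem_iUnion.2 ⟨k, w, hw, hk, rfl⟩
     height := y
     height_pos := hy
     height_lt := fun w' h hw' j => by
      obtain ⟨c, rfl⟩ := eq_smul_of_mem_orbit hw.sign_eq_one hw'.sign_eq_one h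
      rw [smul_one_eq, volume_snd_shear]
      exact hlt j
     taylor := S }, w, hw, hk, rfl⟩

theorem exists_eq_ofPrimitive {m : ℕ} {k : Fin m → ℤ} (a : IngredientsIndex m k) :
    ∃ w hw hk y hy hlt S, a = ofPrimitive w hw hk y hy hlt S := by
  obtain ⟨⟨O, hO, y, hy, hlt, S⟩, w, hw, hk, h⟩ := a
  have hO' : O = MulAction.orbit ((Fin m → ℤˣ) × Multiplicative ℤ) w := h
  subst hO'
  exact ⟨w, hw, hk, y, hy, hlt w (MulAction.mem_orbit_self w) hw, S, rfl⟩

theorem ofPrimitive_congr {m : ℕ} {k : Fin m → ℤ} {w w' : WeightedRegion m}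
    {hw : IsPrimitiveSemitoric w} {hw' : IsPrimitiveSemitoric w'} {hk : w.label = k}
    {hk' : w'.label = k} {y y' : Fin m → ℝ} {hy hy' hlt hlt'} {S S' : Fin m → TaylorSeries}
    (h1 : w = w') (h2 : y = y') (h3 : S = S') :
    ofPrimitive w hw hk y hy hlt S = ofPrimitive w' hw' hk' y' hy' hlt' S' := by
  subst h1 h2 h3
  rfl

/-- Convergence of lists of ingredients follows from that of primitive representatives. -/
theorem tendsto_ingredientsDist {ν : Measure (ℝ × ℝ)} {b : ℕ → ℝ} {m : ℕ} {k : Fin m → ℤ}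
    {ι : Type*} {F : Filter ι} {a : Ingredients m} {a' : ι → Ingredients m} {w : WeightedRegion m}
    {w' : ι → WeightedRegion m} (hw : IsPrimitiveSemitoric w) (hk : w.label = k)
    (ha : a.polygon = MulAction.orbit ((Fin m → ℤˣ) × Multiplicative ℤ) w)
    (hw' : ∀ i, IsPrimitiveSemitoric (w' i)) (hk' : ∀ i, (w' i).label = k)
    (ha' : ∀ i, (a' i).polygon = MulAction.orbit ((Fin m → ℤˣ) × Multiplicative ℤ) (w' i))
    (h1 : Tendsto (fun i => regionDist ν w (w' i)) F (𝓝 0))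
    (h2 : ∀ j, Tendsto (fun i => (a' i).height j) F (𝓝 (a.height j)))
    (h3 : ∀ j, Tendsto (fun i => taylorDist b (a.taylor j) ((a' i).taylor j)) F (𝓝 0)) :
    Tendsto (fun i => ingredientsDist ν b k a (a' i)) F (𝓝 0) := by
  have h4 : Tendsto (fun i => ∑ j, (taylorDist b (a.taylor j) ((a' i).taylor j) +
      ENNReal.ofReal |a.height j - (a' i).height j|)) F (𝓝 0) := by
    have h0 : ∑ _j : Fin m, (0 : ℝ≥0∞) = 0 := by simp
    rw [← congrArg 𝓝 h0]
    refine tendsto_finsetSum _ fun j _ => ?_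
    have h5 : Tendsto (fun i => |a.height j - (a' i).height j|) F (𝓝 0) := by
      simpa using ((tendsto_const_nhds (x := a.height j)).sub (h2 j)).abs
    have h6 := ENNReal.tendsto_ofReal h5
    rw [ENNReal.ofReal_zero] at h6
    have := (h3 j).add h6
    rwa [add_zero] at this
  have h5 := h1.add h4
  rw [add_zero] at h5
  refine tendsto_of_tendsto_of_tendsto_of_le_of_le tendsto_const_nhds h5 (fun i => zero_le)
    fun i => add_le_add_left ?_ _
  rw [ha, ha' i]
  exact iInf_le_of_le w <| iInf_le_of_le (w' i) <|
    iInf_le_of_le ⟨MulAction.mem_orbit_self w, hw, hk⟩ <|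
    iInf_le_of_le ⟨MulAction.mem_orbit_self (w' i), hw' i, hk' i⟩ le_rfl

/-! ### Paths of lists of ingredients -/

namespace SupportData

variable {m : ℕ} {θ θ' : SupportData m} {N N' : ℕ}

/-- The list of ingredients with a smooth polygon as its primitive representative. -/
def IsSmooth.ingredients (h : IsSmooth θ N) (k : Fin m → ℤ) {y : Fin m → ℝ}
    (hy : ∀ j, y j ∈ Set.Ioo 0 (θ.height N j)) (S : Fin m → TaylorSeries) :
    IngredientsIndex m k :=
  ofPrimitive (θ.poly N k) (h.isPrimitiveSemitoric k) rfl y (fun j => (hy j).1)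
    (fun j => (ENNReal.ofReal_lt_ofReal_iff ((hy j).1.trans (hy j).2)).2 (hy j).2 |>.trans_eq
      (h.toIsCompatible.volume_snd k j).symm) S

theorem IsSmooth.lerp_mem_height (h : IsSmooth θ N) (h' : IsSmooth θ' N') (hNN : N ≤ N')
    {y y' : Fin m → ℝ} (hy : ∀ j, y j ∈ Set.Ioo 0 (θ.height N j))
    (hy' : ∀ j, y' j ∈ Set.Ioo 0 (θ'.height N' j)) {t : ℝ} (ht : t ∈ Set.Icc (0 : ℝ) 1)
    (j : Fin m) :
    (1 - t) * y j + t * y' j ∈ Set.Ioo 0 ((segment θ θ' N t).height N' j) := by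
  constructor
  · have := lerp_lt_lerp ht (hy j).1 (hy' j).1
    linarith
  · have h1 := lerp_lt_lerp ht (hy j).2 (hy' j).2
    rw [← h.toIsCompatible.height_closure hNN j] at h1
    exact h1.trans_le (le_height_lerp h'.one_le _ _ j ht)

/-- The point of the path between two lists of ingredients with smooth polygons: the intercepts, the
heights and the Taylor series are interpolated linearly. -/
def segmentIngredients (h : IsSmooth θ N) (h' : IsSmooth θ' N') (hNN : N ≤ N') (k : Fin m → ℤ)
    {y y' : Fin m → ℝ} (hy : ∀ j, y j ∈ Set.Ioo 0 (θ.height N j))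
    (hy' : ∀ j, y' j ∈ Set.Ioo 0 (θ'.height N' j)) (S S' : Fin m → TaylorSeries)
    (t : unitInterval) : IngredientsIndex m k :=
  ofPrimitive ((segment θ θ' N t).poly N' k) (h.isPrimitiveSemitoric_segment h' hNN k t.2) rfl
    (fun j => (1 - t) * y j + t * y' j) (fun j => (h.lerp_mem_height h' hNN hy hy' t.2 j).1)
    (fun j => by
      have h1 := h.lerp_mem_height h' hNN hy hy' t.2 j
      exact (ENNReal.ofReal_lt_ofReal_iff (h1.1.trans h1.2)).2 h1.2 |>.trans_eq
        (((h.toIsCompatible.closure hNN).lerp h'.toIsCompatible t.2).volume_snd k j).symm)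
    (fun j => (S j).lerp (S' j) t)

/-- The path between two lists of ingredients with smooth polygons. -/
def segmentPath {ν : Measure (ℝ × ℝ)} (hν : IsAdmissible ν) {b : ℕ → ℝ}
    (hb : IsLinearlySummable b) (h : IsSmooth θ N) (h' : IsSmooth θ' N') (hNN : N ≤ N')
    (k : Fin m → ℤ) {y y' : Fin m → ℝ} (hy : ∀ j, y j ∈ Set.Ioo 0 (θ.height N j))
    (hy' : ∀ j, y' j ∈ Set.Ioo 0 (θ'.height N' j)) (S S' : Fin m → TaylorSeries) :
    @Path (IngredientsIndex m k) (ingredientsTopology ν b m k) (h.ingredients k hy S)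
      (h'.ingredients k hy' S') :=
  letI := ingredientsTopology ν b m k
  { toFun := segmentIngredients h h' hNN k hy hy' S S'
    continuous_toFun := by
      have hprim := fun t : unitInterval => h.isPrimitiveSemitoric_segment h' hNN k t.2
      refine continuous_topologyOfDist fun t₀ => tendsto_ingredientsDist (hprim t₀) rfl rfl
        hprim (fun _ => rfl) (fun _ => rfl) ?_ (fun j => ?_)
        fun j => TaylorSeries.tendsto_lerp hb (S j) (S' j) t₀
      · refine (tendsto_regionDist_lerp hν h'.one_le (θ.closure N) θ' k t₀.2
          (hprim t₀).isLabeledWeighted.isPolygon.convex_isClosed.1).comp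
          (tendsto_nhdsWithin_iff.2 ⟨continuous_subtype_val.tendsto t₀,
            Eventually.of_forall fun t => t.2⟩)
      · have : Continuous fun t : unitInterval => (1 - (t : ℝ)) * y j + t * y' j := by fun_prop
        exact this.tendsto t₀
    source' := ofPrimitive_congr
      (by
        have h0 : ((0 : unitInterval) : ℝ) = 0 := rfl
        rw [h0, segment, lerp_zero, h.toIsCompatible.poly_closure hNN])
      (by simp) (by simp [TaylorSeries.lerp_zero])
    target' := ofPrimitive_congr
      (by
        have h0 : ((1 : unitInterval) : ℝ) = 1 := rfl
        rw [h0, segment, lerp_one])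
      (by simp) (by simp [TaylorSeries.lerp_one]) }

/-- Any two lists of ingredients with smooth polygons can be joined. -/
theorem IsSmooth.joined {ν : Measure (ℝ × ℝ)} (hν : IsAdmissible ν) {b : ℕ → ℝ}
    (hb : IsLinearlySummable b) (h : IsSmooth θ N) (h' : IsSmooth θ' N') (k : Fin m → ℤ)
    {y y' : Fin m → ℝ} (hy : ∀ j, y j ∈ Set.Ioo 0 (θ.height N j))
    (hy' : ∀ j, y' j ∈ Set.Ioo 0 (θ'.height N' j)) (S S' : Fin m → TaylorSeries) :
    @Joined (IngredientsIndex m k) (ingredientsTopology ν b m k) (h.ingredients k hy S)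
      (h'.ingredients k hy' S') := by
  let := ingredientsTopology ν b m k
  rcases le_total N N' with hNN | hNN
  · exact ⟨segmentPath hν hb h h' hNN k hy hy' S S'⟩
  · exact ⟨(segmentPath hν hb h' h hNN k hy' hy S' S).symm⟩

/-- Smooth support data with the slopes `-1`, `0` and `1` exist. -/
theorem exists_isSmooth (m : ℕ) : ∃ θ : SupportData m, θ.IsSmooth 1 := by
  set c : ℝ → ℝ := fun s => (m + 2) + 1 / 4 * s ^ 2 with hc
  set l : Fin m → ℝ := fun j => -1 + 2 * ((j : ℝ) + 1) / (m + 2) with hl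
  have hconv : StrictConvexOn ℝ Set.univ c := by
    have h1 : StrictConvexOn ℝ Set.univ fun s : ℝ => s ^ 2 :=
      Even.strictConvexOn_pow even_two two_ne_zero
    have h2 : StrictConvexOn ℝ Set.univ fun s : ℝ => 1 / 4 * s ^ 2 := by
      refine ⟨convex_univ, fun x hx y hy hxy a b ha hb hab => ?_⟩
      have := h1.2 hx hy hxy ha hb hab
      simp only [smul_eq_mul] at this ⊢
      linarith
    exact (h2.add_const ((m : ℝ) + 2)).congr fun s _ => by
      simp only [hc, Pi.add_apply]; ring
  have hm : (0 : ℝ) < m + 2 := by positivity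
  have hline : ∀ j, l j ∈ Set.Ioo (-1 : ℝ) 1 := fun j => by
    have hj : ((j : ℕ) : ℝ) + 1 ≤ m := by exact_mod_cast j.2
    have h0 : (0 : ℝ) ≤ (j : ℕ) := Nat.cast_nonneg _
    constructor
    · have : 0 < 2 * (((j : ℕ) : ℝ) + 1) / (m + 2) := by positivity
      simp only [hl]; linarith
    · have : 2 * (((j : ℕ) : ℝ) + 1) / (m + 2) < 2 := by
        rw [div_lt_iff₀ hm]; linarith
      simp only [hl]; linarith
  have hmono : StrictMono l := fun i j hij => by
    have : ((i : ℕ) : ℝ) < (j : ℕ) := by exact_mod_cast hij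
    have h2 := div_lt_div_of_pos_right (by linarith : 2 * (((i : ℕ) : ℝ) + 1) < 2 * ((j : ℕ) + 1)) hm
    simp only [hl]; linarith
  have hkink : kinkSum l 1 ≤ m * 2 := by
    unfold kinkSum
    refine (Finset.sum_le_card_nsmul _ _ 2 fun j _ => ?_).trans_eq (by simp)
    exact max_le (by linarith [(hline j).1]) zero_le_two
  have hlt1 : ∀ s ∈ Set.Ico (-1 : ℝ) 1, c 1 + 1 * -1 < c s + s * -1 := fun s hs => by
    have h2 := hs.2
    simp only [hc]
    nlinarith [hs.1, mul_pos (by linarith : 0 < 1 - s) (by linarith [hs.1] : 0 < 3 - s)]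
  have hlt2 : ∀ s ∈ Set.Ioc (-1 : ℝ) 1, c (-1) - 1 * 1 < c s + s * 1 := fun s hs => by
    have h2 := hs.1
    simp only [hc]
    nlinarith [hs.2, mul_pos (by linarith : 0 < 1 + s) (by linarith [hs.1] : 0 < 3 + s)]
  have hle1 : ∀ s ∈ Set.Icc (-1 : ℝ) 1, c 1 + 1 * -1 ≤ c s + s * -1 := fun s hs => by
    rcases hs.2.eq_or_lt with rfl | h
    · linarith
    · exact (hlt1 s ⟨hs.1, h⟩).le
  have hle2 : ∀ s ∈ Set.Icc (-1 : ℝ) 1, c (-1) - 1 * 1 ≤ c s + s * 1 := fun s hs => by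
    rcases hs.1.eq_or_lt with rfl | h
    · linarith
    · exact (hlt2 s ⟨h, hs.2⟩).le
  have hm0 : (0 : ℝ) ≤ m := Nat.cast_nonneg m
  refine ⟨⟨-1, 1, c, c, l⟩, ⟨⟨le_rfl, hconv.convexOn, hconv.convexOn, ?_, ?_, ?_, ?_, hmono, hline,
    by norm_num, ?_, ?_⟩, hconv, hconv, ?_, ?_, ?_, ?_⟩⟩
  all_goals simp only [Nat.cast_one]
  · exact hle1
  · exact hle2
  · exact hle1
  · exact hle2
  · simp only [hc]; linarith
  · simp only [hc]; linarith
  · exact hlt1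
  · exact hlt2
  · exact hlt1
  · exact hlt2

end SupportData

/-- The approximating polygons are at least as high above the marked lines as the original one, so that
heights of ingredients that are allowed for the latter are allowed for them. -/
theorem IsApproximation.le_height {m : ℕ} {w : WeightedRegion m} {I : Set ℝ} {lo hi : ℝ → ℝ}
    {θ : ℕ → SupportData m} {N : ℕ → ℕ} {L R M : ℕ → ℝ}
    (h : IsApproximation w I lo hi θ N L R M) (n : ℕ) (j : Fin m) :
    hi (w.line j) - lo (w.line j) ≤ (θ n).height (N n) j := by
  have h1 := le_envelope (h.smooth n).one_le fun s _ => h.top_lower n _ (h.line_mem n j) s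
  have h2 := le_envelope (h.smooth n).one_le fun s _ => h.bot_lower n _ (h.line_mem n j) s
  unfold SupportData.height SupportData.hi
  rw [h.line_eq n]
  linarith

/-- Every list of ingredients can be joined to one with a smooth polygon. -/
theorem exists_joined_isSmooth {ν : Measure (ℝ × ℝ)} (hν : IsAdmissible ν) {b : ℕ → ℝ}
    (hb : IsLinearlySummable b) {m : ℕ} {k : Fin m → ℤ} (a : IngredientsIndex m k) :
    ∃ (θ : SupportData m) (N : ℕ) (h : θ.IsSmooth N) (y : Fin m → ℝ)
      (hy : ∀ j, y j ∈ Set.Ioo 0 (θ.height N j)) (S : Fin m → TaylorSeries),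
      @Joined _ (ingredientsTopology ν b m k) a (h.ingredients k hy S) := by
  obtain ⟨w, hw, hk, y, hy, hlt, S, rfl⟩ := exists_eq_ofPrimitive a
  obtain ⟨I, lo, hi, hp⟩ := hw.exists_hasProfile
  obtain ⟨θ, N, L, R, M, h⟩ := hp.exists_isApproximation
  have hyθ : ∀ n j, y j ∈ Set.Ioo 0 ((θ n).height (N n) j) := fun n j => by
    refine ⟨hy j, lt_of_lt_of_le ?_ (h.le_height n j)⟩
    have h1 := hlt j
    rw [hp.region_eq, volume_snd_band (interior_subset (hp.line_mem j))] at h1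
    exact (ENNReal.ofReal_lt_ofReal_iff_of_nonneg (hy j).le).1 h1
  refine ⟨θ 0, N 0, h.smooth 0, y, hyθ 0, S, ?_⟩
  let := ingredientsTopology ν b m k
  refine joined_of_tendsto_paths (x := fun n => (h.smooth n).ingredients k (hyθ n) S)
    (fun n => SupportData.segmentPath hν hb (h.smooth n) (h.smooth (n + 1)) (h.N_mono n.le_succ) k
      (hyθ n) (hyθ (n + 1)) S S) ?_
  refine tendsto_nhds_topologyOfDist (tendsto_ingredientsDist hw hk rfl
    (fun p => (h.smooth p.1).isPrimitiveSemitoric_segment (h.smooth (p.1 + 1))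
      (h.N_mono p.1.le_succ) k p.2.2) (fun _ => rfl) (fun _ => rfl) ?_ (fun j => ?_) fun j => ?_)
  · refine (h.tendsto_regionDist hp hν k).comp
      (g := fun p : ℕ × ℝ => regionDist ν w
        ((SupportData.segment (θ p.1) (θ (p.1 + 1)) (N p.1) p.2).poly (N (p.1 + 1)) k))
      (f := fun p : ℕ × unitInterval => (p.1, (p.2 : ℝ))) ?_
    exact tendsto_fst.prodMk (tendsto_principal.2 (Eventually.of_forall fun p => p.2.2))
  · refine (tendsto_const_nhds (x := y j)).congr fun p => ?_
    change y j = (1 - (p.2 : ℝ)) * y j + p.2 * y j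
    ring
  · change Tendsto (fun p : ℕ × unitInterval => taylorDist b (S j) ((S j).lerp (S j) p.2)) _ _
    simp only [TaylorSeries.lerp_self]
    exact tendsto_taylorDist hb fun _ _ => tendsto_const_nhds

theorem pathConnectedSpace_ingredientsIndex {ν : Measure (ℝ × ℝ)} (hν : IsAdmissible ν) {b : ℕ → ℝ}
    (hb : IsLinearlySummable b) (m : ℕ) (k : Fin m → ℤ) :
    @PathConnectedSpace (IngredientsIndex m k) (ingredientsTopology ν b m k) := by
  let := ingredientsTopology ν b m k
  refine ⟨?_, fun a a' => ?_⟩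
  · obtain ⟨θ, h⟩ := SupportData.exists_isSmooth m
    have hpos : ∀ j, 0 < θ.height 1 j := fun j => by
      have := h.toIsCompatible.pos (Set.Ioo_subset_Icc_self (h.line_mem j))
      unfold SupportData.height
      linarith
    have hS : Nonempty TaylorSeries :=
      ⟨⟨0, by simp [coeffXY], by simp [coeffXY, Real.pi_pos]⟩⟩
    exact ⟨h.ingredients k (y := fun j => θ.height 1 j / 2)
      (fun j => ⟨half_pos (hpos j), half_lt_self (hpos j)⟩) fun _ => hS.some⟩
  · obtain ⟨θ, N, h, y, hy, S, hJ⟩ := exists_joined_isSmooth hν hb a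
    obtain ⟨θ', N', h', y', hy', S', hJ'⟩ := exists_joined_isSmooth hν hb a'
    exact (hJ.trans (h.joined hν hb h' k hy hy' S S')).trans hJ'.symm

/-! ### Shears preserve primitive semitoric polygons -/

/-- The shear `(Tᵗ)^c` as a linear automorphism of the plane. -/
def shearEquiv (c : ℤ) : (ℝ × ℝ) ≃L[ℝ] (ℝ × ℝ) :=
  LinearEquiv.toContinuousLinearEquiv
    { toFun := shear c
      invFun := shear (-c)
      map_add' := fun p q => by ext <;> simp [shear]; ring
      map_smul' := fun a p => by ext <;> simp [shear]; ring
      left_inv := fun p => by ext <;> simp [shear]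
      right_inv := fun p => by ext <;> simp [shear] }

theorem coe_shearEquiv (c : ℤ) : ⇑(shearEquiv c) = shear c := rfl

theorem dot_shear (c : ℤ) (n p : ℝ × ℝ) : dot (n.1 - c * n.2, n.2) (shear c p) = dot n p := by
  simp only [dot, shear]; ring

theorem mem_shear_image {c : ℤ} {Δ : Set (ℝ × ℝ)} {p : ℝ × ℝ} :
    shear c p ∈ shear c '' Δ ↔ p ∈ Δ :=
  (shearEquiv c).injective.mem_set_image

theorem vertices_shear (c : ℤ) (Δ : Set (ℝ × ℝ)) :
    vertices (shear c '' Δ) = shear c '' vertices Δ :=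
  (image_extremePoints (𝕜 := ℝ) (shearEquiv c) Δ).symm

theorem face_shear (c : ℤ) (Δ : Set (ℝ × ℝ)) (n : ℝ × ℝ) :
    face (shear c '' Δ) (n.1 - c * n.2, n.2) = shear c '' face Δ n := by
  ext q
  obtain ⟨p, rfl⟩ := (shearEquiv c).surjective q
  rw [coe_shearEquiv, mem_shear_image]
  simp only [face, Set.mem_ofPred_eq, mem_shear_image, Set.forall_mem_image, dot_shear]

theorem exists_eq_sub_mul (c : ℤ) (n : ℝ × ℝ) : ∃ n' : ℝ × ℝ, n = (n'.1 - c * n'.2, n'.2) :=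
  ⟨(n.1 + c * n.2, n.2), by ext <;> simp⟩

theorem topBoundary_shear (c : ℤ) (Δ : Set (ℝ × ℝ)) :
    topBoundary (shear c '' Δ) = shear c '' topBoundary Δ := by
  ext q
  obtain ⟨p, rfl⟩ := (shearEquiv c).surjective q
  rw [coe_shearEquiv, mem_shear_image]
  have : {y : ℝ | ((shear c p).1, y) ∈ shear c '' Δ} =
      OrderIso.addRight (c * p.1) '' {y : ℝ | (p.1, y) ∈ Δ} := by
    ext y
    obtain ⟨z, rfl⟩ := (OrderIso.addRight (c * p.1)).surjective y
    rw [(OrderIso.addRight (c * p.1)).injective.mem_set_image]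
    exact mem_shear_image (p := (p.1, z))
  unfold topBoundary
  rw [Set.mem_ofPred_eq, this]
  exact OrderIso.isLUB_image' (OrderIso.addRight (c * p.1))

theorem isPolygon_shear (c : ℤ) {Δ : Set (ℝ × ℝ)} (h : IsPolygon Δ) : IsPolygon (shear c '' Δ) := by
  obtain ⟨H, hH, hΔ⟩ := h.inter_halfPlanes
  refine ⟨⟨(fun a => ((a.1.1 - c * a.1.2, a.1.2), a.2)) '' H, ?_, ?_⟩, ?_, fun K hK => ?_⟩
  · rintro _ ⟨a, ha, rfl⟩ h0
    have h2 : a.1.2 = 0 := congrArg Prod.snd h0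
    have h1 : a.1.1 - c * a.1.2 = 0 := congrArg Prod.fst h0
    rw [h2, mul_zero, sub_zero] at h1
    exact hH a ha (Prod.ext h1 h2)
  · ext q
    obtain ⟨p, rfl⟩ := (shearEquiv c).surjective q
    rw [coe_shearEquiv, mem_shear_image, hΔ]
    simp only [Set.mem_ofPred_eq, Set.forall_mem_image, dot_shear]
  · have := (shearEquiv c).toHomeomorph.image_interior Δ
    have h2 : (shear c '' interior Δ) = interior (shear c '' Δ) := this
    rw [← h2]
    exact h.interior_nonempty.image _
  · have hK' := h.finite_vertices _ (hK.image (shearEquiv c).symm.continuous)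
    refine (hK'.image (shear c)).subset ?_
    rw [vertices_shear]
    rintro _ ⟨⟨p, hp, rfl⟩, hpK⟩
    exact ⟨p, ⟨hp, shear c p, hpK, (shearEquiv c).symm_apply_apply p⟩, rfl⟩

/-- The action of `(Tᵗ)^c` on normal vectors. -/
def normalShear (c : ℤ) (u : ℤ × ℤ) : ℤ × ℤ := (u.1 - c * u.2, u.2)

theorem det_normalShear (c : ℤ) (u v : ℤ × ℤ) :
    det (normalShear c u) (normalShear c v) = det u v := by
  simp only [det, normalShear]; ring

theorem matT_normalShear (c : ℤ) (v : ℤ × ℤ) : matT (normalShear c v) = normalShear c (matT v) := by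
  ext <;> simp only [matT, normalShear]; ring

theorem isEdgeNormalAt_shear (c : ℤ) {Δ : Set (ℝ × ℝ)} {p : ℝ × ℝ} {u : ℤ × ℤ}
    (h : IsEdgeNormalAt Δ p u) : IsEdgeNormalAt (shear c '' Δ) (shear c p) (normalShear c u) := by
  obtain ⟨h1, h2, h3⟩ := h
  have hface := face_shear c Δ ((u.1 : ℝ), (u.2 : ℝ))
  have hcast : (((normalShear c u).1 : ℝ), ((normalShear c u).2 : ℝ)) =
      ((u.1 : ℝ) - c * u.2, (u.2 : ℝ)) := by simp [normalShear]
  refine ⟨by simpa [normalShear] using h1, ?_, ?_⟩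
  · rw [hcast, hface]
    exact h2.image (shearEquiv c).injective
  · rw [hcast, hface]
    exact Set.mem_image_of_mem _ h3

theorem areCornerNormals_shear (c : ℤ) {Δ : Set (ℝ × ℝ)} {p : ℝ × ℝ} {u v : ℤ × ℤ}
    (h : AreCornerNormals Δ p u v) :
    AreCornerNormals (shear c '' Δ) (shear c p) (normalShear c u) (normalShear c v) :=
  ⟨isEdgeNormalAt_shear c h.1, isEdgeNormalAt_shear c h.2.1, by rw [det_normalShear]; exact h.2.2⟩

theorem IsPrimitiveSemitoric.smul_one {m : ℕ} {w : WeightedRegion m} (hw : IsPrimitiveSemitoric w)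
    (c : ℤ) : IsPrimitiveSemitoric (((1 : Fin m → ℤˣ), Multiplicative.ofAdd c) • w) := by
  have hmem : ∀ x p, shear c p ∈ topBoundary (shear c '' w.region) ∩ verticalLine x ↔
      p ∈ topBoundary w.region ∩ verticalLine x := fun x p => by
    rw [topBoundary_shear]
    exact and_congr mem_shear_image Iff.rfl
  rw [smul_one_eq]
  refine ⟨⟨isPolygon_shear c hw.isLabeledWeighted.isPolygon, fun n hn hne => ?_,
    hw.isLabeledWeighted.strictMono, fun j => ?_⟩, fun x => ?_, hw.sign_eq_one, fun j => ?_,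
    fun j q hq => ?_, fun q hq hqj => ?_⟩
  · obtain ⟨n', rfl⟩ := exists_eq_sub_mul c n
    have hn' : n' ≠ 0 := by
      rintro rfl
      exact hn (by simp)
    rw [face_shear, ← coe_shearEquiv, Set.image_nontrivial (shearEquiv c).injective] at hne
    obtain ⟨v, hv, hdot⟩ := hw.isLabeledWeighted.isRational n' hn' hne
    refine ⟨(v.1, v.2 + c * v.1), fun h0 => hv ?_, ?_⟩
    · have h1 : v.1 = 0 := congrArg Prod.fst h0
      have h2 : v.2 + c * v.1 = 0 := congrArg Prod.snd h0
      rw [h1, mul_zero, add_zero] at h2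
      exact Prod.ext h1 h2
    · rw [← dot_shear c] at hdot
      simpa [shear] using hdot
  · obtain ⟨⟨p, hp, h1⟩, q, hq, h2⟩ := hw.isLabeledWeighted.between j
    exact ⟨⟨_, Set.mem_image_of_mem _ hp, h1⟩, _, Set.mem_image_of_mem _ hq, h2⟩
  · have : shear c '' w.region ∩ verticalLine x = shear c '' (w.region ∩ verticalLine x) := by
      ext q
      obtain ⟨p, rfl⟩ := (shearEquiv c).surjective q
      rw [coe_shearEquiv, mem_shear_image]
      exact and_congr mem_shear_image Iff.rfl
    change IsCompact (shear c '' w.region ∩ verticalLine x)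
    rw [this]
    exact (hw.finiteHeight x).image (shearEquiv c).continuous
  · obtain ⟨p, hp⟩ := hw.line_meets_top j
    exact ⟨shear c p, (hmem _ p).2 hp⟩
  · obtain ⟨p, rfl⟩ := (shearEquiv c).surjective q
    have hp := (hmem _ p).1 hq
    obtain ⟨h1, h2⟩ := hw.hidden_or_fake j p hp
    refine ⟨?_, ?_⟩
    · change shear c p ∈ vertices (shear c '' w.region)
      rw [vertices_shear]
      exact Set.mem_image_of_mem _ h1
    · rcases h2 with ⟨_, u, v, huv, hdet⟩ | ⟨_, u, v, huv, hdet⟩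
      · exact Or.inl ⟨hq.1, _, _, areCornerNormals_shear c huv, by
          rw [matT_normalShear, det_normalShear, hdet]⟩
      · exact Or.inr ⟨hq.1, _, _, areCornerNormals_shear c huv, by
          rw [matT_normalShear, det_normalShear, hdet]⟩
  · obtain ⟨p, rfl⟩ := (shearEquiv c).surjective q
    have hp : p ∈ vertices w.region := by
      have hq' : shear c p ∈ vertices (shear c '' w.region) := hq
      rw [vertices_shear] at hq'
      exact mem_shear_image.1 hq'
    obtain ⟨u, v, huv, hdet⟩ := hw.delzant p hp fun j hj => hqj j ((hmem _ p).2 hj)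
    exact ⟨_, _, areCornerNormals_shear c huv, by rw [det_normalShear, hdet]⟩

/-! ### The classes of twisting indices -/

theorem DPolyg_subset_add {m : ℕ} (k : Fin m → ℤ) (c : ℤ) :
    DPolyg m k ⊆ DPolyg m fun j => c + k j := by
  rintro O ⟨w, hw, rfl, rfl⟩
  exact ⟨((1 : Fin m → ℤˣ), Multiplicative.ofAdd c) • w, hw.smul_one c, by rw [smul_one_eq],
    (MulAction.orbit_smul _ w).symm⟩

theorem DPolyg_add {m : ℕ} (k : Fin m → ℤ) (c : ℤ) :
    (DPolyg m fun j => c + k j) = DPolyg m k := by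
  refine Set.Subset.antisymm ?_ (DPolyg_subset_add k c)
  have := DPolyg_subset_add (fun j => c + k j) (-c)
  simpa using this

/-- Two sets of semitoric polygons with given twisting indices are equal or disjoint. -/
theorem DPolyg_eq_of_mem {m : ℕ} {k k' : Fin m → ℤ} {O : Set (WeightedRegion m)}
    (h : O ∈ DPolyg m k) (h' : O ∈ DPolyg m k') : DPolyg m k = DPolyg m k' := by
  obtain ⟨w, hw, rfl, rfl⟩ := h
  obtain ⟨w', hw', rfl, hO⟩ := h'
  have hmem : w' ∈ MulAction.orbit ((Fin m → ℤˣ) × Multiplicative ℤ) w := by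
    rw [hO]; exact MulAction.mem_orbit_self w'
  obtain ⟨c, rfl⟩ := eq_smul_of_mem_orbit hw.sign_eq_one hw'.sign_eq_one hmem
  rw [smul_one_eq]
  exact (DPolyg_add w.label c).symm

theorem mem_moduliIndex {m : ℕ} {k : Fin m → ℤ} {a : Ingredients m} :
    (⟨m, a⟩ : Moduli) ∈ ModuliIndex m k ↔ a ∈ IngredientsIndex m k := by
  refine ⟨?_, fun h => ⟨a, h, rfl⟩⟩
  rintro ⟨a', h, heq⟩
  rwa [← eq_of_heq (Sigma.mk.inj heq).2]

theorem moduliIndex_eq_of_mem {m m' : ℕ} {k : Fin m → ℤ} {k' : Fin m' → ℤ} {x : Moduli}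
    (h : x ∈ ModuliIndex m k) (h' : x ∈ ModuliIndex m' k') :
    ModuliIndex m k = ModuliIndex m' k' := by
  obtain ⟨a, ha, rfl⟩ := h
  have hm : m' = m := by
    obtain ⟨a', _, heq⟩ := h'
    exact (Sigma.mk.inj heq).1
  subst hm
  have ha' := mem_moduliIndex.1 h'
  unfold ModuliIndex IngredientsIndex
  rw [DPolyg_eq_of_mem ha ha']

theorem moduliIndex_add {m : ℕ} (k : Fin m → ℤ) (c : ℤ) :
    ModuliIndex m (fun j => c + k j) = ModuliIndex m k := by
  unfold ModuliIndex IngredientsIndex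
  rw [DPolyg_add]

theorem exists_mem_moduliIndex (x : Moduli) : ∃ k, x ∈ ModuliIndex x.1 k := by
  obtain ⟨m, a⟩ := x
  obtain ⟨k, hk⟩ := Set.mem_iUnion.1 a.polygon_mem
  exact ⟨k, a, hk, rfl⟩

theorem moduliIndex_zero (k : Fin 0 → ℤ) : ModuliIndex 0 k = ModuliComplexity 0 := by
  ext x
  constructor
  · rintro ⟨a, _, rfl⟩
    rfl
  · intro h
    obtain ⟨k', hk'⟩ := exists_mem_moduliIndex x
    obtain ⟨m, a⟩ := x
    have hm : m = 0 := h
    subst hm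
    rwa [Subsingleton.elim k k']

/-! ### Connected components -/

/-- The inclusion of a metric piece in the space of all lists of ingredients. -/
def toModuli {m : ℕ} {k : Fin m → ℤ} (a : IngredientsIndex m k) : Moduli := ⟨m, a.1⟩

theorem toModuli_mem {m : ℕ} {k : Fin m → ℤ} (a : IngredientsIndex m k) :
    toModuli a ∈ ModuliIndex m k := ⟨a.1, a.2, rfl⟩

/-- A set that contains or avoids each `ModuliIndex m k` is open. -/
theorem isOpen_moduli (ν : Measure (ℝ × ℝ)) (b : ℕ → ℝ) {U : Set Moduli}
    (hU : ∀ (m : ℕ) (k : Fin m → ℤ), ModuliIndex m k ⊆ U ∨ ModuliIndex m k ⊆ Uᶜ) :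
    IsOpen[moduliTopology ν b] U := by
  refine isOpen_iSup_iff.2 fun m => isOpen_iSup_iff.2 fun k => isOpen_coinduced.2 ?_
  let := ingredientsTopology ν b m k
  change IsOpen ((toModuli : IngredientsIndex m k → Moduli) ⁻¹' U)
  rcases hU m k with h | h
  · rw [Set.eq_univ_of_forall (s := toModuli ⁻¹' U) fun a => h (toModuli_mem a)]
    exact isOpen_univ
  · rw [Set.eq_empty_of_forall_notMem (s := toModuli ⁻¹' U) fun a ha => h (toModuli_mem a) ha]
    exact isOpen_empty

theorem isClopen_moduliIndex (ν : Measure (ℝ × ℝ)) (b : ℕ → ℝ) (m : ℕ) (k : Fin m → ℤ) :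
    @IsClopen _ (moduliTopology ν b) (ModuliIndex m k) := by
  let := moduliTopology ν b
  have h : ∀ (m' : ℕ) (k' : Fin m' → ℤ), ModuliIndex m' k' ⊆ ModuliIndex m k ∨
      ModuliIndex m' k' ⊆ (ModuliIndex m k)ᶜ := fun m' k' => by
    by_cases hx : ∃ x ∈ ModuliIndex m' k', x ∈ ModuliIndex m k
    · obtain ⟨x, h1, h2⟩ := hx
      exact Or.inl (moduliIndex_eq_of_mem h1 h2).subset
    · push Not at hx
      exact Or.inr hx
  exact ⟨⟨isOpen_moduli ν b fun m' k' => (compl_compl (ModuliIndex m k)).symm ▸ (h m' k').symm⟩,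
    isOpen_moduli ν b h⟩

theorem isPathConnected_moduliIndex {ν : Measure (ℝ × ℝ)} (hν : IsAdmissible ν) {b : ℕ → ℝ}
    (hb : IsLinearlySummable b) (m : ℕ) (k : Fin m → ℤ) :
    @IsPathConnected _ (moduliTopology ν b) (ModuliIndex m k) := by
  let := ingredientsTopology ν b m k
  let := moduliTopology ν b
  have := pathConnectedSpace_ingredientsIndex hν hb m k
  have hcont : Continuous (toModuli : IngredientsIndex m k → Moduli) :=
    continuous_iff_coinduced_le.2 (le_iSup₂_of_le (f := fun (m : ℕ) (k : Fin m → ℤ) =>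
      TopologicalSpace.coinduced (toModuli : IngredientsIndex m k → Moduli)
        (ingredientsTopology ν b m k)) m k le_rfl)
  have hrange : ModuliIndex m k = Set.range (toModuli : IngredientsIndex m k → Moduli) :=
    Set.image_eq_range _ _
  rw [hrange]
  exact isPathConnected_range hcont

theorem connectedComponent_moduli {ν : Measure (ℝ × ℝ)} (hν : IsAdmissible ν) {b : ℕ → ℝ}
    (hb : IsLinearlySummable b) {m : ℕ} {k : Fin m → ℤ} {x : Moduli} (hx : x ∈ ModuliIndex m k) :
    @connectedComponent _ (moduliTopology ν b) x = ModuliIndex m k := by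
  let := moduliTopology ν b
  exact ((isClopen_moduliIndex ν b m k).connectedComponent_subset hx).antisymm
    ((isPathConnected_moduliIndex hν hb m k).isConnected.isPreconnected.subset_connectedComponent hx)

/-- The polygons are a continuous image of the lists of ingredients. -/
theorem pathConnectedSpace_DPolyg {ν : Measure (ℝ × ℝ)} (hν : IsAdmissible ν) {b : ℕ → ℝ}
    (hb : IsLinearlySummable b) (m : ℕ) (k : Fin m → ℤ) :
    @PathConnectedSpace (DPolyg m k) (polygonTopology ν m k) := by
  let := ingredientsTopology ν b m k
  let := polygonTopology ν m k
  have := pathConnectedSpace_ingredientsIndex hν hb m k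
  set f : IngredientsIndex m k → DPolyg m k := fun a => ⟨a.1.polygon, a.2⟩
  have hcont : Continuous f := by
    refine ⟨fun U hU a ha => ?_⟩
    obtain ⟨r, hr, hball⟩ := hU (f a) ha
    exact ⟨r, hr, fun a' h => hball _ (lt_of_le_of_lt le_self_add h)⟩
  refine Function.Surjective.pathConnectedSpace (f := f) ?_ hcont
  rintro ⟨O, w, hw, hk, rfl⟩
  obtain ⟨I, lo, hi, hp⟩ := hw.exists_hasProfile
  have hpos : ∀ j, 0 < hi (w.line j) - lo (w.line j) := fun j => sub_pos.2 (hp.lt _ (hp.line_mem j))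
  obtain ⟨a⟩ := PathConnectedSpace.nonempty (X := IngredientsIndex m k)
  exact ⟨ofPrimitive w hw hk (fun j => (hi (w.line j) - lo (w.line j)) / 2)
    (fun j => half_pos (hpos j)) (fun j => by
      rw [hp.region_eq, volume_snd_band (interior_subset (hp.line_mem j))]
      exact (ENNReal.ofReal_lt_ofReal_iff (hpos j)).2 (half_lt_self (hpos j))) a.1.taylor, rfl⟩

end Semitoric

end

theorem mainTheorem8 (ν : MeasureTheory.Measure (ℝ × ℝ)) (hν : Semitoric.IsAdmissible ν)
    (b : ℕ → ℝ) (hb : Semitoric.IsLinearlySummable b) :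
    (∀ (m : ℕ) (k : Fin m → ℤ),
      @PathConnectedSpace (Semitoric.DPolyg m k) (Semitoric.polygonTopology ν m k)) ∧
    (∀ (m : ℕ) (k : Fin m → ℤ),
      @PathConnectedSpace (Semitoric.IngredientsIndex m k)
        (Semitoric.ingredientsTopology ν b m k)) ∧
    (∀ (m : ℕ) (k : Fin m → ℤ),
      @IsPathConnected Semitoric.Moduli (Semitoric.moduliTopology ν b)
        (Semitoric.ModuliIndex m k)) ∧
    {C : Set Semitoric.Moduli |
        ∃ x, C = @connectedComponent Semitoric.Moduli (Semitoric.moduliTopology ν b) x} =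
      {C | ∃ (m : ℕ) (hm : 0 < m) (k : Fin m → ℤ), k ⟨0, hm⟩ = 0 ∧ C = Semitoric.ModuliIndex m k} ∪
        {Semitoric.ModuliComplexity 0} := by
  refine ⟨Semitoric.pathConnectedSpace_DPolyg hν hb,
    Semitoric.pathConnectedSpace_ingredientsIndex hν hb,
    Semitoric.isPathConnected_moduliIndex hν hb, Set.ext fun C => ⟨?_, ?_⟩⟩
  · rintro ⟨x, rfl⟩
    obtain ⟨k, hk⟩ := Semitoric.exists_mem_moduliIndex x
    rw [Semitoric.connectedComponent_moduli hν hb hk]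
    obtain ⟨m, a⟩ := x
    rcases Nat.eq_zero_or_pos m with rfl | hm
    · exact Or.inr (Semitoric.moduliIndex_zero k)
    · exact Or.inl ⟨m, hm, fun j => -k ⟨0, hm⟩ + k j, neg_add_cancel _,
        (Semitoric.moduliIndex_add k _).symm⟩
  · intro hC
    obtain ⟨m, k, rfl⟩ : ∃ (m : ℕ) (k : Fin m → ℤ), C = Semitoric.ModuliIndex m k := by
      rcases hC with ⟨m, _, k, _, rfl⟩ | rfl
      · exact ⟨m, k, rfl⟩
      · exact ⟨0, 0, (Semitoric.moduliIndex_zero 0).symm⟩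
    obtain ⟨x, hx, _⟩ := Semitoric.isPathConnected_moduliIndex hν hb m k
    exact ⟨x, (Semitoric.connectedComponent_moduli hν hb hx).symm⟩
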